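/- \textbf{Model.} A state $\omega\in\{0,1\}$ has prior $\Pr(\omega=1)=\pi\in(0,1)$. Each of one or two senders is independently informed with probability $p_i\in(0,1)$. An informed sender draws a signal $s$, independently across senders given $\omega$, from a density $f(\cdot\mid\omega)$; both densities have support $[\underline s,\overline s]\subseteq[0,1]$, and signals are labelled by private beliefs: $\Pr(\omega=1\mid s)=s$. An informed sender either discloses $s$ or sends the message $\phi$; an uninformed sender can only send $\phi$. The decision maker (DM) observes the messages, which are sent simultaneously, and forms her belief $\beta$ that $\omega=1$ by Bayes' rule (any disclosed signal, also off path, is taken as proof of that signal). All senders are biased upward: the payoff of a sender is $\beta$ minus a cost $c\in\mathbb R$ if he discloses. Equilibrium is perfect Bayesian equilibrium, possibly in mixed strategies. The DM has a set of actions and a von Neumann--Morgenstern utility $u_{DM}(a,\omega)$ such that an optimal action exists at every belief; her welfare is her ex-ante expected utility when she acts optimally. A threshold strategy with threshold $t\in[\underline s,\overline s]$ discloses signals above $t$ and conceals signals below $t$. \textbf{Statement.} Every equilibrium of the single-sender games and of the two-sender game is in threshold strategies; equilibria are identified with their thresholds. Each single-sender game has a smallest equilibrium threshold $\hat s_i^0$,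 which is the unique one if $c\le 0$. Moreover: 1. If $c=0$, then $(\hat s_1^0,\hat s_2^0)$ is the unique equilibrium of the two-sender game. The DM's welfare is higher in the two-sender game than in either single-sender game, strictly so unless one and the same action of the DM is optimal after all message pairs that are sent. 2. If $c<0$, then every equilibrium $(s_1,s_2)$ of the two-sender game satisfies $s_i\le\hat s_i^0$ for $i=1,2$, with $(s_1,s_2)=(\hat s_1^0,\hat s_2^0)$ if and only if $\hat s_1^0=\hat s_2^0=\underline s$. The DM's welfare is higher in any equilibrium of the two-sender game than in either single-sender game, strictly so unless one and the same action of the DM is optimal after all message pairs that are sent in that equilibrium. 3. If $c>0$, then every equilibrium $(s_1,s_2)$ of the two-sender game satisfies $s_i\ge\hat s_i^0$ for $i=1,2$. The pair $(\hat s_1^0,\hat s_2^0)$ is the only equilibrium of the two-sender game if and only if $\hat s_1^0=\hat s_2^0=\overline s$, and it is one of the equilibria if and only if $\hat s_1^0=\overline s$ or $\hat s_2^0=\overline s$. The DM's welfare in the best equilibrium of the two-sender game may be higher or lower than in the best equilibrium of either single-sender game: even with quadratic loss, $u_{DM}(a,\omega)=-(a-\omega)^2$ with $a\in[0,1]$,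 there are parameters ($\pi$, $f(\cdot\mid\omega)$, $p_1$, $p_2$ and $c>0$) for which the best equilibria exist and it is strictly higher than in both single-sender games, and parameters for which it is strictly lower than in both. -/

import Mathlib

open Set MeasureTheory

universe u

namespace Disclosure

noncomputable section

/-- The primitives that govern the state `ω ∈ {0, 1}` and the senders' signals: the common prior
probability of state `1`, and the densities `density ω` of an informed sender's signal in state `ω`.
Both signal distributions have support `[lo, hi] ⊆ [0, 1]`, and a signal is labelled by the
private belief that it induces: by Bayes' rule, the posterior on state `1` after `s` is `s`. -/
structure Environment where
  prior : ℝ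
  lo : ℝ
  hi : ℝ
  density : Fin 2 → ℝ → ℝ
  prior_mem : prior ∈ Ioo (0 : ℝ) 1
  lo_nonneg : 0 ≤ lo
  lo_lt_hi : lo < hi
  hi_le_one : hi ≤ 1
  measurable_density : ∀ ω, Measurable (density ω)
  density_nonneg : ∀ ω s, 0 ≤ density ω s
  density_eq_zero : ∀ ω s, s ∉ Icc lo hi → density ω s = 0
  integral_density : ∀ ω, ∫ s, density ω s = 1
  full_support : ∀ ω a b, lo ≤ a → a < b → b ≤ hi → 0 < ∫ s in a..b, density ω s
  private_belief : ∀ᵐ s, prior * density 1 s =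
    s * (prior * density 1 s + (1 - prior) * density 0 s)

/-- The decision maker's problem: a set of actions and a von Neumann-Morgenstern utility of actions
and states, such that every belief (probability of state `1`) admits an optimal action. -/
structure DecisionProblem : Type (u + 1) where
  Action : Type u
  utility : Action → Fin 2 → ℝ
  exists_optimal : ∀ μ ∈ Icc (0 : ℝ) 1, ∃ a, ∀ a',
    μ * utility a' 1 + (1 - μ) * utility a' 0 ≤ μ * utility a 1 + (1 - μ) * utility a 0

namespace DecisionProblem

variable (D : DecisionProblem.{u})

/-- Expected utility of an action under a belief. -/
def expectedUtility (μ : ℝ) (a : D.Action) : ℝ :=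
  μ * D.utility a 1 + (1 - μ) * D.utility a 0

/-- The action `a` is optimal at the belief `μ`. -/
def IsOptimal (μ : ℝ) (a : D.Action) : Prop :=
  ∀ a', D.expectedUtility μ a' ≤ D.expectedUtility μ a

/-- Expected utility of an optimal action under a belief. -/
def value (μ : ℝ) : ℝ := ⨆ a, D.expectedUtility μ a

end DecisionProblem

/-- Quadratic loss: the action is a number in `[0, 1]`, the utility is `-(a - ω) ^ 2`. -/
def quadraticLoss : DecisionProblem.{0} where
  Action := Icc (0 : ℝ) 1
  utility a ω := -((a : ℝ) - ((ω : ℕ) : ℝ)) ^ 2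
  exists_optimal μ hμ := ⟨⟨μ, hμ⟩, fun a' => by
    simp only [Fin.val_one, Fin.val_zero, Nat.cast_one, Nat.cast_zero]
    nlinarith [sq_nonneg ((a' : ℝ) - μ)]⟩

namespace Environment

variable (E : Environment)

/-- The prior probability of a state. -/
def stateProb (ω : Fin 2) : ℝ := if ω = 1 then E.prior else 1 - E.prior

/-! A message is an element of `Option ℝ`: `none` is nondisclosure, `some s` discloses the
signal `s`. A (possibly mixed) strategy is a function `σ` giving the probability `σ s` with
which an informed sender discloses the signal `s`; an uninformed sender must send `none`.
A sender is informed with probability `p`. -/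

/-- `σ` is a strategy. -/
def IsStrategy (σ : ℝ → ℝ) : Prop :=
  Measurable σ ∧ ∀ s ∈ Icc E.lo E.hi, σ s ∈ Icc (0 : ℝ) 1

/-- Probability of nondisclosure in state `ω`. -/
def silence (p : ℝ) (σ : ℝ → ℝ) (ω : Fin 2) : ℝ :=
  (1 - p) + p * ∫ s, (1 - σ s) * E.density ω s

/-- Expectation, conditional on state `ω`, of a function `g` of the sender's message. -/
def msgExp (p : ℝ) (σ : ℝ → ℝ) (ω : Fin 2) (g : Option ℝ → ℝ) : ℝ :=
  E.silence p σ ω * g none + p * ∫ s, σ s * E.density ω s * g (some s)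

/-- Likelihood of a message in state `ω`, up to a factor common to both states. A disclosed signal
`s` has density `p * σ s * density ω s`; as the private belief after `s` is `s`, this is
proportional to `s / prior` in state `1` and to `(1 - s) / (1 - prior)` in state `0`. The same
formula is used off path: any disclosed signal is taken as proof of that signal. -/
def likelihood (p : ℝ) (σ : ℝ → ℝ) (ω : Fin 2) : Option ℝ → ℝ
  | none => E.silence p σ ω
  | some s => if ω = 1 then s / E.prior else (1 - s) / (1 - E.prior)

/-- Bayesian belief of the decision maker facing a single sender, after message `m`. -/
def belief₁ (p : ℝ) (σ : ℝ → ℝ) (m : Option ℝ) : ℝ :=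
  E.prior * E.likelihood p σ 1 m /
    (E.prior * E.likelihood p σ 1 m + (1 - E.prior) * E.likelihood p σ 0 m)

/-- Bayesian belief of the decision maker facing two senders whose messages are independent
conditional on the state: `m` comes from the sender with `(p, σ)` and `n` from the sender with
`(q, τ)`. Exchanging the two senders does not change the belief. -/
def belief₂ (p : ℝ) (σ : ℝ → ℝ) (q : ℝ) (τ : ℝ → ℝ) (m n : Option ℝ) : ℝ :=
  E.prior * (E.likelihood p σ 1 m * E.likelihood q τ 1 n) /
    (E.prior * (E.likelihood p σ 1 m * E.likelihood q τ 1 n) +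
      (1 - E.prior) * (E.likelihood p σ 0 m * E.likelihood q τ 0 n))

/-- The message cost: `c` if a signal is disclosed, nothing otherwise. -/
def cost (c : ℝ) (m : Option ℝ) : ℝ := if m = none then 0 else c

/-- Payoff of an upward-biased single sender who sends message `m` while the decision maker
conjectures the strategy `σ`. -/
def payoff₁ (c p : ℝ) (σ : ℝ → ℝ) (m : Option ℝ) : ℝ := E.belief₁ p σ m - cost c m

/-- Expected payoff, in the two-sender game, of an upward-biased sender with `(p, σ)` who holds the
signal (private belief) `s` and sends message `m`, while the other sender plays `τ` and is
informed with probability `q`, and the decision maker conjectures `σ` and `τ`. -/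
def payoff₂ (c p : ℝ) (σ : ℝ → ℝ) (q : ℝ) (τ : ℝ → ℝ) (s : ℝ) (m : Option ℝ) : ℝ :=
  s * E.msgExp q τ 1 (fun n => E.belief₂ p σ q τ m n) +
    (1 - s) * E.msgExp q τ 0 (fun n => E.belief₂ p σ q τ m n) - cost c m

/-- The strategy `σ` is optimal when `π s m` is the payoff of an informed sender with signal `s` who
sends message `m`: every type uses only messages that are optimal for him. -/
def IsOptimalStrategy (σ : ℝ → ℝ) (π : ℝ → Option ℝ → ℝ) : Prop :=
  ∀ s ∈ Icc E.lo E.hi, (0 < σ s → π s none ≤ π s (some s)) ∧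
    (σ s < 1 → π s (some s) ≤ π s none)

/-- Perfect Bayesian equilibrium of the single-sender game. -/
def IsEquilibrium₁ (c p : ℝ) (σ : ℝ → ℝ) : Prop :=
  E.IsStrategy σ ∧ E.IsOptimalStrategy σ (fun _ m => E.payoff₁ c p σ m)

/-- Perfect Bayesian equilibrium of the two-sender game. -/
def IsEquilibrium₂ (c p₁ p₂ : ℝ) (σ₁ σ₂ : ℝ → ℝ) : Prop :=
  E.IsStrategy σ₁ ∧ E.IsStrategy σ₂ ∧
    E.IsOptimalStrategy σ₁ (fun s m => E.payoff₂ c p₁ σ₁ p₂ σ₂ s m) ∧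
    E.IsOptimalStrategy σ₂ (fun s m => E.payoff₂ c p₂ σ₂ p₁ σ₁ s m)

/-- `σ` discloses all signals above `t` and conceals all signals below `t`. (What the
threshold type does is immaterial, an event of probability zero.) -/
def HasThreshold (σ : ℝ → ℝ) (t : ℝ) : Prop :=
  t ∈ Icc E.lo E.hi ∧ ∀ s ∈ Icc E.lo E.hi, (t < s → σ s = 1) ∧ (s < t → σ s = 0)

/-- Equilibrium thresholds of the single-sender game. -/
def thresholds₁ (c p : ℝ) : Set ℝ :=
  {t | ∃ σ, E.IsEquilibrium₁ c p σ ∧ E.HasThreshold σ t}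

/-- Equilibrium threshold pairs of the two-sender game. -/
def thresholds₂ (c p₁ p₂ : ℝ) : Set (ℝ × ℝ) :=
  {e | ∃ σ₁ σ₂, E.IsEquilibrium₂ c p₁ p₂ σ₁ σ₂ ∧
    E.HasThreshold σ₁ e.1 ∧ E.HasThreshold σ₂ e.2}

/-- Ex-ante expected utility of the decision maker facing a single sender. -/
def welfare₁ (D : DecisionProblem.{u}) (p : ℝ) (σ : ℝ → ℝ) : ℝ :=
  ∑ ω, E.stateProb ω * E.msgExp p σ ω (fun m => D.value (E.belief₁ p σ m))

/-- Ex-ante expected utility of the decision maker facing two senders. -/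
def welfare₂ (D : DecisionProblem.{u}) (p₁ : ℝ) (σ₁ : ℝ → ℝ) (p₂ : ℝ) (σ₂ : ℝ → ℝ) : ℝ :=
  ∑ ω, E.stateProb ω * E.msgExp p₁ σ₁ ω (fun m₁ =>
    E.msgExp p₂ σ₂ ω (fun m₂ => D.value (E.belief₂ p₁ σ₁ p₂ σ₂ m₁ m₂)))

/-- The messages that are sent under the strategy `σ`. -/
def OnPath (σ : ℝ → ℝ) : Option ℝ → Prop
  | none => True
  | some s => s ∈ Icc E.lo E.hi ∧ 0 < σ s

/-- The senders' messages are of no use to the decision maker: one and the same action is optimal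
for her after all messages that are sent. -/
def MessagesUseless (D : DecisionProblem.{u}) (p₁ : ℝ) (σ₁ : ℝ → ℝ) (p₂ : ℝ) (σ₂ : ℝ → ℝ) : Prop :=
  ∃ a, ∀ m₁ m₂, E.OnPath σ₁ m₁ → E.OnPath σ₂ m₂ →
    D.IsOptimal (E.belief₂ p₁ σ₁ p₂ σ₂ m₁ m₂) a

/-- Every equilibrium of the two-sender game gives a decision maker with problem `D` a higher
welfare than every equilibrium of either single-sender game, and strictly so unless she has no
use for the messages. -/
def BetterWithTwo (D : DecisionProblem.{u}) (c p₁ p₂ : ℝ) : Prop :=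
  ∀ σ₁ σ₂, E.IsEquilibrium₂ c p₁ p₂ σ₁ σ₂ →
    ∀ p ∈ ({p₁, p₂} : Set ℝ), ∀ σ, E.IsEquilibrium₁ c p σ →
      E.welfare₁ D p σ ≤ E.welfare₂ D p₁ σ₁ p₂ σ₂ ∧
      (¬ E.MessagesUseless D p₁ σ₁ p₂ σ₂ → E.welfare₁ D p σ < E.welfare₂ D p₁ σ₁ p₂ σ₂)

/-- `w` is the decision maker's welfare in her best equilibrium of the single-sender game. -/
def IsBestWelfare₁ (D : DecisionProblem.{u}) (c p w : ℝ) : Prop :=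
  IsGreatest {v | ∃ σ, E.IsEquilibrium₁ c p σ ∧ v = E.welfare₁ D p σ} w

/-- `w` is the decision maker's welfare in her best equilibrium of the two-sender game. -/
def IsBestWelfare₂ (D : DecisionProblem.{u}) (c p₁ p₂ w : ℝ) : Prop :=
  IsGreatest {v | ∃ σ₁ σ₂, E.IsEquilibrium₂ c p₁ p₂ σ₁ σ₂ ∧ v = E.welfare₂ D p₁ σ₁ p₂ σ₂} w

end Environment

end

end Disclosure

/-!
The whole comparison rests on one identity. If a sender discloses his signal `s`, then his own
belief and the decision maker's are both `s`, and by the martingale property of beliefs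
(`mix_update`) he expects the posterior `s`, whatever the other sender does. If he stays silent, then
the decision maker starts from the belief `b` after silence, and the expected posterior of a type `s`
is `b + (s - b) κ`, where the *responsiveness* `κ ∈ [0, 1)` of the other sender is the difference
between the expected posteriors in the two states; it is the variance of the posterior up to a
factor (`mix_sq_eq`), hence zero only if the other sender discloses nothing. So disclosure is optimal
for `s` iff `(s - b) (1 - κ) ≥ c`: all best replies are threshold strategies, and equilibria are the
fixed points `t = b t + c / (1 - κ)`, truncated to the support (`mem_thresholds₁_iff` with `κ = 0`,
`mem_thresholds₂_iff`). A second sender thus scales the disclosure cost up by `1 / (1 - κ)`. If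
`c ≤ 0`, then the crossing of `t - c` and `b t` is unique because types between two candidates are
averaged into the belief after silence (`not_lt_of_silentBelief_add`), and scaling `c` lowers the
threshold. If `c > 0`, then a smallest fixed point exists by continuity, and scaling `c` up can only lead to
thresholds above it (`threshold₁_le_threshold₂`).

Welfare for `c ≤ 0` is compared in two steps: a lower threshold is a finer experiment
(`welfare₁_thr_anti`), and a further message never hurts (`welfare₁_le_welfare₂`). If the second
step is an equality, then for almost every disclosed signal `s` of the first sender, an action that is
optimal at `s` remains optimal after every message of the second one. These messages move
the posterior both above and below `s`, so the interval of beliefs at which a given action is optimal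
propagates over all signals that are disclosed (`Ioo_subset_of_propagation`), among which is, for
`c ≤ 0`, also the belief after silence; one action is then optimal throughout
(`messagesUseless_of_welfare_eq`).

For `c > 0`, a gain from the second sender survives from the costless case by continuity
(`exists_welfare_gain`). For a loss (`exists_welfare_loss`), the signals have a spike whose types are
barely willing to disclose when alone: the slightest responsiveness of the other sender makes both
senders conceal the spike, and hardly any probability is left above it. Best two-sender equilibria
exist because the set of equilibrium thresholds is compact and welfare is continuous on it
(`exists_isBestWelfare₂`).
-/

namespace Disclosure

namespace Environment

/-! ### Signal distributions -/

/-- The unconditional density of an informed sender's signal. -/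
noncomputable def marginal (E : Environment) (s : ℝ) : ℝ :=
  E.prior * E.density 1 s + (1 - E.prior) * E.density 0 s

variable (E : Environment)

lemma prior_pos : 0 < E.prior := E.prior_mem.1

lemma one_sub_prior_pos : 0 < 1 - E.prior := sub_pos.2 E.prior_mem.2

lemma Icc_subset_unit {s : ℝ} (hs : s ∈ Icc E.lo E.hi) : s ∈ Icc (0 : ℝ) 1 :=
  ⟨E.lo_nonneg.trans hs.1, hs.2.trans E.hi_le_one⟩

lemma integrable_density (ω : Fin 2) : Integrable (E.density ω) := by
  by_contra h
  have := E.integral_density ω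
  rw [integral_undef h] at this
  exact zero_ne_one this

lemma integrable_marginal : Integrable E.marginal :=
  ((E.integrable_density 1).const_mul _).add ((E.integrable_density 0).const_mul _)

lemma marginal_nonneg (s : ℝ) : 0 ≤ E.marginal s :=
  add_nonneg (mul_nonneg E.prior_pos.le (E.density_nonneg 1 s))
    (mul_nonneg E.one_sub_prior_pos.le (E.density_nonneg 0 s))

lemma marginal_eq_zero {s : ℝ} (hs : s ∉ Icc E.lo E.hi) : E.marginal s = 0 := by
  simp [marginal, E.density_eq_zero _ s hs]

lemma density_one_ae : ∀ᵐ s, E.prior * E.density 1 s = s * E.marginal s := E.private_belief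

lemma density_zero_ae : ∀ᵐ s, (1 - E.prior) * E.density 0 s = (1 - s) * E.marginal s := by
  filter_upwards [E.private_belief] with s hs
  simp only [marginal]
  linarith

lemma integral_marginal : ∫ s, E.marginal s = 1 := by
  simp only [marginal]
  rw [integral_add ((E.integrable_density 1).const_mul _) ((E.integrable_density 0).const_mul _),
    integral_const_mul, integral_const_mul, E.integral_density, E.integral_density]
  ring

/-- A bounded measurable function is integrable against a function supported on `[lo, hi]`. -/
lemma integrable_bdd_mul {g k : ℝ → ℝ} {C : ℝ} (hg : Measurable g)
    (hC : ∀ s ∈ Icc E.lo E.hi, |g s| ≤ C) (hk : Integrable k)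
    (hk0 : ∀ s, s ∉ Icc E.lo E.hi → k s = 0) : Integrable (fun s => g s * k s) := by
  refine Integrable.mono' (hk.norm.const_mul C) (hg.aestronglyMeasurable.mul hk.1)
    (Filter.Eventually.of_forall fun s => ?_)
  by_cases hs : s ∈ Icc E.lo E.hi
  · rw [norm_mul]
    exact mul_le_mul_of_nonneg_right (hC s hs) (norm_nonneg _)
  · simp [hk0 s hs]

lemma integrable_bdd_mul_density {g : ℝ → ℝ} {C : ℝ} (hg : Measurable g)
    (hC : ∀ s ∈ Icc E.lo E.hi, |g s| ≤ C) (ω : Fin 2) :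
    Integrable (fun s => g s * E.density ω s) :=
  E.integrable_bdd_mul hg hC (E.integrable_density ω) (E.density_eq_zero ω)

lemma integrable_bdd_mul_marginal {g : ℝ → ℝ} {C : ℝ} (hg : Measurable g)
    (hC : ∀ s ∈ Icc E.lo E.hi, |g s| ≤ C) : Integrable (fun s => g s * E.marginal s) :=
  E.integrable_bdd_mul hg hC E.integrable_marginal fun _ => E.marginal_eq_zero

/-- Full support, in measure-theoretic form: a property that fails only where the signal
density vanishes holds somewhere in each interval of signals. -/
lemma exists_of_ae {P : ℝ → Prop} {a b : ℝ} (ω : Fin 2) (ha : E.lo ≤ a) (hab : a < b)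
    (hb : b ≤ E.hi) (hP : ∀ᵐ s, s ∈ Ioo a b → ¬ P s → E.density ω s = 0) :
    ∃ s ∈ Ioo a b, P s := by
  by_contra! hcon
  have h := E.full_support ω a b ha hab hb
  rw [intervalIntegral.integral_of_le hab.le, integral_Ioc_eq_integral_Ioo] at h
  refine h.ne' ?_
  rw [setIntegral_eq_zero_of_ae_eq_zero]
  filter_upwards [hP] with s hs hmem using hs hmem (hcon s hmem)

/-- A nonnegative function that vanishes on an interval of signals only where the density does has a
positive integral. -/
lemma integral_pos_of_density {F : ℝ → ℝ} {a b : ℝ} (ω : Fin 2) (ha : E.lo ≤ a) (hab : a < b)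
    (hb : b ≤ E.hi) (hF : Integrable F) (hF0 : 0 ≤ᵐ[volume] F)
    (h : ∀ᵐ s, s ∈ Ioo a b → F s = 0 → E.density ω s = 0) : 0 < ∫ s, F s := by
  refine lt_of_le_of_ne (integral_nonneg_of_ae hF0) fun h0 => ?_
  have hz := (integral_eq_zero_iff_of_nonneg_ae hF0 hF).1 h0.symm
  obtain ⟨s, -, hs⟩ := E.exists_of_ae (P := fun _ => False) ω ha hab hb (by
    filter_upwards [hz, h] with s h1 h2 hs _ using h2 hs h1)
  exact hs

lemma density_eq_zero_of_marginal {s : ℝ} (h : E.marginal s = 0) (ω : Fin 2) :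
    E.density ω s = 0 := by
  have h1 := mul_nonneg E.prior_pos.le (E.density_nonneg 1 s)
  have h0 := mul_nonneg E.one_sub_prior_pos.le (E.density_nonneg 0 s)
  unfold marginal at h
  have e1 : E.prior * E.density 1 s = 0 := by linarith
  have e0 : (1 - E.prior) * E.density 0 s = 0 := by linarith
  fin_cases ω
  · simpa [E.one_sub_prior_pos.ne'] using e0
  · simpa [E.prior_pos.ne'] using e1

lemma integral_id_mul_marginal : ∫ s, s * E.marginal s = E.prior := by
  rw [← integral_congr_ae E.density_one_ae, integral_const_mul, E.integral_density, mul_one]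

lemma integrable_id_mul_marginal : Integrable fun s => s * E.marginal s :=
  E.integrable_bdd_mul_marginal (C := 1) measurable_id fun s hs => by
    obtain ⟨h0, h1⟩ := E.Icc_subset_unit hs
    rw [abs_le]
    constructor <;> linarith

lemma lo_lt_prior : E.lo < E.prior := by
  have h : 0 < ∫ s, (s * E.marginal s - E.lo * E.marginal s) := by
    refine E.integral_pos_of_density 1 le_rfl E.lo_lt_hi le_rfl
      (E.integrable_id_mul_marginal.sub (E.integrable_marginal.const_mul _))
      (Filter.Eventually.of_forall fun s => ?_) (Filter.Eventually.of_forall fun s hs h => ?_)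
    · by_cases hs : s ∈ Icc E.lo E.hi
      · have := mul_nonneg (sub_nonneg.2 hs.1) (E.marginal_nonneg s)
        simp only [Pi.zero_apply]
        linarith
      · simp [E.marginal_eq_zero hs]
    · refine E.density_eq_zero_of_marginal ?_ 1
      rw [← sub_mul] at h
      exact (mul_eq_zero.1 h).resolve_left (sub_pos.2 hs.1).ne'
  rw [integral_sub E.integrable_id_mul_marginal (E.integrable_marginal.const_mul _),
    integral_const_mul, E.integral_marginal, E.integral_id_mul_marginal] at h
  linarith

lemma prior_lt_hi : E.prior < E.hi := by
  have h : 0 < ∫ s, (E.hi * E.marginal s - s * E.marginal s) := by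
    refine E.integral_pos_of_density 1 le_rfl E.lo_lt_hi le_rfl
      ((E.integrable_marginal.const_mul _).sub E.integrable_id_mul_marginal)
      (Filter.Eventually.of_forall fun s => ?_) (Filter.Eventually.of_forall fun s hs h => ?_)
    · by_cases hs : s ∈ Icc E.lo E.hi
      · have := mul_nonneg (sub_nonneg.2 hs.2) (E.marginal_nonneg s)
        simp only [Pi.zero_apply]
        linarith
      · simp [E.marginal_eq_zero hs]
    · refine E.density_eq_zero_of_marginal ?_ 1
      rw [← sub_mul] at h
      exact (mul_eq_zero.1 h).resolve_left (sub_pos.2 hs.2).ne'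
  rw [integral_sub (E.integrable_marginal.const_mul _) E.integrable_id_mul_marginal,
    integral_const_mul, E.integral_marginal, E.integral_id_mul_marginal] at h
  linarith

/-! ### Expectations over messages -/

variable {E} {p q : ℝ} {σ τ : ℝ → ℝ}

lemma IsStrategy.abs_le (hσ : E.IsStrategy σ) {s : ℝ} (hs : s ∈ Icc E.lo E.hi) : |σ s| ≤ 1 := by
  obtain ⟨h0, h1⟩ := hσ.2 s hs
  rw [_root_.abs_le]
  constructor <;> linarith

lemma IsStrategy.integrable_mul_density (hσ : E.IsStrategy σ) (ω : Fin 2) :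
    Integrable fun s => σ s * E.density ω s :=
  E.integrable_bdd_mul_density hσ.1 (fun _ hs => hσ.abs_le hs) ω

lemma IsStrategy.integrable_mul_marginal (hσ : E.IsStrategy σ) :
    Integrable fun s => σ s * E.marginal s :=
  E.integrable_bdd_mul_marginal hσ.1 (fun _ hs => hσ.abs_le hs)

lemma IsStrategy.silence_eq (hσ : E.IsStrategy σ) (p : ℝ) (ω : Fin 2) :
    E.silence p σ ω = 1 - p * ∫ s, σ s * E.density ω s := by
  have : ∫ s, (1 - σ s) * E.density ω s = 1 - ∫ s, σ s * E.density ω s := by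
    simp only [sub_mul, one_mul]
    rw [integral_sub (E.integrable_density ω) (hσ.integrable_mul_density ω), E.integral_density]
  rw [silence, this]
  ring

lemma IsStrategy.mul_density_nonneg (hσ : E.IsStrategy σ) (ω : Fin 2) (s : ℝ) :
    0 ≤ σ s * E.density ω s := by
  by_cases hs : s ∈ Icc E.lo E.hi
  · exact mul_nonneg (hσ.2 s hs).1 (E.density_nonneg ω s)
  · simp [E.density_eq_zero ω s hs]

lemma IsStrategy.one_sub_le_silence (hσ : E.IsStrategy σ) (hp : p ∈ Ioo (0 : ℝ) 1) (ω : Fin 2) :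
    1 - p ≤ E.silence p σ ω := by
  have : 0 ≤ ∫ s, (1 - σ s) * E.density ω s := integral_nonneg fun s => by
    by_cases hs : s ∈ Icc E.lo E.hi
    · exact mul_nonneg (sub_nonneg.2 (hσ.2 s hs).2) (E.density_nonneg ω s)
    · simp [E.density_eq_zero ω s hs]
  have := mul_nonneg hp.1.le this
  rw [silence]
  linarith

lemma IsStrategy.silence_pos (hσ : E.IsStrategy σ) (hp : p ∈ Ioo (0 : ℝ) 1) (ω : Fin 2) :
    0 < E.silence p σ ω :=
  (sub_pos.2 hp.2).trans_le (hσ.one_sub_le_silence hp ω)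

lemma IsStrategy.silence_le_one (hσ : E.IsStrategy σ) (hp : p ∈ Ioo (0 : ℝ) 1) (ω : Fin 2) :
    E.silence p σ ω ≤ 1 := by
  have := mul_nonneg hp.1.le (integral_nonneg (μ := volume) (hσ.mul_density_nonneg ω))
  rw [hσ.silence_eq]
  linarith

/-- Message functions whose expectations are well behaved: measurable, and bounded on the signals
that occur. -/
def IsBddMsg (E : Environment) (g : Option ℝ → ℝ) : Prop :=
  Measurable (fun s => g (some s)) ∧ ∃ C, ∀ s ∈ Icc E.lo E.hi, |g (some s)| ≤ C

lemma IsBddMsg.integrable {g : Option ℝ → ℝ} (hg : E.IsBddMsg g) (hσ : E.IsStrategy σ)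
    (ω : Fin 2) : Integrable fun s => σ s * E.density ω s * g (some s) := by
  obtain ⟨hm, C, hC⟩ := hg
  have := E.integrable_bdd_mul (g := fun s => g (some s)) hm hC (hσ.integrable_mul_density ω)
    fun s hs => by simp [E.density_eq_zero ω s hs]
  simpa only [mul_comm] using this

lemma isBddMsg_of_unit {g : Option ℝ → ℝ} (hm : Measurable fun s => g (some s))
    (h : ∀ s ∈ Icc E.lo E.hi, g (some s) ∈ Icc (0 : ℝ) 1) : E.IsBddMsg g :=
  ⟨hm, 1, fun s hs => abs_le.2 ⟨by linarith [(h s hs).1], (h s hs).2⟩⟩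

lemma msgExp_congr {g g' : Option ℝ → ℝ} {ω : Fin 2} (h0 : g none = g' none)
    (h : ∀ s ∈ Icc E.lo E.hi, g (some s) = g' (some s)) :
    E.msgExp p σ ω g = E.msgExp p σ ω g' := by
  rw [msgExp, msgExp, h0]
  congr 2
  refine integral_congr_ae (Filter.Eventually.of_forall fun s => ?_)
  by_cases hs : s ∈ Icc E.lo E.hi
  · simp only [h s hs]
  · simp [E.density_eq_zero ω s hs]

lemma msgExp_add {g g' : Option ℝ → ℝ} (hσ : E.IsStrategy σ) (hg : E.IsBddMsg g)
    (hg' : E.IsBddMsg g') (ω : Fin 2) :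
    E.msgExp p σ ω (fun m => g m + g' m) = E.msgExp p σ ω g + E.msgExp p σ ω g' := by
  simp only [msgExp, mul_add]
  rw [integral_add (hg.integrable hσ ω) (hg'.integrable hσ ω)]
  ring

lemma msgExp_const_mul {g : Option ℝ → ℝ} (k : ℝ) (ω : Fin 2) :
    E.msgExp p σ ω (fun m => k * g m) = k * E.msgExp p σ ω g := by
  simp only [msgExp]
  have : (fun s => σ s * E.density ω s * (k * g (some s))) =
    fun s => k * (σ s * E.density ω s * g (some s)) := by funext s; ring
  rw [this, integral_const_mul]
  ring

lemma msgExp_const (hσ : E.IsStrategy σ) (k : ℝ) (ω : Fin 2) :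
    E.msgExp p σ ω (fun _ => k) = k := by
  rw [msgExp, integral_mul_const, hσ.silence_eq]
  ring

lemma silence_mul_le_msgExp {g : Option ℝ → ℝ} (hσ : E.IsStrategy σ) (hp : p ∈ Ioo (0 : ℝ) 1)
    (h : ∀ s ∈ Icc E.lo E.hi, 0 ≤ g (some s)) (ω : Fin 2) :
    E.silence p σ ω * g none ≤ E.msgExp p σ ω g := by
  rw [msgExp, le_add_iff_nonneg_right]
  refine mul_nonneg hp.1.le (integral_nonneg fun s => ?_)
  by_cases hs : s ∈ Icc E.lo E.hi
  · exact mul_nonneg (hσ.mul_density_nonneg ω s) (h s hs)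
  · simp [E.density_eq_zero ω s hs]

/-! ### Posteriors -/

/-- The posterior on state `1` when the joint probabilities of the evidence with states `1` and `0`
are (proportional to) `x` and `y`. -/
noncomputable def post (x y : ℝ) : ℝ := x / (x + y)

lemma post_mem {x y : ℝ} (hx : 0 ≤ x) (hy : 0 ≤ y) : post x y ∈ Icc (0 : ℝ) 1 :=
  ⟨div_nonneg hx (add_nonneg hx hy), div_le_one_of_le₀ (by linarith) (add_nonneg hx hy)⟩

lemma add_mul_post {x y : ℝ} (hx : 0 ≤ x) (hy : 0 ≤ y) : (x + y) * post x y = x := by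
  rcases eq_or_ne (x + y) 0 with h | h
  · rw [h, zero_mul]
    linarith
  · rw [post, mul_div_cancel₀ _ h]

lemma add_mul_one_sub_post {x y : ℝ} (hx : 0 ≤ x) (hy : 0 ≤ y) : (x + y) * (1 - post x y) = y := by
  linarith [add_mul_post hx hy]

lemma one_sub_post_pos {x y : ℝ} (hx : 0 < x) (hy : 0 < y) : 0 < 1 - post x y :=
  pos_of_mul_pos_right (hy.trans_eq (add_mul_one_sub_post hx.le hy.le).symm) (add_pos hx hy).le

lemma post_mul_left {k : ℝ} (hk : k ≠ 0) (x y : ℝ) : post (k * x) (k * y) = post x y := by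
  rw [post, post, ← mul_add, mul_div_mul_left _ _ hk]

lemma post_self (s : ℝ) : post s (1 - s) = s := by simp [post]

variable (E) in
/-- The posterior after message `n` of a sender who is informed with probability `q` and plays `τ`,
if the evidence before this message has joint probabilities `x` and `y` with the two states. -/
noncomputable def update (q : ℝ) (τ : ℝ → ℝ) (x y : ℝ) (n : Option ℝ) : ℝ :=
  post (x * E.likelihood q τ 1 n) (y * E.likelihood q τ 0 n)

lemma update_some (x y s : ℝ) :
    E.update q τ x y (some s) = post (x * (s / E.prior)) (y * ((1 - s) / (1 - E.prior))) := by
  simp [update, likelihood]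

lemma update_none (x y : ℝ) :
    E.update q τ x y none = post (x * E.silence q τ 1) (y * E.silence q τ 0) := rfl

lemma measurable_update (x y : ℝ) : Measurable fun s => E.update q τ x y (some s) := by
  simp only [update_some, post]
  fun_prop

lemma likelihood_some_nonneg {s : ℝ} (hs : s ∈ Icc (0 : ℝ) 1) (ω : Fin 2) :
    0 ≤ E.likelihood q τ ω (some s) := by
  simp only [likelihood]
  split_ifs
  · exact div_nonneg hs.1 E.prior_pos.le
  · exact div_nonneg (sub_nonneg.2 hs.2) E.one_sub_prior_pos.le

lemma update_some_mem {x y s : ℝ} (hx : 0 ≤ x) (hy : 0 ≤ y) (hs : s ∈ Icc (0 : ℝ) 1) :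
    E.update q τ x y (some s) ∈ Icc (0 : ℝ) 1 :=
  post_mem (mul_nonneg hx (likelihood_some_nonneg hs 1))
    (mul_nonneg hy (likelihood_some_nonneg hs 0))

lemma update_none_mem {x y : ℝ} (hτ : E.IsStrategy τ) (hq : q ∈ Ioo (0 : ℝ) 1) (hx : 0 ≤ x)
    (hy : 0 ≤ y) : E.update q τ x y none ∈ Icc (0 : ℝ) 1 :=
  post_mem (mul_nonneg hx (hτ.silence_pos hq 1).le) (mul_nonneg hy (hτ.silence_pos hq 0).le)

lemma isBddMsg_update {x y : ℝ} (hx : 0 ≤ x) (hy : 0 ≤ y) :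
    E.IsBddMsg (E.update q τ x y) :=
  isBddMsg_of_unit (measurable_update x y) fun _ hs => update_some_mem hx hy (E.Icc_subset_unit hs)

variable (E) in
/-- The sum, over the states, of the expectations of `g` of the message, where the states carry the
masses `x` and `y`. -/
noncomputable def mix (q : ℝ) (τ : ℝ → ℝ) (x y : ℝ) (g : Option ℝ → ℝ) : ℝ :=
  x * E.msgExp q τ 1 g + y * E.msgExp q τ 0 g

lemma mix_eq {x y : ℝ} {g : Option ℝ → ℝ} (hτ : E.IsStrategy τ) (hg : E.IsBddMsg g) :
    E.mix q τ x y g = (x * E.silence q τ 1 + y * E.silence q τ 0) * g none +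
      q * ∫ s, τ s * (x * E.density 1 s + y * E.density 0 s) * g (some s) := by
  have : (fun s => τ s * (x * E.density 1 s + y * E.density 0 s) * g (some s)) = fun s =>
      x * (τ s * E.density 1 s * g (some s)) + y * (τ s * E.density 0 s * g (some s)) := by
    funext s; ring
  rw [this, integral_add ((hg.integrable hτ 1).const_mul _) ((hg.integrable hτ 0).const_mul _),
    integral_const_mul, integral_const_mul, mix, msgExp, msgExp]
  ring

/-- Bayes' rule: the mass of a disclosed signal, times the posterior after it, is its mass together
with state `1`. -/
lemma mass_mul_update_ae {x y : ℝ} (hx : 0 ≤ x) (hy : 0 ≤ y) : ∀ᵐ s,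
    (x * E.density 1 s + y * E.density 0 s) * E.update q τ x y (some s) = x * E.density 1 s := by
  filter_upwards [E.density_one_ae, E.density_zero_ae] with s h1 h0
  by_cases hs : s ∈ Icc E.lo E.hi
  swap
  · simp [E.density_eq_zero _ s hs]
  obtain ⟨hs0, hs1⟩ := E.Icc_subset_unit hs
  have e1 : E.density 1 s = s / E.prior * E.marginal s := by
    rw [div_mul_eq_mul_div, ← h1, mul_div_cancel_left₀ _ E.prior_pos.ne']
  have e0 : E.density 0 s = (1 - s) / (1 - E.prior) * E.marginal s := by
    rw [div_mul_eq_mul_div, ← h0, mul_div_cancel_left₀ _ E.one_sub_prior_pos.ne']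
  have := add_mul_post (mul_nonneg hx (div_nonneg hs0 E.prior_pos.le))
    (mul_nonneg hy (div_nonneg (sub_nonneg.2 hs1) E.one_sub_prior_pos.le))
  rw [update_some, e1, e0]
  linear_combination E.marginal s * this

/-- Integration of a posterior-weighted function: weighting by the posterior amounts to integrating
over state `1` only. -/
lemma mix_update_mul {x y : ℝ} {g : Option ℝ → ℝ} (hτ : E.IsStrategy τ) (hq : q ∈ Ioo (0 : ℝ) 1)
    (hx : 0 ≤ x) (hy : 0 ≤ y) (hg : E.IsBddMsg fun n => E.update q τ x y n * g n) :
    E.mix q τ x y (fun n => E.update q τ x y n * g n) = x * E.msgExp q τ 1 g := by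
  rw [mix_eq hτ hg, msgExp, update_none]
  have h := add_mul_post (mul_nonneg hx (hτ.silence_pos hq 1).le)
    (mul_nonneg hy (hτ.silence_pos hq 0).le)
  have h' : ∫ s, τ s * (x * E.density 1 s + y * E.density 0 s) *
      (E.update q τ x y (some s) * g (some s)) =
      x * ∫ s, τ s * E.density 1 s * g (some s) := by
    rw [← integral_const_mul]
    refine integral_congr_ae ?_
    filter_upwards [mass_mul_update_ae (q := q) (τ := τ) hx hy] with s hs
    linear_combination τ s * g (some s) * hs
  rw [h']
  linear_combination g none * h

/-- Posteriors are a martingale. -/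
lemma mix_update {x y : ℝ} (hτ : E.IsStrategy τ) (hq : q ∈ Ioo (0 : ℝ) 1)
    (hx : 0 ≤ x) (hy : 0 ≤ y) : E.mix q τ x y (E.update q τ x y) = x := by
  have := mix_update_mul (g := fun _ => 1) hτ hq hx hy (by simpa using isBddMsg_update hx hy)
  rw [msgExp_const hτ, mul_one] at this
  simpa using this

variable {c t : ℝ}

/-! ### Incentives to disclose -/

lemma belief₂_eq_update (m : Option ℝ) : E.belief₂ p σ q τ m =
    E.update q τ (E.prior * E.likelihood p σ 1 m) ((1 - E.prior) * E.likelihood p σ 0 m) := by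
  funext n
  simp only [belief₂, update, post, mul_assoc]

lemma belief₂_some (s : ℝ) : E.belief₂ p σ q τ (some s) = E.update q τ s (1 - s) := by
  rw [belief₂_eq_update]
  simp [likelihood, mul_div_cancel₀ _ E.prior_pos.ne', mul_div_cancel₀ _ E.one_sub_prior_pos.ne']

lemma belief₂_none : E.belief₂ p σ q τ none =
    E.update q τ (E.prior * E.silence p σ 1) ((1 - E.prior) * E.silence p σ 0) :=
  belief₂_eq_update none

lemma belief₁_some (s : ℝ) : E.belief₁ p σ (some s) = s := by
  simp [belief₁, likelihood, mul_div_cancel₀ _ E.prior_pos.ne',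
    mul_div_cancel₀ _ E.one_sub_prior_pos.ne']

lemma belief₁_none : E.belief₁ p σ none =
    post (E.prior * E.silence p σ 1) ((1 - E.prior) * E.silence p σ 0) := rfl

lemma prior_mul_silence_pos (hσ : E.IsStrategy σ) (hp : p ∈ Ioo (0 : ℝ) 1) :
    0 < E.prior * E.silence p σ 1 := mul_pos E.prior_pos (hσ.silence_pos hp 1)

lemma one_sub_prior_mul_silence_pos (hσ : E.IsStrategy σ) (hp : p ∈ Ioo (0 : ℝ) 1) :
    0 < (1 - E.prior) * E.silence p σ 0 := mul_pos E.one_sub_prior_pos (hσ.silence_pos hp 0)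

variable (E) in
/-- How strongly the expected posterior responds to the state, if the evidence before the message of
the sender `(q, τ)` has joint probabilities `x` and `y` with the two states: the difference
between the expected posteriors in state `1` and in state `0`. -/
noncomputable def responsiveness (q : ℝ) (τ : ℝ → ℝ) (x y : ℝ) : ℝ :=
  E.msgExp q τ 1 (E.update q τ x y) - E.msgExp q τ 0 (E.update q τ x y)

section responsiveness

variable {x y : ℝ} (hτ : E.IsStrategy τ) (hq : q ∈ Ioo (0 : ℝ) 1) (hx : 0 < x) (hy : 0 < y)
include hτ hq hx hy

lemma post_add_mul_responsiveness (s : ℝ) :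
    s * E.msgExp q τ 1 (E.update q τ x y) + (1 - s) * E.msgExp q τ 0 (E.update q τ x y) =
      post x y + (s - post x y) * E.responsiveness q τ x y := by
  have h := mix_update hτ hq hx.le hy.le
  have hb := add_mul_post hx.le hy.le
  have hxy : x + y ≠ 0 := (add_pos hx hy).ne'
  rw [mix] at h
  rw [responsiveness]
  apply mul_left_cancel₀ hxy
  linear_combination h - (1 - (E.msgExp q τ 1 (E.update q τ x y) -
    E.msgExp q τ 0 (E.update q τ x y))) * hb

lemma one_sub_post_mul_one_sub_responsiveness :
    (1 - post x y) * (1 - E.responsiveness q τ x y) = 1 - E.msgExp q τ 1 (E.update q τ x y) := by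
  linear_combination post_add_mul_responsiveness hτ hq hx hy 1

lemma silence_mul_le_one_sub_msgExp :
    E.silence q τ 1 * (1 - E.update q τ x y none) ≤ 1 - E.msgExp q τ 1 (E.update q τ x y) := by
  have h := silence_mul_le_msgExp (g := fun n => 1 + (-1) * E.update q τ x y n) hτ hq
    (fun s hs => by linarith [(update_some_mem (E := E) (q := q) (τ := τ) hx.le hy.le
      (E.Icc_subset_unit hs)).2]) 1
  rw [msgExp_add hτ (isBddMsg_of_unit measurable_const fun _ _ => by norm_num), msgExp_const hτ,
    msgExp_const_mul] at h
  · linarith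
  · obtain ⟨hm, C, hC⟩ := isBddMsg_update (E := E) (q := q) (τ := τ) hx.le hy.le
    exact ⟨hm.const_mul _, C, fun s hs => by rw [abs_mul]; simpa using hC s hs⟩

lemma responsiveness_lt_one : E.responsiveness q τ x y < 1 := by
  have h1 := one_sub_post_mul_one_sub_responsiveness hτ hq hx hy
  have h2 := silence_mul_le_one_sub_msgExp hτ hq hx hy
  have h3 : 0 < 1 - E.update q τ x y none := one_sub_post_pos
    (mul_pos hx (hτ.silence_pos hq 1)) (mul_pos hy (hτ.silence_pos hq 0))
  have h4 := mul_pos (hτ.silence_pos hq 1) h3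
  have h5 : 0 < (1 - post x y) * (1 - E.responsiveness q τ x y) := by linarith
  linarith [pos_of_mul_pos_right h5 (one_sub_post_pos hx hy).le]

/-- Up to a positive factor, the responsiveness is the variance of the posterior. -/
lemma mix_sq_eq : E.mix q τ x y (fun n => (E.update q τ x y n - post x y) ^ 2) =
    x * (1 - post x y) * E.responsiveness q τ x y := by
  obtain ⟨hm, -⟩ := isBddMsg_update (E := E) (q := q) (τ := τ) hx.le hy.le
  have hu := fun s (hs : s ∈ Icc E.lo E.hi) => update_some_mem (E := E) (q := q) (τ := τ) hx.le hy.le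
    (E.Icc_subset_unit hs)
  have hsq : E.IsBddMsg fun n => E.update q τ x y n * E.update q τ x y n :=
    isBddMsg_of_unit (hm.mul hm) fun s hs => ⟨mul_nonneg (hu s hs).1 (hu s hs).1,
      mul_le_one₀ (hu s hs).2 (hu s hs).1 (hu s hs).2⟩
  have hb := post_mem hx.le hy.le
  have hlin : E.IsBddMsg fun n => (-2 * post x y) * E.update q τ x y n :=
    ⟨hm.const_mul _, |-2 * post x y|, fun s hs => by
      rw [abs_mul, abs_of_nonneg (hu s hs).1]
      exact mul_le_of_le_one_right (abs_nonneg _) (hu s hs).2⟩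
  have hone : E.IsBddMsg fun _ => post x y ^ 2 :=
    ⟨measurable_const, |post x y ^ 2|, fun _ _ => le_rfl⟩
  have hsum : E.IsBddMsg fun n => (-2 * post x y) * E.update q τ x y n + post x y ^ 2 := by
    obtain ⟨h1, C, hC⟩ := hlin
    exact ⟨h1.add measurable_const, C + |post x y ^ 2|, fun s hs =>
      (abs_add_le _ _).trans (add_le_add (hC s hs) le_rfl)⟩
  have e : (fun n => (E.update q τ x y n - post x y) ^ 2) = fun n =>
      E.update q τ x y n * E.update q τ x y n +
        ((-2 * post x y) * E.update q τ x y n + post x y ^ 2) := by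
    funext n; ring
  have h1 := mix_update_mul (g := E.update q τ x y) hτ hq hx.le hy.le hsq
  have h2 := mix_update hτ hq hx.le hy.le
  have h3 := post_add_mul_responsiveness hτ hq hx hy 1
  have h4 := add_mul_post hx.le hy.le
  rw [mix] at h1 h2
  rw [mix, e]
  simp only [msgExp_add hτ hsq hsum, msgExp_add hτ hlin hone, msgExp_const hτ, msgExp_const_mul]
  linear_combination h1 - 2 * post x y * h2 + x * h3 + post x y * h4

lemma responsiveness_nonneg : 0 ≤ E.responsiveness q τ x y := by
  have h := mix_sq_eq hτ hq hx hy
  have h1 := silence_mul_le_msgExp (g := fun n => (E.update q τ x y n - post x y) ^ 2) hτ hq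
    (fun _ _ => sq_nonneg _)
  have h2 : 0 ≤ E.mix q τ x y (fun n => (E.update q τ x y n - post x y) ^ 2) :=
    add_nonneg
      (mul_nonneg hx.le ((mul_nonneg (hτ.silence_pos hq 1).le (sq_nonneg _)).trans (h1 1)))
      (mul_nonneg hy.le ((mul_nonneg (hτ.silence_pos hq 0).le (sq_nonneg _)).trans (h1 0)))
  rw [h] at h2
  exact nonneg_of_mul_nonneg_right h2 (mul_pos hx (one_sub_post_pos hx hy))

/-- A sender who discloses some of the high signals moves the expected posterior. -/
lemma responsiveness_pos (ht : t ∈ Icc E.lo E.hi) (hth : t < E.hi)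
    (h : E.HasThreshold τ t) : 0 < E.responsiveness q τ x y := by
  obtain ⟨hm, -⟩ := isBddMsg_update (E := E) (q := q) (τ := τ) hx.le hy.le
  have hb := post_mem hx.le hy.le
  have hg : E.IsBddMsg fun n => (E.update q τ x y n - post x y) ^ 2 :=
    isBddMsg_of_unit ((hm.sub_const _).pow_const 2) fun s hs => by
      have := update_some_mem (E := E) (q := q) (τ := τ) hx.le hy.le (E.Icc_subset_unit hs)
      exact ⟨sq_nonneg _, by nlinarith [this.1, this.2, hb.1, hb.2]⟩
  have h2 : 0 < E.mix q τ x y (fun n => (E.update q τ x y n - post x y) ^ 2) := by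
    rw [mix_eq hτ hg]
    refine add_pos_of_nonneg_of_pos (mul_nonneg (add_nonneg (mul_pos hx (hτ.silence_pos hq 1)).le
      (mul_pos hy (hτ.silence_pos hq 0)).le) (sq_nonneg _)) (mul_pos hq.1 ?_)
    refine E.integral_pos_of_density (a := max t E.prior) (b := E.hi) 1
      (ht.1.trans (le_max_left _ _)) (max_lt hth E.prior_lt_hi) le_rfl ?_
      (Filter.Eventually.of_forall fun s => ?_) (Filter.Eventually.of_forall fun s hs h0 => ?_)
    · have := (hg.integrable hτ 1).const_mul x |>.add ((hg.integrable hτ 0).const_mul y)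
      refine this.congr (Filter.Eventually.of_forall fun s => ?_)
      simp only [Pi.add_apply]
      ring
    · have h1 := mul_nonneg hx.le (hτ.mul_density_nonneg 1 s)
      have h0 := mul_nonneg hy.le (hτ.mul_density_nonneg 0 s)
      refine mul_nonneg ?_ (sq_nonneg _)
      linarith
    · obtain ⟨hs1, hs2⟩ := hs
      have hts := (le_max_left _ _).trans_lt hs1
      have hps := (le_max_right _ _).trans_lt hs1
      have hsI : s ∈ Icc E.lo E.hi := ⟨ht.1.trans hts.le, hs2.le⟩
      have hunit := E.Icc_subset_unit hsI
      rw [(h.2 s hsI).1 hts, one_mul] at h0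
      rcases mul_eq_zero.1 h0 with h0 | h0
      · have h1 := mul_nonneg hx.le (E.density_nonneg 1 s)
        have h2 := mul_nonneg hy.le (E.density_nonneg 0 s)
        exact (mul_eq_zero.1 (by linarith : x * E.density 1 s = 0)).resolve_left hx.ne'
      · exfalso
        -- A signal above the prior strictly raises the posterior.
        have hu := pow_eq_zero_iff (two_ne_zero) |>.1 h0
        have hs0 : 0 < s := E.prior_pos.trans hps
        have e1 := div_pos hs0 E.prior_pos
        have e0 := div_nonneg (sub_nonneg.2 hunit.2) E.one_sub_prior_pos.le
        have hlt : (1 - s) / (1 - E.prior) < s / E.prior := by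
          rw [div_lt_div_iff₀ E.one_sub_prior_pos E.prior_pos]
          nlinarith
        rw [update_some, post, post, sub_eq_zero, div_eq_div_iff
          (add_pos_of_pos_of_nonneg (mul_pos hx e1) (mul_nonneg hy.le e0)).ne'
          (add_pos hx hy).ne'] at hu
        have : x * y * (s / E.prior) = x * y * ((1 - s) / (1 - E.prior)) := by linarith
        exact hlt.ne' (mul_left_cancel₀ (mul_pos hx hy).ne' this)
  rw [mix_sq_eq hτ hq hx hy] at h2
  exact pos_of_mul_pos_right h2 (mul_pos hx (one_sub_post_pos hx hy)).le

end responsiveness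

/-- A disclosing sender's expectation of the posterior is his own belief. -/
lemma payoff₂_some (hτ : E.IsStrategy τ) (hq : q ∈ Ioo (0 : ℝ) 1) {s : ℝ}
    (hs : s ∈ Icc E.lo E.hi) : E.payoff₂ c p σ q τ s (some s) = s - c := by
  have hu := E.Icc_subset_unit hs
  have := mix_update hτ hq hu.1 (sub_nonneg.2 hu.2)
  rw [mix] at this
  rw [payoff₂, belief₂_some, this]
  simp [cost]

lemma payoff₂_none (hσ : E.IsStrategy σ) (hp : p ∈ Ioo (0 : ℝ) 1) (hτ : E.IsStrategy τ)
    (hq : q ∈ Ioo (0 : ℝ) 1) (s : ℝ) : E.payoff₂ c p σ q τ s none =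
      E.belief₁ p σ none + (s - E.belief₁ p σ none) * E.responsiveness q τ
        (E.prior * E.silence p σ 1) ((1 - E.prior) * E.silence p σ 0) := by
  rw [payoff₂, belief₂_none, belief₁_none, ← post_add_mul_responsiveness hτ hq
    (prior_mul_silence_pos hσ hp) (one_sub_prior_mul_silence_pos hσ hp)]
  simp [cost]

variable (E) in
/-- The strategy `σ` discloses signals above `r` and conceals signals below `r`; unlike for
`HasThreshold`, `r` may lie outside of the support. -/
def IsCutoff (σ : ℝ → ℝ) (r : ℝ) : Prop :=
  ∀ s ∈ Icc E.lo E.hi, (0 < σ s → r ≤ s) ∧ (σ s < 1 → s ≤ r)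

lemma isOptimalStrategy₁_iff :
    E.IsOptimalStrategy σ (fun _ m => E.payoff₁ c p σ m) ↔
      E.IsCutoff σ (E.belief₁ p σ none + c) := by
  refine forall₂_congr fun s _ => ?_
  have h1 : E.payoff₁ c p σ (some s) = s - c := by simp [payoff₁, belief₁_some, cost]
  have h0 : E.payoff₁ c p σ none = E.belief₁ p σ none := by simp [payoff₁, cost]
  simp only [h1, h0]
  rw [le_sub_iff_add_le, sub_le_iff_le_add]

/-- The other sender scales the gain from disclosure down by `1 - κ`, where `κ` is his
responsiveness, which amounts to scaling the disclosure cost up. -/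
lemma isOptimalStrategy₂_iff (hσ : E.IsStrategy σ) (hp : p ∈ Ioo (0 : ℝ) 1)
    (hτ : E.IsStrategy τ) (hq : q ∈ Ioo (0 : ℝ) 1) :
    E.IsOptimalStrategy σ (fun s m => E.payoff₂ c p σ q τ s m) ↔
      E.IsCutoff σ (E.belief₁ p σ none + c / (1 - E.responsiveness q τ
        (E.prior * E.silence p σ 1) ((1 - E.prior) * E.silence p σ 0))) := by
  refine forall₂_congr fun s hs => ?_
  have hκ : 0 < 1 - E.responsiveness q τ
        (E.prior * E.silence p σ 1) ((1 - E.prior) * E.silence p σ 0) :=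
    sub_pos.2 (responsiveness_lt_one hτ hq (prior_mul_silence_pos hσ hp)
      (one_sub_prior_mul_silence_pos hσ hp))
  simp only [payoff₂_some hτ hq hs, payoff₂_none hσ hp hτ hq]
  refine and_congr (imp_congr_right fun _ => ?_) (imp_congr_right fun _ => ?_)
  · refine Iff.trans ?_ ((div_le_iff₀ hκ).symm.trans le_sub_iff_add_le')
    constructor <;> intro h <;> linarith
  · refine Iff.trans ?_ ((le_div_iff₀ hκ).symm.trans sub_le_iff_le_add')
    constructor <;> intro h <;> linarith

/-! ### Threshold strategies -/

variable (E) in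
/-- The point of the support that is closest to `r`. -/
noncomputable def clamp (r : ℝ) : ℝ := max E.lo (min E.hi r)

lemma clamp_mem (r : ℝ) : E.clamp r ∈ Icc E.lo E.hi :=
  ⟨le_max_left _ _, max_le E.lo_lt_hi.le (min_le_left _ _)⟩

lemma continuous_clamp : Continuous E.clamp := by
  unfold clamp
  fun_prop

lemma eq_clamp_iff {r : ℝ} (ht : t ∈ Icc E.lo E.hi) :
    t = E.clamp r ↔ (t < E.hi → r ≤ t) ∧ (E.lo < t → t ≤ r) := by
  obtain ⟨h0, h1⟩ := ht
  have := E.lo_lt_hi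
  unfold clamp
  constructor
  · intro h
    constructor <;> intro h'
    · by_contra! hr
      rcases le_total E.hi r with hh | hh
      · rw [min_eq_left hh, max_eq_right this.le] at h
        linarith
      · rw [min_eq_right hh, max_eq_right (h0.trans hr.le)] at h
        linarith
    · by_contra! hr
      rw [min_eq_right (by linarith), eq_comm, max_eq_iff] at h
      rcases h with h | h <;> linarith [h.1]
  · rintro ⟨ha, hb⟩
    rcases lt_or_ge r E.lo with hr | hr
    · rw [min_eq_right (by linarith), max_eq_left hr.le]
      by_contra hne
      linarith [hb (lt_of_le_of_ne h0 (Ne.symm hne))]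
    · rcases lt_or_ge E.hi r with hr' | hr'
      · rw [min_eq_left hr'.le, max_eq_right this.le]
        by_contra hne
        linarith [ha (lt_of_le_of_ne h1 hne)]
      · rw [min_eq_right hr', max_eq_right hr]
        rcases h1.eq_or_lt with e | hlt
        · exact le_antisymm (hb (by linarith)) (by linarith)
        · rcases h0.eq_or_lt with e | hlt'
          · linarith [ha hlt]
          · exact le_antisymm (hb hlt') (ha hlt)

lemma IsCutoff.hasThreshold {r : ℝ} (h : E.IsCutoff σ r) (hσ : E.IsStrategy σ) :
    E.HasThreshold σ (E.clamp r) := by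
  refine ⟨clamp_mem r, fun s hs => ⟨fun hlt => ?_, fun hlt => ?_⟩⟩
  · refine le_antisymm (hσ.2 s hs).2 (not_lt.1 fun h1 => ?_)
    have hr := (h s hs).2 h1
    exact hlt.not_ge ((le_min hs.2 hr).trans (le_max_right _ _))
  · refine le_antisymm (not_lt.1 fun h1 => ?_) (hσ.2 s hs).1
    have hr := (h s hs).1 h1
    exact hlt.not_ge (max_le hs.1 ((min_le_right _ _).trans hr))

lemma IsCutoff.eq_clamp {r : ℝ} (h : E.IsCutoff σ r) (ht : E.HasThreshold σ t) :
    t = E.clamp r := by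
  obtain ⟨htI, ht⟩ := ht
  rw [eq_clamp_iff htI]
  refine ⟨fun hlt => le_of_forall_gt_imp_ge_of_dense fun s hs => ?_,
    fun hlt => le_of_forall_lt_imp_le_of_dense fun s hs => ?_⟩
  · have hm : min s E.hi ∈ Icc E.lo E.hi :=
      ⟨le_min (htI.1.trans hs.le) E.lo_lt_hi.le, min_le_right _ _⟩
    have := (ht _ hm).1 (lt_min hs hlt)
    exact ((h _ hm).1 (by rw [this]; exact one_pos)).trans (min_le_left _ _)
  · have hm : max s E.lo ∈ Icc E.lo E.hi :=
      ⟨le_max_right _ _, max_le (hs.le.trans htI.2) E.lo_lt_hi.le⟩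
    have := (ht _ hm).2 (max_lt hs hlt)
    exact (le_max_left _ _).trans ((h _ hm).2 (by rw [this]; exact one_pos))

/-- The pure threshold strategy that discloses exactly the signals above `t`. -/
noncomputable def thr (t s : ℝ) : ℝ := if t < s then 1 else 0

lemma measurable_thr (t : ℝ) : Measurable (thr t) :=
  Measurable.ite measurableSet_Ioi measurable_const measurable_const

lemma thr_mem (t s : ℝ) : thr t s ∈ Icc (0 : ℝ) 1 := by
  unfold thr
  split_ifs <;> simp

variable (E) in
lemma isStrategy_thr (t : ℝ) : E.IsStrategy (thr t) := ⟨measurable_thr t, fun s _ => thr_mem t s⟩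

lemma isCutoff_thr (r : ℝ) : E.IsCutoff (thr r) r := fun _ _ => by
  unfold thr
  constructor <;> split_ifs with h <;> intro h' <;> linarith

lemma hasThreshold_thr (ht : t ∈ Icc E.lo E.hi) : E.HasThreshold (thr t) t :=
  ⟨ht, fun _ _ => ⟨fun h => if_pos h, fun h => if_neg h.not_gt⟩⟩

lemma HasThreshold.mul_density_ae (h : E.HasThreshold σ t) (ω : Fin 2) :
    ∀ᵐ s, σ s * E.density ω s = thr t s * E.density ω s := by
  filter_upwards [Measure.ae_ne volume t] with s hs
  by_cases hI : s ∈ Icc E.lo E.hi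
  · rcases lt_or_gt_of_ne hs with hlt | hgt
    · rw [(h.2 s hI).2 hlt, thr, if_neg hlt.not_gt]
    · rw [(h.2 s hI).1 hgt, thr, if_pos hgt]
  · simp [E.density_eq_zero ω s hI]

lemma HasThreshold.silence_eq (h : E.HasThreshold σ t) : E.silence p σ = E.silence p (thr t) := by
  funext ω
  rw [silence, silence]
  congr 2
  refine integral_congr_ae ?_
  filter_upwards [h.mul_density_ae ω] with s hs
  rw [sub_mul, sub_mul, hs]

lemma HasThreshold.msgExp_eq (h : E.HasThreshold σ t) : E.msgExp p σ = E.msgExp p (thr t) := by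
  funext ω g
  rw [msgExp, msgExp, h.silence_eq]
  congr 2
  refine integral_congr_ae ?_
  filter_upwards [h.mul_density_ae ω] with s hs
  rw [hs]

lemma HasThreshold.likelihood_eq (h : E.HasThreshold σ t) :
    E.likelihood p σ = E.likelihood p (thr t) := by
  funext ω m
  cases m
  · simp only [likelihood, h.silence_eq]
  · rfl

lemma HasThreshold.belief₁_eq (h : E.HasThreshold σ t) :
    E.belief₁ p σ = E.belief₁ p (thr t) := by
  funext m
  rw [belief₁, belief₁, h.likelihood_eq]

lemma HasThreshold.update_eq (h : E.HasThreshold σ t) : E.update p σ = E.update p (thr t) := by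
  funext x y n
  rw [update, update, h.likelihood_eq]

lemma HasThreshold.responsiveness_eq (h : E.HasThreshold σ t) :
    E.responsiveness p σ = E.responsiveness p (thr t) := by
  funext x y
  rw [responsiveness, responsiveness, h.update_eq, h.msgExp_eq]

lemma HasThreshold.belief₂_eq {t' : ℝ} (h : E.HasThreshold σ t) (h' : E.HasThreshold τ t') :
    E.belief₂ p σ q τ = E.belief₂ p (thr t) q (thr t') := by
  funext m
  rw [belief₂_eq_update, belief₂_eq_update, h.likelihood_eq, h'.update_eq]

lemma HasThreshold.welfare₁_eq (D : DecisionProblem.{u}) (h : E.HasThreshold σ t) :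
    E.welfare₁ D p σ = E.welfare₁ D p (thr t) := by
  rw [welfare₁, welfare₁, h.msgExp_eq, h.belief₁_eq]

lemma HasThreshold.welfare₂_eq (D : DecisionProblem.{u}) {t' : ℝ} (h : E.HasThreshold σ t)
    (h' : E.HasThreshold τ t') :
    E.welfare₂ D p σ q τ = E.welfare₂ D p (thr t) q (thr t') := by
  rw [welfare₂, welfare₂, h.msgExp_eq, h'.msgExp_eq, h.belief₂_eq h']

variable (E) in
/-- The belief after silence of a sender with threshold `t`. -/
noncomputable def silentBelief (p t : ℝ) : ℝ := E.belief₁ p (thr t) none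

variable (E) in
/-- The responsiveness that a silent sender with threshold `t` attributes to the messages of a
sender with threshold `t'`. -/
noncomputable def thrResponse (p t q t' : ℝ) : ℝ := E.responsiveness q (thr t')
  (E.prior * E.silence p (thr t) 1) ((1 - E.prior) * E.silence p (thr t) 0)

lemma thrResponse_lt_one (hp : p ∈ Ioo (0 : ℝ) 1) (hq : q ∈ Ioo (0 : ℝ) 1) (t t' : ℝ) :
    E.thrResponse p t q t' < 1 :=
  responsiveness_lt_one (E.isStrategy_thr _) hq (prior_mul_silence_pos (E.isStrategy_thr _) hp)
    (one_sub_prior_mul_silence_pos (E.isStrategy_thr _) hp)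

lemma thrResponse_nonneg (hp : p ∈ Ioo (0 : ℝ) 1) (hq : q ∈ Ioo (0 : ℝ) 1) (t t' : ℝ) :
    0 ≤ E.thrResponse p t q t' :=
  responsiveness_nonneg (E.isStrategy_thr _) hq (prior_mul_silence_pos (E.isStrategy_thr _) hp)
    (one_sub_prior_mul_silence_pos (E.isStrategy_thr _) hp)

lemma thrResponse_pos (hp : p ∈ Ioo (0 : ℝ) 1) (hq : q ∈ Ioo (0 : ℝ) 1) (t : ℝ) {t' : ℝ}
    (ht' : t' ∈ Icc E.lo E.hi) (hlt : t' < E.hi) : 0 < E.thrResponse p t q t' :=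
  responsiveness_pos (E.isStrategy_thr _) hq (prior_mul_silence_pos (E.isStrategy_thr _) hp)
    (one_sub_prior_mul_silence_pos (E.isStrategy_thr _) hp) ht' hlt (hasThreshold_thr ht')

lemma thr_hi_mul_density (ω : Fin 2) (s : ℝ) : thr E.hi s * E.density ω s = 0 := by
  by_cases hs : s ∈ Icc E.lo E.hi
  · simp [thr, hs.2.not_gt]
  · simp [E.density_eq_zero ω s hs]

variable (E) in
lemma silence_thr_hi (p : ℝ) (ω : Fin 2) : E.silence p (thr E.hi) ω = 1 := by
  simp [(E.isStrategy_thr _).silence_eq, thr_hi_mul_density]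

lemma thrResponse_hi (p t q : ℝ) : E.thrResponse p t q E.hi = 0 := by
  simp [thrResponse, responsiveness, msgExp, thr_hi_mul_density, silence_thr_hi]

lemma isEquilibrium₁_iff (hσ : E.IsStrategy σ) (ht : E.HasThreshold σ t) :
    E.IsEquilibrium₁ c p σ ↔ E.IsCutoff σ (E.silentBelief p t + c) := by
  rw [IsEquilibrium₁, and_iff_right hσ, isOptimalStrategy₁_iff, ht.belief₁_eq]
  rfl

lemma isEquilibrium₂_iff (hp : p ∈ Ioo (0 : ℝ) 1) (hq : q ∈ Ioo (0 : ℝ) 1)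
    (hσ : E.IsStrategy σ) (hτ : E.IsStrategy τ) {t' : ℝ} (ht : E.HasThreshold σ t)
    (ht' : E.HasThreshold τ t') : E.IsEquilibrium₂ c p q σ τ ↔
      E.IsCutoff σ (E.silentBelief p t + c / (1 - E.thrResponse p t q t')) ∧
      E.IsCutoff τ (E.silentBelief q t' + c / (1 - E.thrResponse q t' p t)) := by
  rw [IsEquilibrium₂, and_iff_right hσ, and_iff_right hτ, isOptimalStrategy₂_iff hσ hp hτ hq,
    isOptimalStrategy₂_iff hτ hq hσ hp, ht.belief₁_eq, ht'.belief₁_eq, ht.responsiveness_eq,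
    ht'.responsiveness_eq, ht.silence_eq, ht'.silence_eq]
  rfl

lemma IsEquilibrium₁.exists_hasThreshold (h : E.IsEquilibrium₁ c p σ) :
    ∃ t, E.HasThreshold σ t := ⟨_, (isOptimalStrategy₁_iff.1 h.2).hasThreshold h.1⟩

lemma IsEquilibrium₂.exists_hasThreshold (hp : p ∈ Ioo (0 : ℝ) 1) (hq : q ∈ Ioo (0 : ℝ) 1)
    (h : E.IsEquilibrium₂ c p q σ τ) : ∃ t t', E.HasThreshold σ t ∧ E.HasThreshold τ t' :=
  ⟨_, _, ((isOptimalStrategy₂_iff h.1 hp h.2.1 hq).1 h.2.2.1).hasThreshold h.1,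
    ((isOptimalStrategy₂_iff h.2.1 hq h.1 hp).1 h.2.2.2).hasThreshold h.2.1⟩

/-- Single-sender equilibrium thresholds as fixed points. -/
lemma mem_thresholds₁_iff : t ∈ E.thresholds₁ c p ↔ t = E.clamp (E.silentBelief p t + c) := by
  constructor
  · rintro ⟨σ, h, ht⟩
    exact ((isEquilibrium₁_iff h.1 ht).1 h).eq_clamp ht
  · intro h
    have ht : E.HasThreshold (thr (E.silentBelief p t + c)) t := by
      have := (isCutoff_thr (E := E) (E.silentBelief p t + c)).hasThreshold (E.isStrategy_thr _)
      rwa [← h] at this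
    exact ⟨_, (isEquilibrium₁_iff (E.isStrategy_thr _) ht).2 (isCutoff_thr _), ht⟩

/-- Two-sender equilibrium thresholds as fixed points. -/
lemma mem_thresholds₂_iff (hp : p ∈ Ioo (0 : ℝ) 1) (hq : q ∈ Ioo (0 : ℝ) 1) {e : ℝ × ℝ} :
    e ∈ E.thresholds₂ c p q ↔
      e.1 = E.clamp (E.silentBelief p e.1 + c / (1 - E.thrResponse p e.1 q e.2)) ∧
      e.2 = E.clamp (E.silentBelief q e.2 + c / (1 - E.thrResponse q e.2 p e.1)) := by
  constructor
  · rintro ⟨σ, τ, h, ht, ht'⟩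
    obtain ⟨h1, h2⟩ := (isEquilibrium₂_iff hp hq h.1 h.2.1 ht ht').1 h
    exact ⟨h1.eq_clamp ht, h2.eq_clamp ht'⟩
  · rintro ⟨h1, h2⟩
    have key : ∀ r t, t = E.clamp r → E.HasThreshold (thr r) t := fun r t h => by
      have := (isCutoff_thr (E := E) r).hasThreshold (E.isStrategy_thr _)
      rwa [← h] at this
    exact ⟨_, _, (isEquilibrium₂_iff hp hq (E.isStrategy_thr _) (E.isStrategy_thr _)
      (key _ _ h1) (key _ _ h2)).2 ⟨isCutoff_thr _, isCutoff_thr _⟩, key _ _ h1, key _ _ h2⟩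

variable {t' : ℝ}

/-! ### The belief after silence -/

variable (E) in
/-- The probability that a sender with threshold `t` is silent. -/
noncomputable def silentMass (p t : ℝ) : ℝ :=
  E.prior * E.silence p (thr t) 1 + (1 - E.prior) * E.silence p (thr t) 0

lemma silentMass_pos (hp : p ∈ Ioo (0 : ℝ) 1) (t : ℝ) : 0 < E.silentMass p t :=
  add_pos (prior_mul_silence_pos (E.isStrategy_thr t) hp)
    (one_sub_prior_mul_silence_pos (E.isStrategy_thr t) hp)

lemma silentMass_mul_silentBelief (hp : p ∈ Ioo (0 : ℝ) 1) (t : ℝ) :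
    E.silentMass p t * E.silentBelief p t = E.prior * E.silence p (thr t) 1 :=
  add_mul_post (prior_mul_silence_pos (E.isStrategy_thr t) hp).le
    (one_sub_prior_mul_silence_pos (E.isStrategy_thr t) hp).le

lemma silentMass_eq (p t : ℝ) : E.silentMass p t = 1 - p * ∫ s, thr t s * E.marginal s := by
  have h := (E.isStrategy_thr t).integrable_mul_density
  have : (fun s => thr t s * E.marginal s) = fun s =>
      E.prior * (thr t s * E.density 1 s) + (1 - E.prior) * (thr t s * E.density 0 s) := by
    funext s; rw [marginal]; ring
  rw [silentMass, (E.isStrategy_thr t).silence_eq, (E.isStrategy_thr t).silence_eq, this,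
    integral_add ((h 1).const_mul _) ((h 0).const_mul _), integral_const_mul, integral_const_mul]
  ring

lemma prior_mul_silence_eq (p t : ℝ) : E.prior * E.silence p (thr t) 1 =
    E.prior - p * ∫ s, thr t s * (s * E.marginal s) := by
  have : ∫ s, thr t s * (s * E.marginal s) = E.prior * ∫ s, thr t s * E.density 1 s := by
    rw [← integral_const_mul]
    refine integral_congr_ae ?_
    filter_upwards [E.density_one_ae] with s hs
    rw [← hs]
    ring
  rw [(E.isStrategy_thr t).silence_eq, this]
  ring

lemma integrable_thr_mul_marginal (t : ℝ) : Integrable fun s => thr t s * E.marginal s :=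
  (E.isStrategy_thr t).integrable_mul_marginal

lemma integrable_thr_mul_id_mul_marginal (t : ℝ) :
    Integrable fun s => thr t s * (s * E.marginal s) :=
  E.integrable_bdd_mul (measurable_thr t) (fun _ hs => (E.isStrategy_thr t).abs_le hs)
    E.integrable_id_mul_marginal fun s hs => by rw [E.marginal_eq_zero hs, mul_zero]

/-- Raising the threshold from `t` to `t'` adds to the silent types a mass of types between `t` and
`t'`. -/
lemma exists_silentMass_add (hp : 0 ≤ p) (htt' : t ≤ t') : ∃ δ, 0 ≤ δ ∧
    E.silentMass p t' = E.silentMass p t + δ ∧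
    E.prior * E.silence p (thr t) 1 + t * δ ≤ E.prior * E.silence p (thr t') 1 ∧
    E.prior * E.silence p (thr t') 1 ≤ E.prior * E.silence p (thr t) 1 + t' * δ := by
  have key : ∀ s, 0 ≤ (thr t s - thr t' s) * E.marginal s ∧
      t * ((thr t s - thr t' s) * E.marginal s) ≤
        thr t s * (s * E.marginal s) - thr t' s * (s * E.marginal s) ∧
      thr t s * (s * E.marginal s) - thr t' s * (s * E.marginal s) ≤
        t' * ((thr t s - thr t' s) * E.marginal s) := by
    intro s
    have h := E.marginal_nonneg s
    unfold thr
    split_ifs with h1 h2 h2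
    · simp
    · rw [not_lt] at h2
      refine ⟨by linarith, ?_, ?_⟩
      · linarith [mul_le_mul_of_nonneg_right h1.le h]
      · linarith [mul_le_mul_of_nonneg_right h2 h]
    · exact absurd (htt'.trans_lt h2) h1
    · simp
  have i1 := (integrable_thr_mul_marginal (E := E) t).sub
    (integrable_thr_mul_marginal (E := E) t')
  have i1' : Integrable fun s => (thr t s - thr t' s) * E.marginal s :=
    i1.congr (Filter.Eventually.of_forall fun s => (sub_mul _ _ _).symm)
  have i2 := (integrable_thr_mul_id_mul_marginal (E := E) t).sub
    (integrable_thr_mul_id_mul_marginal (E := E) t')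
  have e1 : ∫ s, (thr t s - thr t' s) * E.marginal s =
      (∫ s, thr t s * E.marginal s) - ∫ s, thr t' s * E.marginal s := by
    rw [← integral_sub (integrable_thr_mul_marginal t) (integrable_thr_mul_marginal t')]
    simp only [sub_mul]
  have e2 := integral_sub (integrable_thr_mul_id_mul_marginal (E := E) t)
    (integrable_thr_mul_id_mul_marginal (E := E) t')
  have l1 := integral_mono (i1'.const_mul t) i2 fun s => (key s).2.1
  have l2 := integral_mono i2 (i1'.const_mul t') fun s => (key s).2.2
  simp only [Pi.sub_apply] at l1 l2
  rw [integral_const_mul, e2] at l1 l2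
  refine ⟨p * ∫ s, (thr t s - thr t' s) * E.marginal s,
    mul_nonneg hp (integral_nonneg fun s => (key s).1), ?_, ?_, ?_⟩
  · rw [silentMass_eq, silentMass_eq, e1]
    ring
  · rw [prior_mul_silence_eq, prior_mul_silence_eq]
    linarith [mul_le_mul_of_nonneg_left l1 hp]
  · rw [prior_mul_silence_eq, prior_mul_silence_eq]
    linarith [mul_le_mul_of_nonneg_left l2 hp]

/-- The key comparison for `c ≤ 0`: the types between two candidate thresholds lie above the belief
after silence at the lower one, but pull the belief up too little to sustain the higher one. -/
lemma not_lt_of_silentBelief_add (hp : p ∈ Ioo (0 : ℝ) 1) (hc : c ≤ 0)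
    (ht : E.silentBelief p t + c ≤ t) (ht' : t' ≤ E.silentBelief p t' + c) : ¬ t < t' := by
  intro hlt
  obtain ⟨δ, hδ, hN, -, hM⟩ := exists_silentMass_add (E := E) hp.1.le hlt.le
  rw [← silentMass_mul_silentBelief hp, ← silentMass_mul_silentBelief hp] at hM
  have hpos := silentMass_pos (E := E) hp t
  have h1 := mul_le_mul_of_nonneg_left ht hpos.le
  have h2 := mul_le_mul_of_nonneg_left ht' (silentMass_pos (E := E) hp t').le
  rw [hN] at h2 hM
  have h3 := mul_lt_mul_of_pos_left hlt hpos
  have h4 := mul_nonpos_of_nonneg_of_nonpos hδ hc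
  nlinarith

lemma thr_lo_mul_density_ae (ω : Fin 2) : ∀ᵐ s, thr E.lo s * E.density ω s = E.density ω s := by
  filter_upwards [Measure.ae_ne volume E.lo] with s hs
  by_cases hI : s ∈ Icc E.lo E.hi
  · simp [thr, lt_of_le_of_ne hI.1 hs.symm]
  · simp [E.density_eq_zero ω s hI]

lemma silence_thr_lo (p : ℝ) (ω : Fin 2) : E.silence p (thr E.lo) ω = 1 - p := by
  rw [(E.isStrategy_thr _).silence_eq, integral_congr_ae (thr_lo_mul_density_ae ω),
    E.integral_density, mul_one]

lemma silentBelief_lo (hp : p ∈ Ioo (0 : ℝ) 1) : E.silentBelief p E.lo = E.prior := by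
  have hp' : 1 - p ≠ 0 := (sub_pos.2 hp.2).ne'
  rw [silentBelief, belief₁_none, silence_thr_lo, silence_thr_lo, mul_comm, mul_comm (1 - E.prior),
    post_mul_left hp', post_self]

variable (E) in
lemma silentBelief_hi (p : ℝ) : E.silentBelief p E.hi = E.prior := by
  rw [silentBelief, belief₁_none, silence_thr_hi, silence_thr_hi, mul_one, mul_one, post_self]

lemma silentBelief_lt_hi (hp : p ∈ Ioo (0 : ℝ) 1) (ht : t ∈ Icc E.lo E.hi) :
    E.silentBelief p t < E.hi := by
  obtain ⟨δ, hδ, hN, -, hM⟩ := exists_silentMass_add (E := E) hp.1.le ht.1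
  have h1 := silentMass_mul_silentBelief (E := E) hp t
  have hlo : E.silentMass p E.lo = 1 - p := by
    rw [silentMass, silence_thr_lo, silence_thr_lo]; ring
  rw [silence_thr_lo] at hM
  have h2 := mul_lt_mul_of_pos_right E.prior_lt_hi (sub_pos.2 hp.2)
  have h3 := mul_le_mul_of_nonneg_right ht.2 hδ
  refine lt_of_mul_lt_mul_left ?_ (silentMass_pos (E := E) hp t).le
  rw [h1, hN, hlo]
  linarith

lemma silentBelief_pos (hp : p ∈ Ioo (0 : ℝ) 1) (t : ℝ) : 0 < E.silentBelief p t := by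
  have h := silentMass_mul_silentBelief (E := E) hp t
  exact pos_of_mul_pos_right (h ▸ prior_mul_silence_pos (E.isStrategy_thr t) hp)
    (silentMass_pos hp t).le

/-! ### Continuity in the thresholds -/

/-- Continuity of the expected contribution of disclosed signals in the threshold and in parameters:
the integrand jumps at the threshold only, which is a null event. -/
lemma continuous_integral_thr {X : Type*} [TopologicalSpace X] [FirstCountableTopology X]
    {F : X → ℝ → ℝ} {k : ℝ → ℝ} {C : ℝ} (hk : Integrable k)
    (hk0 : ∀ s, s ∉ Icc E.lo E.hi → k s = 0) (hm : ∀ x, Measurable (F x))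
    (hC : ∀ x, ∀ s ∈ Icc E.lo E.hi, |F x s| ≤ C)
    (hF : ∀ s ∈ Icc E.lo E.hi, Continuous fun x => F x s) :
    Continuous fun z : X × ℝ => ∫ s, thr z.2 s * k s * F z.1 s := by
  rw [continuous_iff_continuousAt]
  intro z₀
  refine continuousAt_of_dominated (bound := fun s => ‖k s‖ * C)
    (Filter.Eventually.of_forall fun z => ?_) (Filter.Eventually.of_forall fun z =>
      Filter.Eventually.of_forall fun s => ?_) (hk.norm.mul_const C) ?_
  · exact ((measurable_thr _).aestronglyMeasurable.mul hk.1).mul (hm _).aestronglyMeasurable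
  · by_cases hs : s ∈ Icc E.lo E.hi
    · rw [norm_mul, norm_mul]
      refine mul_le_mul ?_ (hC _ s hs) (norm_nonneg _) (norm_nonneg _)
      refine mul_le_of_le_one_left (norm_nonneg _) ?_
      obtain ⟨h0, h1⟩ := thr_mem z.2 s
      rwa [Real.norm_of_nonneg h0]
    · simp [hk0 s hs]
  · filter_upwards [Measure.ae_ne volume z₀.2] with s hs
    by_cases hI : s ∈ Icc E.lo E.hi
    · have h1 : (fun z : X × ℝ => thr z.2 s) =ᶠ[nhds z₀] fun _ => thr z₀.2 s := by
        rcases lt_or_gt_of_ne hs with hlt | hgt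
        · filter_upwards [continuous_snd.continuousAt.eventually_const_lt hlt] with z hz
          simp [thr, hlt.not_gt, hz.not_gt]
        · filter_upwards [continuous_snd.continuousAt.eventually_lt_const hgt] with z hz
          simp [thr, hgt, hz]
      exact ((continuousAt_const.congr h1.symm).mul continuousAt_const).mul
        ((hF s hI).comp continuous_fst).continuousAt
    · simp only [hk0 s hI, mul_zero, zero_mul]
      exact continuousAt_const

variable (E) in
lemma continuous_silence (p : ℝ) (ω : Fin 2) : Continuous fun t => E.silence p (thr t) ω := by
  have h := continuous_integral_thr (E := E) (X := ℝ) (F := fun _ _ => 1) (C := 1)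
    (E.integrable_density ω) (E.density_eq_zero ω) (fun _ => measurable_const)
    (fun _ _ _ => by simp) (fun _ _ => continuous_const)
  simp only [mul_one] at h
  simp only [(E.isStrategy_thr _).silence_eq]
  exact continuous_const.sub (continuous_const.mul (h.comp (continuous_id.prodMk continuous_id)))

lemma continuous_silentBelief (hp : p ∈ Ioo (0 : ℝ) 1) : Continuous (E.silentBelief p) := by
  have h1 := (E.continuous_silence p 1).const_mul E.prior
  have h0 := (E.continuous_silence p 0).const_mul (1 - E.prior)
  exact h1.div (h1.add h0) fun t => (silentMass_pos hp t).ne'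

/-- Continuity of expected values of a function of the posterior. -/
lemma continuous_msgExp_update {X : Type*} [TopologicalSpace X] [FirstCountableTopology X]
    {x y : X → ℝ} {V : ℝ → ℝ} {C : ℝ} (hq : q ∈ Ioo (0 : ℝ) 1) (hx : Continuous x)
    (hy : Continuous y) (hx0 : ∀ a, 0 ≤ x a) (hy0 : ∀ a, 0 ≤ y a)
    (hpost : ∀ s ∈ Icc E.lo E.hi,
      Continuous fun a => post (x a * (s / E.prior)) (y a * ((1 - s) / (1 - E.prior))))
    (hxy : ∀ a, 0 < x a + y a)
    (hV : Continuous V) (hC : ∀ μ ∈ Icc (0 : ℝ) 1, |V μ| ≤ C) (ω : Fin 2) :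
    Continuous fun z : X × ℝ =>
      E.msgExp q (thr z.2) ω (fun n => V (E.update q (thr z.2) (x z.1) (y z.1) n)) := by
  have hs := fun ω => (E.continuous_silence q ω).comp (continuous_snd (X := X))
  have hsil := fun t => (E.isStrategy_thr t).silence_pos hq
  have h := continuous_integral_thr (E := E)
    (F := fun a s => V (post (x a * (s / E.prior)) (y a * ((1 - s) / (1 - E.prior)))))
    (C := C) (E.integrable_density ω) (E.density_eq_zero ω)
    (fun a => hV.measurable.comp (by unfold post; fun_prop))
    (fun a s hs => hC _ (post_mem
      (mul_nonneg (hx0 a) (div_nonneg (E.Icc_subset_unit hs).1 E.prior_pos.le))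
      (mul_nonneg (hy0 a) (div_nonneg (sub_nonneg.2 (E.Icc_subset_unit hs).2)
        E.one_sub_prior_pos.le))))
    (fun s hs => hV.comp (hpost s hs))
  simp only [msgExp, update_some, update_none]
  refine ((hs ω).mul (hV.comp ?_)).add (continuous_const.mul h)
  have e1 := (hx.comp continuous_fst).mul (hs 1)
  have e0 := (hy.comp continuous_fst).mul (hs 0)
  refine e1.div (e1.add e0) fun z => ne_of_gt ?_
  have h1 := mul_nonneg (hx0 z.1) (hsil z.2 1).le
  have h0 := mul_nonneg (hy0 z.1) (hsil z.2 0).le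
  rcases (hx0 z.1).eq_or_lt with hz | hz
  · exact add_pos_of_nonneg_of_pos h1 (mul_pos (by linarith [hxy z.1]) (hsil _ _))
  · exact add_pos_of_pos_of_nonneg (mul_pos hz (hsil _ _)) h0

lemma weights_pos {x y s : ℝ} (hx : 0 < x) (hy : 0 < y) (hs : s ∈ Icc E.lo E.hi) :
    0 < x * (s / E.prior) + y * ((1 - s) / (1 - E.prior)) := by
  obtain ⟨h0, h1⟩ := E.Icc_subset_unit hs
  have e1 := mul_nonneg hx.le (div_nonneg h0 E.prior_pos.le)
  have e0 := mul_nonneg hy.le (div_nonneg (sub_nonneg.2 h1) E.one_sub_prior_pos.le)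
  rcases h0.eq_or_lt with h | h
  · refine add_pos_of_nonneg_of_pos e1 (mul_pos hy (div_pos ?_ E.one_sub_prior_pos))
    rw [← h]
    norm_num
  · exact add_pos_of_pos_of_nonneg (mul_pos hx (div_pos h E.prior_pos)) e0

/-- Continuity, in the thresholds, of what a sender who is silent himself expects of a function of
the posterior. -/
lemma continuous_msgExp_silent (hp : p ∈ Ioo (0 : ℝ) 1) (hq : q ∈ Ioo (0 : ℝ) 1) {V : ℝ → ℝ} {C : ℝ}
    (hV : Continuous V) (hC : ∀ μ ∈ Icc (0 : ℝ) 1, |V μ| ≤ C) (ω : Fin 2) :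
    Continuous fun z : ℝ × ℝ => E.msgExp q (thr z.2) ω (fun n => V (E.update q (thr z.2)
      (E.prior * E.silence p (thr z.1) 1) ((1 - E.prior) * E.silence p (thr z.1) 0) n)) := by
  have hx := fun t => prior_mul_silence_pos (E.isStrategy_thr t) hp
  have hy := fun t => one_sub_prior_mul_silence_pos (E.isStrategy_thr t) hp
  have hxc := (E.continuous_silence p 1).const_mul E.prior
  have hyc := (E.continuous_silence p 0).const_mul (1 - E.prior)
  exact continuous_msgExp_update (E := E) hq hxc hyc (fun t => (hx t).le) (fun t => (hy t).le)
    (fun s hs => (hxc.mul_const _).div ((hxc.mul_const _).add (hyc.mul_const _))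
      fun t => (weights_pos (hx t) (hy t) hs).ne') (fun t => add_pos (hx t) (hy t)) hV hC ω

lemma continuous_thrResponse (hp : p ∈ Ioo (0 : ℝ) 1) (hq : q ∈ Ioo (0 : ℝ) 1) :
    Continuous fun z : ℝ × ℝ => E.thrResponse p z.1 q z.2 := by
  have h := continuous_msgExp_silent (E := E) hp hq (V := fun μ => μ) (C := 1) continuous_id
    (fun μ hμ => abs_le.2 ⟨by linarith [hμ.1], hμ.2⟩)
  exact (h 1).sub (h 0)

/-! ### Comparison of equilibrium thresholds -/

lemma exists_fixedPoint_le {g : ℝ → ℝ} (hg : Continuous g) (hmem : ∀ t, g t ∈ Icc E.lo E.hi)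
    (ht : t ∈ Icc E.lo E.hi) (hgt : g t ≤ t) : ∃ s ∈ Icc E.lo t, s = g s := by
  have h := intermediate_value_Icc' ht.1 (f := fun s => g s - s) (hg.sub continuous_id).continuousOn
  obtain ⟨s, hs, h0⟩ := h ⟨sub_nonpos.2 hgt, sub_nonneg.2 (hmem E.lo).1⟩
  exact ⟨s, hs, (sub_eq_zero.1 h0).symm⟩

lemma exists_threshold₁_le (hp : p ∈ Ioo (0 : ℝ) 1) (ht : t ∈ Icc E.lo E.hi)
    (h : t < E.hi → E.silentBelief p t + c ≤ t) : ∃ s ∈ E.thresholds₁ c p, s ≤ t := by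
  obtain ⟨s, hs, he⟩ := exists_fixedPoint_le (E := E)
    (continuous_clamp.comp ((continuous_silentBelief hp).add_const c)) (fun _ => clamp_mem _) ht (by
      rcases ht.2.eq_or_lt with e | hlt
      · rw [e]; exact (clamp_mem _).2
      · exact max_le ht.1 ((min_le_right _ _).trans (h hlt)))
  exact ⟨s, mem_thresholds₁_iff.2 he, hs.2⟩

lemma thresholds₁_subset (c p : ℝ) : E.thresholds₁ c p ⊆ Icc E.lo E.hi := fun _ ⟨_, _, h⟩ => h.1

lemma exists_isLeast_thresholds₁ (c : ℝ) (hp : p ∈ Ioo (0 : ℝ) 1) :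
    ∃ s, IsLeast (E.thresholds₁ c p) s := by
  have hclosed : IsClosed (E.thresholds₁ c p) := by
    have : E.thresholds₁ c p = {t | t = E.clamp (E.silentBelief p t + c)} :=
      Set.ext fun _ => mem_thresholds₁_iff
    rw [this]
    exact isClosed_eq continuous_id
      (continuous_clamp.comp ((continuous_silentBelief hp).add_const c))
  have hcomp := isCompact_Icc.of_isClosed_subset hclosed (thresholds₁_subset c p)
  obtain ⟨s, hs, -⟩ := exists_threshold₁_le (c := c) hp (right_mem_Icc.2 E.lo_lt_hi.le)
    fun h => (lt_irrefl _ h).elim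
  exact hcomp.exists_isLeast ⟨s, hs⟩

lemma threshold₁_bounds (ht : t ∈ E.thresholds₁ c p) :
    (t < E.hi → E.silentBelief p t + c ≤ t) ∧ (E.lo < t → t ≤ E.silentBelief p t + c) :=
  (eq_clamp_iff (thresholds₁_subset _ _ ht)).1 (mem_thresholds₁_iff.1 ht)

lemma thresholds₁_subsingleton (hp : p ∈ Ioo (0 : ℝ) 1) (hc : c ≤ 0)
    (ht : t ∈ E.thresholds₁ c p) (ht' : t' ∈ E.thresholds₁ c p) : t = t' := by
  have key : ∀ t ∈ E.thresholds₁ c p, ∀ t' ∈ E.thresholds₁ c p, ¬ t < t' := by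
    intro t ht t' ht' hlt
    exact not_lt_of_silentBelief_add hp hc
      ((threshold₁_bounds ht).1 (hlt.trans_le (thresholds₁_subset _ _ ht').2))
      ((threshold₁_bounds ht').2 ((thresholds₁_subset _ _ ht).1.trans_lt hlt)) hlt
  exact le_antisymm (not_lt.1 (key _ ht' _ ht)) (not_lt.1 (key _ ht _ ht'))

lemma thresholds₁_eq_singleton (hp : p ∈ Ioo (0 : ℝ) 1) (hc : c ≤ 0)
    (ht : t ∈ E.thresholds₁ c p) : E.thresholds₁ c p = {t} :=
  Subset.antisymm (fun _ h => thresholds₁_subsingleton hp hc h ht) (singleton_subset_iff.2 ht)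

lemma threshold₁_lt_hi (hc : c ≤ 0) (ht : t ∈ E.thresholds₁ c p) :
    t < E.hi := by
  refine lt_of_le_of_ne (thresholds₁_subset _ _ ht).2 fun h => ?_
  have h1 := (threshold₁_bounds ht).2 (h ▸ E.lo_lt_hi)
  rw [h, silentBelief_hi] at h1
  linarith [E.prior_lt_hi]

section two

variable {e : ℝ × ℝ} (hp : p ∈ Ioo (0 : ℝ) 1) (hq : q ∈ Ioo (0 : ℝ) 1)
include hp hq

lemma mem_thresholds₂_swap : e ∈ E.thresholds₂ c p q ↔ e.swap ∈ E.thresholds₂ c q p := by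
  rw [mem_thresholds₂_iff hp hq, mem_thresholds₂_iff hq hp, and_comm]
  rfl

lemma thresholds₂_subset (h : e ∈ E.thresholds₂ c p q) :
    e.1 ∈ Icc E.lo E.hi ∧ e.2 ∈ Icc E.lo E.hi := by
  obtain ⟨h1, h2⟩ := (mem_thresholds₂_iff hp hq).1 h
  exact ⟨h1 ▸ clamp_mem _, h2 ▸ clamp_mem _⟩

lemma threshold₂_bounds (h : e ∈ E.thresholds₂ c p q) :
    (e.1 < E.hi → E.silentBelief p e.1 + c / (1 - E.thrResponse p e.1 q e.2) ≤ e.1) ∧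
    (E.lo < e.1 → e.1 ≤ E.silentBelief p e.1 + c / (1 - E.thrResponse p e.1 q e.2)) :=
  (eq_clamp_iff (thresholds₂_subset hp hq h).1).1 ((mem_thresholds₂_iff hp hq).1 h).1

omit hp hq in
lemma div_le_self_of_nonpos {κ : ℝ} (hc : c ≤ 0) (h0 : 0 ≤ κ) (h1 : κ < 1) : c / (1 - κ) ≤ c := by
  rw [div_le_iff₀ (sub_pos.2 h1)]
  nlinarith

omit hp hq in
lemma le_div_of_nonneg {κ : ℝ} (hc : 0 ≤ c) (h0 : 0 ≤ κ) (h1 : κ < 1) : c ≤ c / (1 - κ) := by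
  rw [le_div_iff₀ (sub_pos.2 h1)]
  nlinarith

omit hp hq in
lemma lt_div_of_pos {κ : ℝ} (hc : 0 < c) (h0 : 0 < κ) (h1 : κ < 1) : c < c / (1 - κ) := by
  rw [lt_div_iff₀ (sub_pos.2 h1)]
  nlinarith

/-- With a subsidy or free disclosure, an additional sender makes a sender disclose more. -/
lemma threshold₂_le_threshold₁ (hc : c ≤ 0) (h : e ∈ E.thresholds₂ c p q)
    (ht : t ∈ E.thresholds₁ c p) : e.1 ≤ t := by
  by_contra! hlt
  obtain ⟨he, -⟩ := thresholds₂_subset hp hq h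
  refine not_lt_of_silentBelief_add hp hc ((threshold₁_bounds ht).1 (hlt.trans_le he.2)) ?_ hlt
  have h1 := (threshold₂_bounds hp hq h).2 ((thresholds₁_subset _ _ ht).1.trans_lt hlt)
  linarith [div_le_self_of_nonpos hc (thrResponse_nonneg (E := E) hp hq e.1 e.2)
    (thrResponse_lt_one hp hq _ _)]

/-- With a disclosure cost, an additional sender makes a sender disclose less. -/
lemma threshold₁_le_threshold₂ (hc : 0 ≤ c) (h : e ∈ E.thresholds₂ c p q)
    (ht : IsLeast (E.thresholds₁ c p) t) : t ≤ e.1 := by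
  obtain ⟨he, -⟩ := thresholds₂_subset hp hq h
  obtain ⟨s, hs, hse⟩ := exists_threshold₁_le (c := c) hp he fun hlt => by
    linarith [(threshold₂_bounds hp hq h).1 hlt, le_div_of_nonneg hc
      (thrResponse_nonneg (E := E) hp hq e.1 e.2) (thrResponse_lt_one hp hq _ _)]
  exact (ht.2 hs).trans hse

lemma thresholds₂_zero {s s' : ℝ} (hs : s ∈ E.thresholds₁ 0 p) (hs' : s' ∈ E.thresholds₁ 0 q) :
    E.thresholds₂ 0 p q = {(s, s')} := by
  ext e
  rw [mem_thresholds₂_iff hp hq, zero_div, zero_div, ← mem_thresholds₁_iff, ← mem_thresholds₁_iff,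
    thresholds₁_eq_singleton hp le_rfl hs, thresholds₁_eq_singleton hq le_rfl hs']
  simp [Prod.ext_iff]

/-- With a strict subsidy, a threshold that does not change is at the bottom of the support, as the
other sender is responsive. -/
lemma eq_lo_of_threshold₂_eq (hc : c < 0) (h : e ∈ E.thresholds₂ c p q)
    (h1 : e.1 ∈ E.thresholds₁ c p) (h2 : e.2 ∈ E.thresholds₁ c q) : e.1 = E.lo := by
  by_contra hne
  have hlo : E.lo < e.1 := lt_of_le_of_ne (thresholds₁_subset _ _ h1).1 (Ne.symm hne)
  have hb := (threshold₁_bounds h1).1 (threshold₁_lt_hi hc.le h1)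
  have hb' := (threshold₂_bounds hp hq h).2 hlo
  have hκ := lt_div_of_pos (neg_pos.2 hc) (thrResponse_pos (E := E) hp hq e.1
    (thresholds₁_subset _ _ h2) (threshold₁_lt_hi hc.le h2)) (thrResponse_lt_one hp hq _ _)
  rw [neg_div] at hκ
  linarith

/-- With a disclosure cost, a sender who faces a responsive sender cannot keep an interior threshold
of the single-sender game. -/
lemma eq_hi_or_eq_hi (hc : 0 < c) (h : e ∈ E.thresholds₂ c p q)
    (h1 : e.1 ∈ E.thresholds₁ c p) : e.1 = E.hi ∨ e.2 = E.hi := by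
  by_contra! hne
  obtain ⟨he1, he2⟩ := thresholds₂_subset hp hq h
  have hlt1 := lt_of_le_of_ne he1.2 hne.1
  have hb := (threshold₂_bounds hp hq h).1 hlt1
  have hκ := lt_div_of_pos hc (thrResponse_pos (E := E) hp hq e.1 he2
    (lt_of_le_of_ne he2.2 hne.2)) (thrResponse_lt_one hp hq _ _)
  rcases he1.1.eq_or_lt with hlo | hlo
  · rw [← hlo, silentBelief_lo hp, hlo] at hb
    linarith [E.lo_lt_prior]
  · linarith [(threshold₁_bounds h1).2 hlo]

omit hp hq in
/-- Complete nondisclosure is an equilibrium of the single-sender game for all or for no `p`. -/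
lemma hi_mem_thresholds₁_iff (c p : ℝ) : E.hi ∈ E.thresholds₁ c p ↔ E.hi ≤ E.prior + c := by
  rw [mem_thresholds₁_iff, eq_clamp_iff (right_mem_Icc.2 E.lo_lt_hi.le), silentBelief_hi]
  simp [E.lo_lt_hi]

/-- If one sender can remain silent, then the other one may behave as if he were alone. -/
lemma mk_hi_mem_thresholds₂ (hc : 0 ≤ c) (hhi : E.hi ∈ E.thresholds₁ c q)
    (ht : t ∈ E.thresholds₁ c p) : (t, E.hi) ∈ E.thresholds₂ c p q := by
  rw [mem_thresholds₂_iff hp hq, thrResponse_hi, sub_zero, div_one]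
  refine ⟨mem_thresholds₁_iff.1 ht, (eq_clamp_iff (right_mem_Icc.2 E.lo_lt_hi.le)).2
    ⟨fun h => (lt_irrefl _ h).elim, fun _ => ?_⟩⟩
  rw [hi_mem_thresholds₁_iff] at hhi
  rw [silentBelief_hi]
  linarith [le_div_of_nonneg hc
      (thrResponse_nonneg (E := E) hq hp E.hi t) (thrResponse_lt_one hq hp _ _)]

end two

end Environment

/-! ### The value of a decision problem -/

namespace DecisionProblem

variable (D : DecisionProblem.{u})

lemma bddAbove_expectedUtility {μ : ℝ} (hμ : μ ∈ Icc (0 : ℝ) 1) :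
    BddAbove (range (D.expectedUtility μ)) := by
  obtain ⟨a, ha⟩ := D.exists_optimal μ hμ
  exact ⟨D.expectedUtility μ a, by rintro _ ⟨a', rfl⟩; exact ha a'⟩

variable {D}

lemma expectedUtility_le_value {μ : ℝ} (hμ : μ ∈ Icc (0 : ℝ) 1) (a : D.Action) :
    D.expectedUtility μ a ≤ D.value μ := le_ciSup (D.bddAbove_expectedUtility hμ) a

lemma IsOptimal.value_eq {μ : ℝ} {a : D.Action} (h : D.IsOptimal μ a) :
    D.value μ = D.expectedUtility μ a :=
  have : Nonempty D.Action := ⟨a⟩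
  le_antisymm (ciSup_le h) (le_ciSup ⟨D.expectedUtility μ a, by rintro _ ⟨a', rfl⟩; exact h a'⟩ a)

lemma isOptimal_of_value_le {μ : ℝ} (hμ : μ ∈ Icc (0 : ℝ) 1) {a : D.Action}
    (h : D.value μ ≤ D.expectedUtility μ a) : D.IsOptimal μ a :=
  fun a' => (expectedUtility_le_value hμ a').trans h

variable (D)

lemma exists_isOptimal {μ : ℝ} (hμ : μ ∈ Icc (0 : ℝ) 1) : ∃ a, D.IsOptimal μ a :=
  D.exists_optimal μ hμ

lemma isClosed_isOptimal (a : D.Action) : IsClosed {μ | D.IsOptimal μ a} := by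
  simp only [IsOptimal, ofPred_forall]
  refine isClosed_iInter fun a' => isClosed_le ?_ ?_ <;> unfold expectedUtility <;> fun_prop

lemma ordConnected_isOptimal (a : D.Action) : OrdConnected {μ | D.IsOptimal μ a} := by
  refine ⟨fun μ hμ ν hν x hx a' => ?_⟩
  have h1 := hμ a'
  have h2 := hν a'
  unfold expectedUtility at *
  -- The advantage of `a` over `a'` is affine in the belief.
  have : 0 ≤ (D.utility a 1 - D.utility a' 1) * x + (D.utility a 0 - D.utility a' 0) * (1 - x) := by
    rcases le_total 0 ((D.utility a 1 - D.utility a' 1) - (D.utility a 0 - D.utility a' 0)) with h | h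
    · nlinarith [mul_le_mul_of_nonneg_left hx.1 h]
    · nlinarith [mul_le_mul_of_nonpos_left hx.2 h]
  linarith

lemma exists_abs_value_le : ∃ C, ∀ μ ∈ Icc (0 : ℝ) 1, |D.value μ| ≤ C := by
  obtain ⟨a, -⟩ := D.exists_isOptimal (left_mem_Icc.2 zero_le_one)
  refine ⟨|D.utility a 1| + |D.utility a 0| + |D.value 1| + |D.value 0|, fun μ hμ => ?_⟩
  have hlow := expectedUtility_le_value hμ a
  obtain ⟨a', ha'⟩ := D.exists_isOptimal hμ
  have h1 := expectedUtility_le_value (D := D) (right_mem_Icc.2 zero_le_one) a'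
  have h0 := expectedUtility_le_value (D := D) (left_mem_Icc.2 zero_le_one) a'
  rw [expectedUtility] at h1 h0 hlow
  rw [ha'.value_eq, expectedUtility] at *
  have hb : ∀ k x : ℝ, 0 ≤ k → k ≤ 1 → |k * x| ≤ |x| := fun k x hk hk' => by
    rw [abs_mul, abs_of_nonneg hk]
    exact mul_le_of_le_one_left (abs_nonneg x) hk'
  have b1 := abs_le.1 (hb μ (D.utility a 1) hμ.1 hμ.2)
  have b0 := abs_le.1 (hb (1 - μ) (D.utility a 0) (sub_nonneg.2 hμ.2) (by linarith [hμ.1]))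
  have c1 := abs_le.1 (hb μ (D.value 1) hμ.1 hμ.2)
  have c0 := abs_le.1 (hb (1 - μ) (D.value 0) (sub_nonneg.2 hμ.2) (by linarith [hμ.1]))
  have d1 := mul_le_mul_of_nonneg_left h1 hμ.1
  have d0 := mul_le_mul_of_nonneg_left h0 (sub_nonneg.2 hμ.2)
  rw [abs_le]
  constructor <;> nlinarith [abs_nonneg (D.utility a 1), abs_nonneg (D.utility a 0),
    abs_nonneg (D.value 1), abs_nonneg (D.value 0)]

/-- The value, extended from the beliefs `[0, 1]` to all reals in a measurable way. -/
noncomputable def clipValue (μ : ℝ) : ℝ := D.value (max 0 (min 1 μ))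

lemma clip_mem (μ : ℝ) : max 0 (min 1 μ) ∈ Icc (0 : ℝ) 1 :=
  ⟨le_max_left _ _, max_le zero_le_one (min_le_left _ _)⟩

lemma clipValue_eq {μ : ℝ} (hμ : μ ∈ Icc (0 : ℝ) 1) : D.clipValue μ = D.value μ := by
  rw [clipValue, min_eq_right hμ.2, max_eq_right hμ.1]

lemma measurable_clipValue : Measurable D.clipValue := by
  refine LowerSemicontinuous.measurable ?_
  refine lowerSemicontinuous_ciSup (f := fun a μ => D.expectedUtility (max 0 (min 1 μ)) a)
    (fun μ => D.bddAbove_expectedUtility (clip_mem μ)) fun a => Continuous.lowerSemicontinuous ?_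
  unfold expectedUtility
  fun_prop

end DecisionProblem

namespace Environment

variable {E : Environment} {c p q t t' : ℝ} {σ τ : ℝ → ℝ} {D : DecisionProblem.{u}}

/-! ### The value of messages -/

variable (E) in
/-- The decision maker's expected value from observing the message of the sender `(q, τ)`, if the
evidence before has joint probabilities `x` and `y` with the two states. -/
noncomputable def msgValue (D : DecisionProblem.{u}) (q : ℝ) (τ : ℝ → ℝ) (x y : ℝ) : ℝ :=
  E.mix q τ x y fun n => D.clipValue (E.update q τ x y n)

lemma isBddMsg_value (D : DecisionProblem.{u}) (x y : ℝ) :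
    E.IsBddMsg fun n => D.clipValue (E.update q τ x y n) := by
  obtain ⟨C, hC⟩ := D.exists_abs_value_le
  exact ⟨D.measurable_clipValue.comp (measurable_update x y), C, fun _ _ =>
    hC _ (DecisionProblem.clip_mem _)⟩

lemma mix_expectedUtility {x y : ℝ} (hτ : E.IsStrategy τ) (hq : q ∈ Ioo (0 : ℝ) 1) (hx : 0 ≤ x)
    (hy : 0 ≤ y) (a : D.Action) :
    E.mix q τ x y (fun n => D.expectedUtility (E.update q τ x y n) a) =
      x * D.utility a 1 + y * D.utility a 0 := by
  obtain ⟨hm, -⟩ := isBddMsg_update (E := E) (q := q) (τ := τ) hx hy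
  have e : (fun n => D.expectedUtility (E.update q τ x y n) a) = fun n =>
      (D.utility a 1 - D.utility a 0) * E.update q τ x y n + D.utility a 0 := by
    funext n
    rw [DecisionProblem.expectedUtility]
    ring
  have h1 : E.IsBddMsg fun n => (D.utility a 1 - D.utility a 0) * E.update q τ x y n :=
    ⟨hm.const_mul _, |D.utility a 1 - D.utility a 0|, fun s hs => by
      have := update_some_mem (E := E) (q := q) (τ := τ) hx hy (E.Icc_subset_unit hs)
      rw [abs_mul, abs_of_nonneg this.1]
      exact mul_le_of_le_one_right (abs_nonneg _) this.2⟩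
  have h0 : E.IsBddMsg fun _ => D.utility a 0 := ⟨measurable_const, _, fun _ _ => le_rfl⟩
  have hmart := mix_update hτ hq hx hy
  rw [mix] at hmart
  rw [mix, e, msgExp_add hτ h1 h0, msgExp_add hτ h1 h0, msgExp_const hτ, msgExp_const hτ,
    msgExp_const_mul, msgExp_const_mul]
  linear_combination (D.utility a 1 - D.utility a 0) * hmart

/-- The value of a message exceeds the payoff from a fixed action by the expected loss of that
action. -/
lemma msgValue_eq {x y : ℝ} (hτ : E.IsStrategy τ) (hq : q ∈ Ioo (0 : ℝ) 1) (hx : 0 ≤ x)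
    (hy : 0 ≤ y) (a : D.Action) :
    (Integrable fun s => τ s * (x * E.density 1 s + y * E.density 0 s) *
      (D.clipValue (E.update q τ x y (some s)) -
        D.expectedUtility (E.update q τ x y (some s)) a)) ∧
    E.msgValue D q τ x y = x * D.utility a 1 + y * D.utility a 0 +
      ((x * E.silence q τ 1 + y * E.silence q τ 0) * (D.clipValue (E.update q τ x y none) -
        D.expectedUtility (E.update q τ x y none) a) +
      q * ∫ s, τ s * (x * E.density 1 s + y * E.density 0 s) *
        (D.clipValue (E.update q τ x y (some s)) -
        D.expectedUtility (E.update q τ x y (some s)) a)) := by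
  have hb := isBddMsg_value (E := E) (q := q) (τ := τ) D x y
  obtain ⟨hm, -⟩ := isBddMsg_update (E := E) (q := q) (τ := τ) hx hy
  have hu : E.IsBddMsg fun n => -D.expectedUtility (E.update q τ x y n) a := by
    refine ⟨?_, |D.utility a 1| + |D.utility a 0|, fun s hs => ?_⟩
    · unfold DecisionProblem.expectedUtility
      fun_prop
    · have h := update_some_mem (E := E) (q := q) (τ := τ) hx hy (E.Icc_subset_unit hs)
      rw [abs_neg, DecisionProblem.expectedUtility]
      refine (abs_add_le _ _).trans (add_le_add ?_ ?_)
      · rw [abs_mul, abs_of_nonneg h.1]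
        exact mul_le_of_le_one_left (abs_nonneg _) h.2
      · rw [abs_mul, abs_of_nonneg (sub_nonneg.2 h.2)]
        exact mul_le_of_le_one_left (abs_nonneg _) (by linarith [h.1])
  have hs : E.IsBddMsg fun n => D.clipValue (E.update q τ x y n) -
      D.expectedUtility (E.update q τ x y n) a := by
    obtain ⟨h1, C1, hC1⟩ := hb
    obtain ⟨h2, C2, hC2⟩ := hu
    simp only [sub_eq_add_neg]
    exact ⟨h1.add h2, C1 + C2, fun s hs => (abs_add_le _ _).trans (add_le_add (hC1 s hs) (hC2 s hs))⟩
  constructor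
  · refine (((hs.integrable hτ 1).const_mul x).add ((hs.integrable hτ 0).const_mul y)).congr
      (Filter.Eventually.of_forall fun s => ?_)
    simp only [Pi.add_apply]
    ring
  · rw [← mix_eq hτ hs, ← mix_expectedUtility hτ hq hx hy a, msgValue, mix, mix, mix]
    have : ∀ ω, E.msgExp q τ ω (fun n => D.clipValue (E.update q τ x y n)) =
        E.msgExp q τ ω (fun n => D.expectedUtility (E.update q τ x y n) a) +
        E.msgExp q τ ω (fun n => D.clipValue (E.update q τ x y n) -
          D.expectedUtility (E.update q τ x y n) a) := fun ω => by
      have hu' : E.IsBddMsg fun n => D.expectedUtility (E.update q τ x y n) a := by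
        obtain ⟨h2, C2, hC2⟩ := hu
        exact ⟨by simpa only [neg_neg] using h2.fun_neg, C2, fun s hs => by simpa using hC2 s hs⟩
      rw [← msgExp_add hτ hu' hs]
      congr 1
      funext n
      ring
    rw [this, this]
    ring

lemma loss_nonneg {x y : ℝ} (hx : 0 ≤ x) (hy : 0 ≤ y) (hτ : E.IsStrategy τ) (a : D.Action) (s : ℝ) :
    0 ≤ τ s * (x * E.density 1 s + y * E.density 0 s) *
        (D.clipValue (E.update q τ x y (some s)) -
        D.expectedUtility (E.update q τ x y (some s)) a) := by
  by_cases hs : s ∈ Icc E.lo E.hi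
  · have h := update_some_mem (E := E) (q := q) (τ := τ) hx hy (E.Icc_subset_unit hs)
    rw [D.clipValue_eq h]
    have h1 := mul_nonneg hx (hτ.mul_density_nonneg 1 s)
    have h0 := mul_nonneg hy (hτ.mul_density_nonneg 0 s)
    refine mul_nonneg ?_ (sub_nonneg.2 (DecisionProblem.expectedUtility_le_value h a))
    linarith
  · simp [E.density_eq_zero _ s hs]

lemma add_mul_expectedUtility_post {x y : ℝ} (hx : 0 ≤ x) (hy : 0 ≤ y) (a : D.Action) :
    (x + y) * D.expectedUtility (post x y) a = x * D.utility a 1 + y * D.utility a 0 := by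
  rw [DecisionProblem.expectedUtility]
  linear_combination D.utility a 1 * add_mul_post hx hy +
    D.utility a 0 * add_mul_one_sub_post hx hy

/-- Information is never harmful to the decision maker. -/
lemma value_post_le_msgValue {x y : ℝ} (hτ : E.IsStrategy τ) (hq : q ∈ Ioo (0 : ℝ) 1) (hx : 0 ≤ x)
    (hy : 0 ≤ y) : (x + y) * D.value (post x y) ≤ E.msgValue D q τ x y := by
  obtain ⟨a, ha⟩ := D.exists_isOptimal (post_mem hx hy)
  rw [ha.value_eq, add_mul_expectedUtility_post hx hy, (msgValue_eq hτ hq hx hy a).2]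
  have h := update_none_mem (E := E) hτ hq hx hy
  have h1 := mul_nonneg hq.1.le (integral_nonneg (μ := volume)
    fun s => loss_nonneg (E := E) (q := q) hx hy hτ a s)
  have h2 : 0 ≤ (x * E.silence q τ 1 + y * E.silence q τ 0) *
      (D.clipValue (E.update q τ x y none) - D.expectedUtility (E.update q τ x y none) a) := by
    rw [D.clipValue_eq h]
    exact mul_nonneg (add_nonneg (mul_nonneg hx (hτ.silence_pos hq 1).le)
      (mul_nonneg hy (hτ.silence_pos hq 0).le))
      (sub_nonneg.2 (DecisionProblem.expectedUtility_le_value h a))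
  linarith

/-- If a message is of no value, then an action that is optimal before it remains optimal after
almost every message. -/
lemma isOptimal_of_msgValue_eq {x y : ℝ} (hτ : E.IsStrategy τ) (hq : q ∈ Ioo (0 : ℝ) 1)
    (hx : 0 < x) (hy : 0 < y) (h : E.msgValue D q τ x y = (x + y) * D.value (post x y))
    {a : D.Action} (ha : D.IsOptimal (post x y) a) :
    D.IsOptimal (E.update q τ x y none) a ∧
      ∀ᵐ s, s ∈ Icc E.lo E.hi → 0 < τ s → ¬ D.IsOptimal (E.update q τ x y (some s)) a →
        E.density 1 s = 0 := by
  obtain ⟨hint, heq⟩ := msgValue_eq (D := D) hτ hq hx.le hy.le a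
  rw [ha.value_eq, add_mul_expectedUtility_post hx.le hy.le, heq] at h
  have hmem := update_none_mem (E := E) hτ hq hx.le hy.le
  have h1 := mul_nonneg hq.1.le (integral_nonneg (μ := volume)
    fun s => loss_nonneg (E := E) (q := q) hx.le hy.le hτ a s)
  have hpos : 0 < x * E.silence q τ 1 + y * E.silence q τ 0 :=
    add_pos (mul_pos hx (hτ.silence_pos hq 1)) (mul_pos hy (hτ.silence_pos hq 0))
  rw [D.clipValue_eq hmem] at h
  have h2 := mul_nonneg hpos.le
    (sub_nonneg.2 (DecisionProblem.expectedUtility_le_value (D := D) hmem a))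
  constructor
  · refine DecisionProblem.isOptimal_of_value_le hmem ?_
    have h3 := (mul_eq_zero.1 (le_antisymm (by linarith) h2)).resolve_left hpos.ne'
    linarith
  · have h3 := (mul_eq_zero.1 (le_antisymm (by linarith) h1)).resolve_left hq.1.ne'
    rw [integral_eq_zero_iff_of_nonneg
      (fun s => loss_nonneg (E := E) (q := q) hx.le hy.le hτ a s) hint] at h3
    filter_upwards [h3] with s hs hI hτs hno
    have hmem' := update_some_mem (E := E) (q := q) (τ := τ) hx.le hy.le (E.Icc_subset_unit hI)
    simp only [Pi.zero_apply, D.clipValue_eq hmem'] at hs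
    rcases mul_eq_zero.1 hs with hs | hs
    · have h4 := (mul_eq_zero.1 hs).resolve_left hτs.ne'
      have h5 := mul_nonneg hx.le (E.density_nonneg 1 s)
      have h6 := mul_nonneg hy.le (E.density_nonneg 0 s)
      exact (mul_eq_zero.1 (by linarith : x * E.density 1 s = 0)).resolve_left hx.ne'
    · exact (hno (DecisionProblem.isOptimal_of_value_le hmem' (by linarith))).elim

/-! ### Welfare -/

lemma isBddMsg_clipValue_id (D : DecisionProblem.{u}) (k : ℝ) :
    E.IsBddMsg fun m => D.clipValue (m.elim k fun s => s) := by
  obtain ⟨C, hC⟩ := D.exists_abs_value_le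
  exact ⟨D.measurable_clipValue, C, fun _ _ => hC _ (DecisionProblem.clip_mem _)⟩

lemma belief₁_none_mem (hσ : E.IsStrategy σ) (hp : p ∈ Ioo (0 : ℝ) 1) :
    E.belief₁ p σ none ∈ Icc (0 : ℝ) 1 :=
  post_mem (prior_mul_silence_pos hσ hp).le (one_sub_prior_mul_silence_pos hσ hp).le

lemma welfare₁_eq (D : DecisionProblem.{u}) (hσ : E.IsStrategy σ) (hp : p ∈ Ioo (0 : ℝ) 1) :
    (Integrable fun s => σ s * E.marginal s * D.clipValue s) ∧
    E.welfare₁ D p σ = (E.prior * E.silence p σ 1 + (1 - E.prior) * E.silence p σ 0) *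
      D.value (E.belief₁ p σ none) + p * ∫ s, σ s * E.marginal s * D.clipValue s := by
  have hb := isBddMsg_clipValue_id (E := E) D (E.belief₁ p σ none)
  constructor
  · refine (((hb.integrable hσ 1).const_mul E.prior).add
      ((hb.integrable hσ 0).const_mul (1 - E.prior))).congr
      (Filter.Eventually.of_forall fun s => ?_)
    simp only [Pi.add_apply, Option.elim, marginal]
    ring
  · have h : ∀ ω, E.msgExp p σ ω (fun m => D.value (E.belief₁ p σ m)) =
        E.msgExp p σ ω (fun m => D.clipValue (m.elim (E.belief₁ p σ none) fun s => s)) :=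
      fun ω => msgExp_congr (D.clipValue_eq (belief₁_none_mem hσ hp)).symm fun s hs => by
        rw [belief₁_some]
        exact (D.clipValue_eq (E.Icc_subset_unit hs)).symm
    have h' := mix_eq (q := p) (x := E.prior) (y := 1 - E.prior) hσ hb
    simp only [Option.elim, D.clipValue_eq (belief₁_none_mem hσ hp)] at h'
    rw [welfare₁, Fin.sum_univ_two, h, h]
    simp only [stateProb, Fin.isValue, zero_ne_one, if_false, if_true]
    rw [add_comm]
    exact h'

lemma measurable_msgExp {F : ℝ → Option ℝ → ℝ} (hτ : E.IsStrategy τ)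
    (h0 : Measurable fun s => F s none)
    (h : Measurable fun z : ℝ × ℝ => F z.1 (some z.2)) (ω : Fin 2) :
    Measurable fun s => E.msgExp q τ ω (F s) := by
  have : Measurable fun z : ℝ × ℝ => τ z.2 * E.density ω z.2 * F z.1 (some z.2) :=
    ((hτ.1.comp measurable_snd).mul ((E.measurable_density ω).comp measurable_snd)).mul h
  exact (h0.const_mul _).add ((this.stronglyMeasurable.integral_prod_right').measurable.const_mul q)

lemma abs_msgExp_le {g : Option ℝ → ℝ} {C : ℝ} (hτ : E.IsStrategy τ) (hq : q ∈ Ioo (0 : ℝ) 1)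
    (hg : Measurable fun s => g (some s)) (h0 : |g none| ≤ C)
    (hC : ∀ s ∈ Icc E.lo E.hi, |g (some s)| ≤ C) (ω : Fin 2) : |E.msgExp q τ ω g| ≤ C := by
  have key : ∀ k : ℝ, |k| ≤ 1 → 0 ≤ C + k * E.msgExp q τ ω g := fun k hk => by
    have hk' : ∀ z : ℝ, |z| ≤ C → 0 ≤ C + k * z := fun z hz => by
      have : |k * z| ≤ C := by
        rw [abs_mul]
        exact (mul_le_of_le_one_left (abs_nonneg _) hk).trans hz
      linarith [(abs_le.1 this).1]
    have hb : E.IsBddMsg fun n => k * g n := ⟨hg.const_mul _, C, fun s hs => by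
      rw [abs_mul]
      exact (mul_le_of_le_one_left (abs_nonneg _) hk).trans (hC s hs)⟩
    rw [← msgExp_const_mul, ← msgExp_const (p := q) hτ C ω,
      ← msgExp_add hτ ⟨measurable_const, |C|, fun _ _ => le_rfl⟩ hb]
    exact (mul_nonneg (hτ.silence_pos hq ω).le (hk' _ h0)).trans
      (silence_mul_le_msgExp (g := fun m => C + k * g m) hτ hq (fun s hs => hk' _ (hC s hs)) ω)
  rw [abs_le]
  constructor
  · linarith [key 1 (by simp)]
  · linarith [key (-1) (by simp)]

lemma measurable_update_prod :
    Measurable fun z : ℝ × ℝ => E.update q τ z.1 (1 - z.1) (some z.2) := by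
  simp only [update_some, post]
  fun_prop

lemma welfare₂_eq (D : DecisionProblem.{u}) (hσ : E.IsStrategy σ) (hp : p ∈ Ioo (0 : ℝ) 1)
    (hτ : E.IsStrategy τ) (hq : q ∈ Ioo (0 : ℝ) 1) :
    (Integrable fun s => σ s * E.marginal s * E.msgValue D q τ s (1 - s)) ∧
    E.welfare₂ D p σ q τ =
      E.msgValue D q τ (E.prior * E.silence p σ 1) ((1 - E.prior) * E.silence p σ 0) +
        p * ∫ s, σ s * E.marginal s * E.msgValue D q τ s (1 - s) := by
  have hx := prior_mul_silence_pos hσ hp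
  have hy := one_sub_prior_mul_silence_pos hσ hp
  obtain ⟨C, hC⟩ := D.exists_abs_value_le
  have hCm : ∀ z : ℝ, |D.clipValue z| ≤ C := fun z => hC _ (DecisionProblem.clip_mem z)
  -- The expected value after the first message, in each state.
  have hI : ∀ ω, Integrable fun s => σ s * E.density ω s *
      E.msgExp q τ ω (fun n => D.clipValue (E.update q τ s (1 - s) n)) := by
    intro ω
    have := E.integrable_bdd_mul
      (g := fun s => E.msgExp q τ ω (fun n => D.clipValue (E.update q τ s (1 - s) n))) (C := C)
      (measurable_msgExp hτ (D.measurable_clipValue.comp (by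
          simp only [update_none, post]; fun_prop))
        (D.measurable_clipValue.comp measurable_update_prod) ω)
      (fun s _ => abs_msgExp_le hτ hq (D.measurable_clipValue.comp (measurable_update _ _))
        (hCm _) (fun _ _ => hCm _) ω) (hσ.integrable_mul_density ω)
      (fun s hs => by simp [E.density_eq_zero ω s hs])
    simpa only [mul_comm] using this
  have hae : (fun s => E.prior * (σ s * E.density 1 s *
        E.msgExp q τ 1 (fun n => D.clipValue (E.update q τ s (1 - s) n))) +
      (1 - E.prior) * (σ s * E.density 0 s *
        E.msgExp q τ 0 (fun n => D.clipValue (E.update q τ s (1 - s) n)))) =ᵐ[volume]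
      fun s => σ s * E.marginal s * E.msgValue D q τ s (1 - s) := by
    filter_upwards [E.density_one_ae, E.density_zero_ae] with s h1 h0
    rw [msgValue, mix]
    linear_combination
      σ s * E.msgExp q τ 1 (fun n => D.clipValue (E.update q τ s (1 - s) n)) * h1 +
      σ s * E.msgExp q τ 0 (fun n => D.clipValue (E.update q τ s (1 - s) n)) * h0
  refine ⟨(((hI 1).const_mul _).add ((hI 0).const_mul _)).congr hae, ?_⟩
  have h : ∀ ω, E.msgExp p σ ω (fun m₁ => E.msgExp q τ ω fun m₂ =>
      D.value (E.belief₂ p σ q τ m₁ m₂)) = E.silence p σ ω * E.msgExp q τ ω (fun n =>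
        D.clipValue (E.update q τ (E.prior * E.silence p σ 1)
          ((1 - E.prior) * E.silence p σ 0) n)) +
      p * ∫ s, σ s * E.density ω s *
        E.msgExp q τ ω (fun n => D.clipValue (E.update q τ s (1 - s) n)) := by
    intro ω
    rw [msgExp]
    congr 2
    · rw [belief₂_none]
      exact msgExp_congr (D.clipValue_eq (update_none_mem hτ hq hx.le hy.le)).symm fun s hs =>
        (D.clipValue_eq (update_some_mem hx.le hy.le (E.Icc_subset_unit hs))).symm
    · refine integral_congr_ae (Filter.Eventually.of_forall fun s => ?_)
      by_cases hs : s ∈ Icc E.lo E.hi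
      · have hu := E.Icc_subset_unit hs
        simp only [belief₂_some]
        congr 1
        exact msgExp_congr
          (D.clipValue_eq (update_none_mem hτ hq hu.1 (sub_nonneg.2 hu.2))).symm fun s hs =>
          (D.clipValue_eq (update_some_mem hu.1 (sub_nonneg.2 hu.2) (E.Icc_subset_unit hs))).symm
      · simp [E.density_eq_zero ω s hs]
  rw [welfare₂, Fin.sum_univ_two, h, h, ← integral_congr_ae hae,
    integral_add ((hI 1).const_mul _) ((hI 0).const_mul _), integral_const_mul, integral_const_mul,
    msgValue, mix]
  simp only [stateProb, Fin.isValue, zero_ne_one, if_false, if_true]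
  ring

/-- Observing a second sender is never harmful; if it is of no value, then this is so after
silence and after almost every disclosed signal of the first sender. -/
lemma welfare₁_le_welfare₂ (D : DecisionProblem.{u}) (hσ : E.IsStrategy σ) (hp : p ∈ Ioo (0 : ℝ) 1)
    (hτ : E.IsStrategy τ) (hq : q ∈ Ioo (0 : ℝ) 1) :
    E.welfare₁ D p σ ≤ E.welfare₂ D p σ q τ ∧
      (E.welfare₁ D p σ = E.welfare₂ D p σ q τ → ∀ᵐ s, s ∈ Icc E.lo E.hi → 0 < σ s →
        E.msgValue D q τ s (1 - s) ≠ D.value s → E.density 1 s = 0) := by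
  obtain ⟨i1, e1⟩ := welfare₁_eq D hσ hp
  obtain ⟨i2, e2⟩ := welfare₂_eq D hσ hp hτ hq
  have hnn : ∀ s, 0 ≤ σ s * E.marginal s * E.msgValue D q τ s (1 - s) -
      σ s * E.marginal s * D.clipValue s := by
    intro s
    by_cases hs : s ∈ Icc E.lo E.hi
    · have hu := E.Icc_subset_unit hs
      have := value_post_le_msgValue (D := D) hτ hq hu.1 (sub_nonneg.2 hu.2)
      rw [add_sub_cancel, one_mul, post_self, ← D.clipValue_eq hu] at this
      rw [← mul_sub]
      exact mul_nonneg (mul_nonneg (hσ.2 s hs).1 (E.marginal_nonneg s)) (sub_nonneg.2 this)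
    · simp [E.marginal_eq_zero hs]
  have h1 := value_post_le_msgValue (D := D) hτ hq (prior_mul_silence_pos hσ hp).le
    (one_sub_prior_mul_silence_pos hσ hp).le
  rw [← belief₁_none] at h1
  have h2 := mul_nonneg hp.1.le (integral_nonneg (μ := volume) hnn)
  have h3 := integral_sub i2 i1
  rw [h3] at h2
  refine ⟨by linarith, fun heq => ?_⟩
  have h4 : p * ∫ s, σ s * E.marginal s * E.msgValue D q τ s (1 - s) -
      σ s * E.marginal s * D.clipValue s = 0 := by
    rw [h3]
    linarith
  have h5 := (mul_eq_zero.1 h4).resolve_left hp.1.ne'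
  rw [integral_eq_zero_iff_of_nonneg hnn (i2.sub i1)] at h5
  filter_upwards [h5] with s hs hI hpos hne
  rw [Pi.zero_apply, ← mul_sub, D.clipValue_eq (E.Icc_subset_unit hI)] at hs
  have h6 := (mul_eq_zero.1 hs).resolve_right (sub_ne_zero.2 hne)
  exact E.density_eq_zero_of_marginal ((mul_eq_zero.1 h6).resolve_left hpos.ne') 1

/-- A lower threshold gives the decision maker more information. -/
lemma welfare₁_thr_anti (D : DecisionProblem.{u}) (hp : p ∈ Ioo (0 : ℝ) 1) (htt' : t ≤ t') :
    E.welfare₁ D p (thr t') ≤ E.welfare₁ D p (thr t) := by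
  obtain ⟨i, e⟩ := welfare₁_eq D (E.isStrategy_thr t) hp
  obtain ⟨i', e'⟩ := welfare₁_eq D (E.isStrategy_thr t') hp
  obtain ⟨a, ha⟩ := D.exists_isOptimal (belief₁_none_mem (E.isStrategy_thr t') hp)
  have hx := fun t => (prior_mul_silence_pos (E.isStrategy_thr t) hp).le
  have hy := fun t => (one_sub_prior_mul_silence_pos (E.isStrategy_thr t) hp).le
  have h1 := mul_le_mul_of_nonneg_left (DecisionProblem.expectedUtility_le_value (D := D)
    (belief₁_none_mem (E.isStrategy_thr t) hp) a) (silentMass_pos (E := E) hp t).le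
  rw [silentMass, belief₁_none, add_mul_expectedUtility_post (hx t) (hy t)] at h1
  rw [e, e', ha.value_eq, belief₁_none, belief₁_none,
    add_mul_expectedUtility_post (hx t') (hy t')]
  have hM := fun t => prior_mul_silence_eq (E := E) p t
  have hN : ∀ t, (1 - E.prior) * E.silence p (thr t) 0 =
      1 - p * (∫ s, thr t s * E.marginal s) - E.prior * E.silence p (thr t) 1 := fun t => by
    rw [← silentMass_eq, silentMass]
    ring
  have iA := fun t => integrable_thr_mul_marginal (E := E) t
  have iB := fun t => integrable_thr_mul_id_mul_marginal (E := E) t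
  have jA : Integrable fun s => thr t s * E.marginal s - thr t' s * E.marginal s :=
    (iA t).sub (iA t')
  have jB : Integrable fun s => thr t s * (s * E.marginal s) - thr t' s * (s * E.marginal s) :=
    (iB t).sub (iB t')
  -- On the signals between the thresholds, the value exceeds the utility of `a`.
  have key : ∫ s, ((D.utility a 1 - D.utility a 0) *
        (thr t s * (s * E.marginal s) - thr t' s * (s * E.marginal s)) +
        D.utility a 0 * (thr t s * E.marginal s - thr t' s * E.marginal s)) ≤
      ∫ s, (thr t s * E.marginal s * D.clipValue s - thr t' s * E.marginal s * D.clipValue s) := by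
    refine integral_mono ((jB.const_mul _).add (jA.const_mul _)) (i.sub i') fun s => ?_
    by_cases hs : s ∈ Icc E.lo E.hi
    · have hu := E.Icc_subset_unit hs
      have h2 := DecisionProblem.expectedUtility_le_value (D := D) hu a
      rw [DecisionProblem.expectedUtility] at h2
      have h3 : 0 ≤ thr t s - thr t' s := by
        unfold thr
        split_ifs with h4 h5 h5 <;> norm_num
        exact h4 (htt'.trans_lt h5)
      have := mul_le_mul_of_nonneg_left h2 (mul_nonneg h3 (E.marginal_nonneg s))
      simp only [D.clipValue_eq hu]
      linarith
    · simp [E.marginal_eq_zero hs]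
  rw [integral_sub i i', integral_add (jB.const_mul _) (jA.const_mul _), integral_const_mul, integral_const_mul,
    integral_sub (iB t) (iB t'), integral_sub (iA t) (iA t')] at key
  have := mul_le_mul_of_nonneg_left key hp.1.le
  rw [hN, hM] at h1 ⊢
  rw [hN t, hM t] at *
  linarith

/-! ### Exchanging the senders -/

lemma belief₂_swap (m n : Option ℝ) : E.belief₂ p σ q τ m n = E.belief₂ q τ p σ n m := by
  simp only [belief₂, mul_comm]

lemma msgExp_swap {F : Option ℝ → Option ℝ → ℝ} {C : ℝ} (hσ : E.IsStrategy σ)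
    (hτ : E.IsStrategy τ) (h10 : Measurable fun s => F (some s) none)
    (h01 : Measurable fun s => F none (some s))
    (h11 : Measurable fun z : ℝ × ℝ => F (some z.1) (some z.2)) (hC : ∀ m n, |F m n| ≤ C)
    (ω : Fin 2) : E.msgExp p σ ω (fun m => E.msgExp q τ ω (F m)) =
      E.msgExp q τ ω (fun n => E.msgExp p σ ω fun m => F m n) := by
  have iσ := hσ.integrable_mul_density ω
  have iτ := hτ.integrable_mul_density ω
  have i2 : Integrable (fun z : ℝ × ℝ => (σ z.1 * E.density ω z.1) * (τ z.2 * E.density ω z.2) *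
      F (some z.1) (some z.2)) (volume.prod volume) := by
    refine Integrable.mono' ((iσ.mul_prod iτ).norm.mul_const C)
      ((iσ.mul_prod iτ).1.mul h11.aestronglyMeasurable) (Filter.Eventually.of_forall fun z => ?_)
    rw [norm_mul]
    exact mul_le_mul_of_nonneg_left (hC _ _) (norm_nonneg _)
  have i10 : Integrable fun s => σ s * E.density ω s * F (some s) none :=
    IsBddMsg.integrable (g := fun m => F m none) ⟨h10, C, fun _ _ => hC _ _⟩ hσ ω
  have i01 : Integrable fun s => τ s * E.density ω s * F none (some s) :=
    IsBddMsg.integrable (g := F none) ⟨h01, C, fun _ _ => hC _ _⟩ hτ ω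
  have l : (fun s => σ s * E.density ω s * (E.silence q τ ω * F (some s) none +
      q * ∫ t, τ t * E.density ω t * F (some s) (some t))) = fun s =>
      E.silence q τ ω * (σ s * E.density ω s * F (some s) none) +
      q * ∫ t, (σ s * E.density ω s) * (τ t * E.density ω t) * F (some s) (some t) := by
    funext s
    simp only [mul_assoc, integral_const_mul]
    ring
  have r : (fun t => τ t * E.density ω t * (E.silence p σ ω * F none (some t) +
      p * ∫ s, σ s * E.density ω s * F (some s) (some t))) = fun t =>
      E.silence p σ ω * (τ t * E.density ω t * F none (some t)) +
      p * ∫ s, (σ s * E.density ω s) * (τ t * E.density ω t) * F (some s) (some t) := by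
    funext t
    have : (fun s => (σ s * E.density ω s) * (τ t * E.density ω t) * F (some s) (some t)) =
        fun s => (τ t * E.density ω t) * (σ s * E.density ω s * F (some s) (some t)) := by
      funext s; ring
    rw [this, integral_const_mul]
    ring
  simp only [msgExp]
  rw [l, r, integral_add (i10.const_mul _) (i2.integral_prod_left.const_mul _),
    integral_add (i01.const_mul _) (i2.integral_prod_right.const_mul _)]
  simp only [integral_const_mul]
  rw [integral_integral_swap (f := fun s t => (σ s * E.density ω s) * (τ t * E.density ω t) *
    F (some s) (some t)) i2]
  ring

lemma welfare₂_swap (D : DecisionProblem.{u}) (hσ : E.IsStrategy σ) (hp : p ∈ Ioo (0 : ℝ) 1)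
    (hτ : E.IsStrategy τ) (hq : q ∈ Ioo (0 : ℝ) 1) :
    E.welfare₂ D p σ q τ = E.welfare₂ D q τ p σ := by
  obtain ⟨C, hC⟩ := D.exists_abs_value_le
  have hmem : ∀ {σ τ p q} (_ : E.IsStrategy σ) (_ : p ∈ Ioo (0 : ℝ) 1) (_ : E.IsStrategy τ)
      (_ : q ∈ Ioo (0 : ℝ) 1) (m n : Option ℝ), (∀ s ∈ m, s ∈ Icc E.lo E.hi) →
      (∀ s ∈ n, s ∈ Icc E.lo E.hi) → E.belief₂ p σ q τ m n ∈ Icc (0 : ℝ) 1 := by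
    intro σ τ p q hσ hp hτ hq m n hm hn
    have hl : ∀ {σ p} (_ : E.IsStrategy σ) (_ : p ∈ Ioo (0 : ℝ) 1) (m : Option ℝ) (ω),
        (∀ s ∈ m, s ∈ Icc E.lo E.hi) → 0 ≤ E.likelihood p σ ω m := by
      intro σ p hσ hp m ω hm
      cases m with
      | none => exact (hσ.silence_pos hp ω).le
      | some s => exact likelihood_some_nonneg (E.Icc_subset_unit (hm s rfl)) ω
    exact post_mem (mul_nonneg E.prior_pos.le (mul_nonneg (hl hσ hp m 1 hm) (hl hτ hq n 1 hn)))
      (mul_nonneg E.one_sub_prior_pos.le (mul_nonneg (hl hσ hp m 0 hm) (hl hτ hq n 0 hn)))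
  have hclip : ∀ {σ τ p q} (_ : E.IsStrategy σ) (_ : p ∈ Ioo (0 : ℝ) 1) (_ : E.IsStrategy τ)
      (_ : q ∈ Ioo (0 : ℝ) 1) (ω : Fin 2), E.msgExp p σ ω (fun m => E.msgExp q τ ω fun n =>
      D.value (E.belief₂ p σ q τ m n)) = E.msgExp p σ ω (fun m => E.msgExp q τ ω fun n =>
      D.clipValue (E.belief₂ p σ q τ m n)) := by
    intro σ τ p q hσ hp hτ hq ω
    refine msgExp_congr ?_ fun s hs => ?_
    · exact msgExp_congr (D.clipValue_eq (hmem hσ hp hτ hq _ _ (by simp) (by simp))).symm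
        fun t ht => (D.clipValue_eq (hmem hσ hp hτ hq _ _ (by simp) (by simpa using ht))).symm
    · exact msgExp_congr (D.clipValue_eq (hmem hσ hp hτ hq _ _ (by simpa using hs) (by simp))).symm
        fun t ht => (D.clipValue_eq
          (hmem hσ hp hτ hq _ _ (by simpa using hs) (by simpa using ht))).symm
  rw [welfare₂, welfare₂]
  refine Finset.sum_congr rfl fun ω _ => ?_
  rw [hclip hσ hp hτ hq, hclip hτ hq hσ hp, msgExp_swap (C := C) hσ hτ]
  · simp only [belief₂_swap]
  · refine D.measurable_clipValue.comp ?_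
    simp only [belief₂_some, update_none, post]
    fun_prop
  · refine D.measurable_clipValue.comp ?_
    simp only [belief₂_none, update_some, post]
    fun_prop
  · refine D.measurable_clipValue.comp ?_
    simp only [belief₂_some]
    exact measurable_update_prod
  · exact fun _ _ => hC _ (DecisionProblem.clip_mem _)

/-! ### When a second sender is useless -/

/-- A closed property that holds at a dense set of points of an interval holds on the interval. -/
lemma mem_of_dense {S : Set ℝ} {f : ℝ → ℝ} {a b x : ℝ} (hS : IsClosed S) (hab : a < b)
    (hx : x ∈ Icc a b) (hf : ContinuousAt f x)
    (h : ∀ c d, a ≤ c → c < d → d ≤ b → ∃ s ∈ Ioo c d, f s ∈ S) : f x ∈ S := by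
  by_contra hno
  obtain ⟨ε, hε, hball⟩ := Metric.mem_nhds_iff.1
    (hf.preimage_mem_nhds (hS.isOpen_compl.mem_nhds hno))
  obtain ⟨s, hs, hsS⟩ := h (max a (x - ε)) (min b (x + ε)) (le_max_left _ _)
    (max_lt (lt_min hab (by linarith [hx.1])) (lt_min (by linarith [hx.2]) (by linarith)))
    (min_le_left _ _)
  refine hball (?_ : s ∈ Metric.ball x ε) hsS
  rw [Metric.mem_ball, Real.dist_eq, abs_lt]
  have h1 := (le_max_right _ _).trans_lt hs.1
  have h2 := hs.2.trans_le (min_le_right _ _)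
  constructor <;> linarith

lemma post_lt_self {s u v : ℝ} (hs : s ∈ Ioo (0 : ℝ) 1) (hu : 0 ≤ u) (huv : u < v) :
    post (s * u) ((1 - s) * v) < s := by
  have h1 := mul_nonneg hs.1.le hu
  have h2 := mul_pos (sub_pos.2 hs.2) (hu.trans_lt huv)
  rw [post, div_lt_iff₀ (by linarith)]
  nlinarith [mul_pos (mul_pos hs.1 (sub_pos.2 hs.2)) (sub_pos.2 huv)]

lemma self_lt_post {s u v : ℝ} (hs : s ∈ Ioo (0 : ℝ) 1) (hv : 0 ≤ v) (huv : v < u) :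
    s < post (s * u) ((1 - s) * v) := by
  have h1 := mul_pos hs.1 (hv.trans_lt huv)
  have h2 := mul_nonneg (sub_pos.2 hs.2).le hv
  rw [post, lt_div_iff₀ (by linarith)]
  nlinarith [mul_pos (mul_pos hs.1 (sub_pos.2 hs.2)) (sub_pos.2 huv)]

lemma continuousAt_post {s u v : ℝ} (h : s * u + (1 - s) * v ≠ 0) :
    ContinuousAt (fun s => post (s * u) ((1 - s) * v)) s := by
  unfold post
  exact ContinuousAt.div (by fun_prop) (by fun_prop) h

/-- Propagation of a closed interval of beliefs: if it contains, with each of a dense set of points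
`s` of `(a, b)`, also points below and above `s` that depend continuously on `s`, then it
exhausts `(a, b)`. -/
lemma Ioo_subset_of_propagation {O G : Set ℝ} {φ ψ : ℝ → ℝ} {a b s₀ : ℝ} (hO : O.OrdConnected)
    (hG : ∀ c d, a ≤ c → c < d → d ≤ b → ∃ s ∈ Ioo c d, s ∈ G)
    (hφ : ∀ s ∈ Ioo a b, ContinuousAt φ s ∧ φ s < s)
    (hψ : ∀ s ∈ Ioo a b, ContinuousAt ψ s ∧ s < ψ s)
    (h : ∀ s ∈ Ioo a b, s ∈ G → s ∈ O → φ s ∈ O ∧ ψ s ∈ O)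
    (hs₀ : s₀ ∈ Ioo a b) (hG₀ : s₀ ∈ G) (hO₀ : s₀ ∈ O) : Ioo a b ⊆ O := by
  have hint : ∀ s ∈ Ioo a b, s ∈ G → s ∈ O → ∀ x ∈ Ioo (φ s) (ψ s), x ∈ interior O := by
    intro s hs hsG hsO x hx
    obtain ⟨h1, h2⟩ := h s hs hsG hsO
    exact interior_maximal (Ioo_subset_Icc_self.trans (hO.out h1 h2)) isOpen_Ioo hx
  refine Subset.trans ?_ interior_subset
  refine isPreconnected_Ioo.subset_of_closure_inter_subset isOpen_interior
    ⟨s₀, hs₀, hint s₀ hs₀ hG₀ hO₀ _ ⟨(hφ s₀ hs₀).2, (hψ s₀ hs₀).2⟩⟩ ?_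
  rintro x ⟨hxc, hx⟩
  have hnear : ∀ᶠ s in nhds x, s ∈ Ioo a b := Ioo_mem_nhds hx.1 hx.2
  have hev : ∀ᶠ s in nhds x, s ∈ Ioo a b ∧ φ s < x ∧ x < ψ s :=
    hnear.and
      (((hφ x hx).1.eventually_lt_const (hφ x hx).2).and
        ((hψ x hx).1.eventually_const_lt (hψ x hx).2))
  obtain ⟨W, hW, hWo, hxW⟩ := eventually_nhds_iff.1 hev
  obtain ⟨y, hyW, hyO⟩ := mem_closure_iff.1 hxc W hWo hxW
  obtain ⟨ε, hε, hball⟩ := Metric.isOpen_iff.1 (hWo.inter isOpen_interior) y ⟨hyW, hyO⟩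
  have hyab := (hW y hyW).1
  obtain ⟨s, hs, hsG⟩ := hG y (min b (y + ε)) hyab.1.le (lt_min hyab.2 (by linarith))
    (min_le_left _ _)
  have hsm : s ∈ W ∩ interior O := hball (by
    rw [Metric.mem_ball, Real.dist_eq, abs_lt]
    have := hs.2.trans_le (min_le_right _ _)
    constructor <;> linarith [hs.1])
  obtain ⟨h1, h2, h3⟩ := hW s hsm.1
  exact hint s h1 hsG (interior_subset hsm.2) x ⟨h2, h3⟩

/-- Silence of a sender with a threshold above the prior is bad news. -/
lemma silence_one_lt_zero (hq : q ∈ Ioo (0 : ℝ) 1) (ht : E.prior ≤ t) (hlt : t < E.hi) :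
    E.silence q (thr t) 1 < E.silence q (thr t) 0 := by
  have hst := E.isStrategy_thr t
  have h1 := hst.integrable_mul_density 1
  have h0 := hst.integrable_mul_density 0
  have key : ∀ᵐ s, E.prior * (1 - E.prior) *
      (thr t s * E.density 1 s - thr t s * E.density 0 s) =
      thr t s * ((s - E.prior) * E.marginal s) := by
    filter_upwards [E.density_one_ae, E.density_zero_ae] with s h1 h0
    linear_combination thr t s * ((1 - E.prior) * h1 - E.prior * h0)
  have : 0 < ∫ s, (thr t s * E.density 1 s - thr t s * E.density 0 s) := by
    refine E.integral_pos_of_density (a := t) (b := E.hi) 1 (E.lo_lt_prior.le.trans ht) hlt le_rfl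
      (h1.sub h0) ?_ ?_
    · filter_upwards [key] with s hs
      refine nonneg_of_mul_nonneg_right ?_ (mul_pos E.prior_pos E.one_sub_prior_pos)
      rw [hs]
      unfold thr
      split_ifs with hts
      · rw [one_mul]
        exact mul_nonneg (by linarith) (E.marginal_nonneg s)
      · simp
    · filter_upwards [key] with s hs hmem hz
      rw [hz, mul_zero, thr, if_pos hmem.1, one_mul, eq_comm, mul_eq_zero] at hs
      exact E.density_eq_zero_of_marginal
        (hs.resolve_left (sub_pos.2 (ht.trans_lt hmem.1)).ne') 1
  rw [integral_sub h1 h0] at this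
  rw [hst.silence_eq, hst.silence_eq]
  linarith [mul_lt_mul_of_pos_left (sub_pos.1 this) hq.1]

/-- The likelihoods of a message that is bad news, sent (possibly in the limit) by a sender with
threshold `t`. -/
lemma exists_bad_news (hq : q ∈ Ioo (0 : ℝ) 1) (ht : t ∈ Icc E.lo E.hi) (hlt : t < E.hi) :
    ∃ n : Option ℝ, (∀ s ∈ n, s ∈ Icc t E.hi) ∧ 0 ≤ E.likelihood q (thr t) 1 n ∧
      E.likelihood q (thr t) 1 n < E.likelihood q (thr t) 0 n := by
  rcases lt_or_ge t E.prior with h | h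
  · refine ⟨some t, by simp [hlt.le], likelihood_some_nonneg (E.Icc_subset_unit ht) 1, ?_⟩
    simp only [likelihood, Fin.isValue, zero_ne_one, if_false, if_true]
    rw [div_lt_div_iff₀ E.prior_pos E.one_sub_prior_pos]
    nlinarith
  · exact ⟨none, by simp, ((E.isStrategy_thr t).silence_pos hq 1).le, silence_one_lt_zero hq h hlt⟩

lemma update_smul {x y : ℝ} (hxy : x + y ≠ 0) (n : Option ℝ) :
    E.update q τ x y n = E.update q τ (post x y) (1 - post x y) n := by
  have h1 : x = (x + y) * post x y := by rw [post, mul_div_cancel₀ _ hxy]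
  have h0 : y = (x + y) * (1 - post x y) := by linarith
  rw [update, update, ← post_mul_left hxy (post x y * _)]
  congr 1
  · linear_combination E.likelihood q τ 1 n * h1
  · linear_combination E.likelihood q τ 0 n * h0

/-- If the second of two senders, both of whom disclose some signals, adds nothing to the welfare
that the first one provides alone, and the first one's belief after silence is a signal that he
discloses, then both are useless: the posteriors after the first sender's message range over an
interval, the second sender's message moves each of them up and down, and so one and the same
action must be optimal throughout. -/
lemma messagesUseless_of_welfare_eq (hp : p ∈ Ioo (0 : ℝ) 1) (hq : q ∈ Ioo (0 : ℝ) 1)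
    (ht : E.HasThreshold σ t) (ht' : E.HasThreshold τ t') (hhi : t < E.hi) (hhi' : t' < E.hi)
    (hb : E.silentBelief p t ∈ Icc t E.hi)
    (h : E.welfare₁ D p (thr t) = E.welfare₂ D p (thr t) q (thr t')) :
    E.MessagesUseless D p σ q τ := by
  have hst := E.isStrategy_thr t
  have hst' := E.isStrategy_thr t'
  have hlo := ht.1.1
  have hunit : ∀ s ∈ Ioo t E.hi, s ∈ Ioo (0 : ℝ) 1 := fun s hs =>
    ⟨E.lo_nonneg.trans_lt (hlo.trans_lt hs.1), hs.2.trans_le E.hi_le_one⟩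
  set G : Set ℝ := {s | E.msgValue D q (thr t') s (1 - s) = D.value s} with hGdef
  have hG : ∀ c d, t ≤ c → c < d → d ≤ E.hi → ∃ s ∈ Ioo c d, s ∈ G := by
    intro c d hc hcd hd
    refine E.exists_of_ae 1 (hlo.trans hc) hcd hd ?_
    filter_upwards [(welfare₁_le_welfare₂ D hst hp hst' hq).2 h] with s hs hmem hno
    have hts := hc.trans_lt hmem.1
    exact hs ⟨hlo.trans hts.le, hmem.2.le.trans hd⟩ (by simp [thr, hts]) hno
  -- An action that is optimal at a good belief stays so after all messages of the second sender.
  have hstay : ∀ a, ∀ s ∈ Ioo t E.hi, s ∈ G → D.IsOptimal s a → ∀ n : Option ℝ,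
      (∀ r ∈ n, r ∈ Icc t' E.hi) → D.IsOptimal (E.update q (thr t') s (1 - s) n) a := by
    intro a s hs hsG hopt n hn
    have hu := hunit s hs
    have hadd : s + (1 - s) = 1 := by ring
    obtain ⟨h1, h2⟩ := isOptimal_of_msgValue_eq (D := D) hst' hq hu.1 (sub_pos.2 hu.2)
      (by rw [hadd, one_mul, post_self]; exact hsG) (a := a) (by rwa [post_self])
    cases n with
    | none => exact h1
    | some r =>
      refine mem_of_dense (f := fun r => E.update q (thr t') s (1 - s) (some r))
        (D.isClosed_isOptimal a) hhi' (hn r rfl) ?_ fun c d hc hcd hd => ?_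
      · simp only [update_some, post]
        exact ContinuousAt.div (by fun_prop) (by fun_prop)
          (weights_pos hu.1 (sub_pos.2 hu.2) ⟨ht'.1.1.trans (hn r rfl).1, (hn r rfl).2⟩).ne'
      · refine E.exists_of_ae 1 (ht'.1.1.trans hc) hcd hd ?_
        filter_upwards [h2] with r hr hmem hno
        have htr := hc.trans_lt hmem.1
        exact hr ⟨ht'.1.1.trans htr.le, hmem.2.le.trans hd⟩ (by simp [thr, htr]) hno
  obtain ⟨s₀, hs₀, hG₀⟩ := hG t E.hi le_rfl hhi le_rfl
  obtain ⟨a, ha⟩ := D.exists_isOptimal (Ioo_subset_Icc_self (hunit s₀ hs₀))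
  have hclosed := D.isClosed_isOptimal a
  obtain ⟨n₀, hn₀, hl, hl'⟩ := exists_bad_news (E := E) hq ht'.1 hhi'
  have hgood0 : 0 ≤ E.likelihood q (thr t') 0 (some E.hi) :=
    likelihood_some_nonneg (E.Icc_subset_unit (right_mem_Icc.2 E.lo_lt_hi.le)) 0
  have hgood : E.likelihood q (thr t') 0 (some E.hi) < E.likelihood q (thr t') 1 (some E.hi) := by
    simp only [likelihood, Fin.isValue, zero_ne_one, if_false, if_true]
    rw [div_lt_div_iff₀ E.one_sub_prior_pos E.prior_pos]
    nlinarith [E.prior_lt_hi]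
  have hIoo : Ioo t E.hi ⊆ {μ | D.IsOptimal μ a} := by
    refine Ioo_subset_of_propagation (D.ordConnected_isOptimal a) hG
      (φ := fun s => E.update q (thr t') s (1 - s) n₀)
      (ψ := fun s => E.update q (thr t') s (1 - s) (some E.hi)) (fun s hs => ?_) (fun s hs => ?_)
      (fun s hs hsG hsO => ⟨hstay a s hs hsG hsO n₀ hn₀,
        hstay a s hs hsG hsO _ (by simp [hhi'.le])⟩) hs₀ hG₀ ha
    · have hu := hunit s hs
      exact ⟨continuousAt_post (add_pos_of_nonneg_of_pos (mul_nonneg hu.1.le hl)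
        (mul_pos (sub_pos.2 hu.2) (hl.trans_lt hl'))).ne', post_lt_self hu hl hl'⟩
    · have hu := hunit s hs
      exact ⟨continuousAt_post (add_pos_of_pos_of_nonneg (mul_pos hu.1 (hgood0.trans_lt hgood))
        (mul_nonneg (sub_pos.2 hu.2).le hgood0)).ne', self_lt_post hu hgood0 hgood⟩
  have hIcc : Icc t E.hi ⊆ {μ | D.IsOptimal μ a} := by
    rw [← closure_Ioo hhi.ne]
    exact hclosed.closure_subset_iff.2 hIoo
  have hall : ∀ s ∈ Icc t E.hi, ∀ n : Option ℝ, (∀ r ∈ n, r ∈ Icc t' E.hi) →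
      D.IsOptimal (E.update q (thr t') s (1 - s) n) a := by
    intro s hs n hn
    have hu := E.Icc_subset_unit ⟨hlo.trans hs.1, hs.2⟩
    have hlim : s * E.likelihood q (thr t') 1 n + (1 - s) * E.likelihood q (thr t') 0 n ≠ 0 →
        D.IsOptimal (E.update q (thr t') s (1 - s) n) a := fun hne =>
      mem_of_dense (f := fun s => E.update q (thr t') s (1 - s) n) hclosed hhi hs
        (continuousAt_post hne) fun c d hc hcd hd => by
          obtain ⟨r, hr, hrG⟩ := hG c d hc hcd hd
          have hr' : r ∈ Ioo t E.hi := ⟨hc.trans_lt hr.1, hr.2.trans_le hd⟩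
          exact ⟨r, hr, hstay a r hr' hrG (hIoo hr') n hn⟩
    cases n with
    | none =>
      refine hlim (ne_of_gt ?_)
      have l1 := hst'.silence_pos hq 1
      have l0 := hst'.silence_pos hq 0
      simp only [likelihood]
      rcases hu.1.eq_or_lt with e | hpos
      · rw [← e]
        simpa using l0
      · exact add_pos_of_pos_of_nonneg (mul_pos hpos l1)
          (mul_nonneg (sub_nonneg.2 hu.2) l0.le)
    | some r =>
      have hrI : r ∈ Icc E.lo E.hi := ⟨ht'.1.1.trans (hn r rfl).1, (hn r rfl).2⟩
      have hru := E.Icc_subset_unit hrI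
      -- A disclosed `0` leads to the belief `0`, even if the other sender discloses `1`.
      rcases hu.1.eq_or_lt with e | hpos
      · have : E.update q (thr t') s (1 - s) (some r) = s := by
          rw [update_some, ← e, zero_mul, post, zero_div]
        rw [this]
        exact hIcc hs
      rcases hru.1.eq_or_lt with e | hrpos
      · have h0 : ∀ s, E.update q (thr t') s (1 - s) (some r) = 0 := fun s => by
          rw [update_some, ← e, zero_div, mul_zero, post, zero_div]
        have := hstay a s₀ hs₀ hG₀ ha (some r) hn
        rw [h0] at this ⊢
        exact this
      · refine hlim (ne_of_gt ?_)
        exact add_pos_of_pos_of_nonneg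
          (by simpa [likelihood] using mul_pos hpos (div_pos hrpos E.prior_pos))
          (mul_nonneg (sub_nonneg.2 hu.2) (likelihood_some_nonneg hru 0))
  have hpath : ∀ {σ t} (_ : E.HasThreshold σ t) (m : Option ℝ), E.OnPath σ m →
      ∀ s ∈ m, s ∈ Icc t E.hi := by
    intro σ t ht m hm s hs
    cases m with
    | none => cases hs
    | some r =>
      cases hs
      obtain ⟨hr, hpos⟩ := hm
      refine ⟨not_lt.1 fun hlt => ?_, hr.2⟩
      rw [(ht.2 _ hr).2 hlt] at hpos
      exact lt_irrefl _ hpos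
  refine ⟨a, fun m₁ m₂ h₁ h₂ => ?_⟩
  rw [ht.belief₂_eq ht']
  have hm₂ := hpath ht' m₂ h₂
  cases m₁ with
  | none =>
    rw [belief₂_none, update_smul (silentMass_pos (E := E) hp t).ne']
    exact hall _ hb m₂ hm₂
  | some s =>
    rw [belief₂_some]
    exact hall s (hpath ht _ h₁ s rfl) m₂ hm₂

lemma messagesUseless_swap (h : E.MessagesUseless D p σ q τ) : E.MessagesUseless D q τ p σ := by
  obtain ⟨a, ha⟩ := h
  exact ⟨a, fun m₁ m₂ h₁ h₂ => by
    rw [belief₂_swap]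
    exact ha m₂ m₁ h₂ h₁⟩

/-! ### Welfare without disclosure costs -/

lemma silentBelief_mem_of_threshold₂ (hp : p ∈ Ioo (0 : ℝ) 1) (hq : q ∈ Ioo (0 : ℝ) 1)
    (hc : c ≤ 0) {e : ℝ × ℝ} (h : e ∈ E.thresholds₂ c p q) :
    E.silentBelief p e.1 ∈ Icc e.1 E.hi := by
  have he := (thresholds₂_subset hp hq h).1
  refine ⟨?_, (silentBelief_lt_hi hp he).le⟩
  rcases he.1.eq_or_lt with hlo | hlo
  · rw [← hlo, silentBelief_lo hp]
    exact E.lo_lt_prior.le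
  · linarith [(threshold₂_bounds hp hq h).2 hlo, div_le_self_of_nonpos hc
      (thrResponse_nonneg (E := E) hp hq e.1 e.2) (thrResponse_lt_one hp hq _ _)]

lemma welfare_comparison (hp : p ∈ Ioo (0 : ℝ) 1) (hq : q ∈ Ioo (0 : ℝ) 1) (hc : c ≤ 0)
    {σ' : ℝ → ℝ} (h₂ : E.IsEquilibrium₂ c p q σ τ) (h₁ : E.IsEquilibrium₁ c p σ') :
    E.welfare₁ D p σ' ≤ E.welfare₂ D p σ q τ ∧
      (¬ E.MessagesUseless D p σ q τ → E.welfare₁ D p σ' < E.welfare₂ D p σ q τ) := by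
  obtain ⟨t, t', ht, ht'⟩ := h₂.exists_hasThreshold hp hq
  obtain ⟨r, hr⟩ := h₁.exists_hasThreshold
  have he : (t, t') ∈ E.thresholds₂ c p q := ⟨σ, τ, h₂, ht, ht'⟩
  have hr₁ : r ∈ E.thresholds₁ c p := ⟨σ', h₁, hr⟩
  obtain ⟨r', hr'⟩ := exists_isLeast_thresholds₁ (E := E) c hq
  have hle : t ≤ r := threshold₂_le_threshold₁ hp hq hc he hr₁
  have hle' : t' ≤ r' :=
    threshold₂_le_threshold₁ hq hp hc ((mem_thresholds₂_swap hp hq).1 he) hr'.1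
  have hhi := hle.trans_lt (threshold₁_lt_hi hc hr₁)
  have hhi' := hle'.trans_lt (threshold₁_lt_hi hc hr'.1)
  rw [hr.welfare₁_eq, ht.welfare₂_eq D ht']
  have h1 := welfare₁_thr_anti (E := E) D hp hle
  have h2 := (welfare₁_le_welfare₂ D (E.isStrategy_thr t) hp (E.isStrategy_thr t') hq).1
  refine ⟨h1.trans h2, fun hno => lt_of_le_of_ne (h1.trans h2) fun heq => hno ?_⟩
  exact messagesUseless_of_welfare_eq hp hq ht ht' hhi hhi'
    (silentBelief_mem_of_threshold₂ hp hq hc he) (le_antisymm h2 (heq ▸ h1))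

lemma IsEquilibrium₂.swap (h : E.IsEquilibrium₂ c p q σ τ) : E.IsEquilibrium₂ c q p τ σ :=
  ⟨h.2.1, h.1, h.2.2.2, h.2.2.1⟩

lemma betterWithTwo (D : DecisionProblem.{u}) (hp : p ∈ Ioo (0 : ℝ) 1) (hq : q ∈ Ioo (0 : ℝ) 1)
    (hc : c ≤ 0) : E.BetterWithTwo D c p q := by
  rintro σ τ h₂ r (rfl | rfl) σ' h₁
  · exact welfare_comparison hp hq hc h₂ h₁
  · rw [welfare₂_swap D h₂.1 hp h₂.2.1 hq]
    obtain ⟨h1, h2⟩ := welfare_comparison (D := D) hq hp hc h₂.swap h₁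
    exact ⟨h1, fun hno => h2 fun h => hno (messagesUseless_swap h)⟩

end Environment

/-! ### Quadratic loss -/

lemma quadraticLoss_expectedUtility (μ : ℝ) (a : Icc (0 : ℝ) 1) :
    quadraticLoss.expectedUtility μ a = -(μ * (1 - μ)) - ((a : ℝ) - μ) ^ 2 := by
  simp only [DecisionProblem.expectedUtility, quadraticLoss, Fin.val_one, Fin.val_zero,
    Nat.cast_one, Nat.cast_zero]
  ring

lemma quadraticLoss_isOptimal_iff {μ : ℝ} (hμ : μ ∈ Icc (0 : ℝ) 1) (a : Icc (0 : ℝ) 1) :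
    quadraticLoss.IsOptimal μ a ↔ (a : ℝ) = μ := by
  constructor
  · intro h
    have := h (⟨μ, hμ⟩ : Icc (0 : ℝ) 1)
    rw [quadraticLoss_expectedUtility, quadraticLoss_expectedUtility, sub_self] at this
    nlinarith [sq_nonneg ((a : ℝ) - μ)]
  · intro h (a' : Icc (0 : ℝ) 1)
    rw [quadraticLoss_expectedUtility, quadraticLoss_expectedUtility, h, sub_self]
    nlinarith [sq_nonneg ((a' : ℝ) - μ)]

lemma quadraticLoss_value {μ : ℝ} (hμ : μ ∈ Icc (0 : ℝ) 1) :
    quadraticLoss.value μ = -(μ * (1 - μ)) := by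
  have h := (quadraticLoss_isOptimal_iff hμ (⟨μ, hμ⟩ : Icc (0 : ℝ) 1)).2 rfl
  rw [h.value_eq, quadraticLoss_expectedUtility]
  simp

lemma continuous_quadraticLoss_clipValue : Continuous quadraticLoss.clipValue := by
  have : quadraticLoss.clipValue =
      fun μ => -((max 0 (min 1 μ)) * (1 - (max 0 (min 1 μ)))) := by
    funext μ
    exact quadraticLoss_value (DecisionProblem.clip_mem μ)
  rw [this]
  fun_prop

namespace Environment

variable {E : Environment} {c p q t t' : ℝ} {σ τ : ℝ → ℝ} {D : DecisionProblem.{u}}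

/-! ### Existence of best equilibria -/

lemma continuous_msgValue_thr (hq : q ∈ Ioo (0 : ℝ) 1) (hD : Continuous D.clipValue) {x y : ℝ}
    (hx : 0 ≤ x) (hy : 0 ≤ y) (hxy : 0 < x + y) :
    Continuous fun t => E.msgValue D q (thr t) x y := by
  obtain ⟨C, hC⟩ := D.exists_abs_value_le
  have h := fun ω => (continuous_msgExp_update (E := E) (X := Unit) (x := fun _ => x)
    (y := fun _ => y) hq continuous_const continuous_const (fun _ => hx) (fun _ => hy)
    (fun _ _ => continuous_const) (fun _ => hxy) hD
    (fun μ hμ => by rw [D.clipValue_eq hμ]; exact hC μ hμ) ω).comp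
    ((continuous_const (y := ())).prodMk (continuous_id (X := ℝ)))
  exact (continuous_const.mul (h 1)).add (continuous_const.mul (h 0))

lemma continuous_welfare₂ (hp : p ∈ Ioo (0 : ℝ) 1) (hq : q ∈ Ioo (0 : ℝ) 1)
    (hD : Continuous D.clipValue) :
    Continuous fun z : ℝ × ℝ => E.welfare₂ D p (thr z.1) q (thr z.2) := by
  obtain ⟨C, hC⟩ := D.exists_abs_value_le
  have hCm : ∀ z : ℝ, |D.clipValue z| ≤ C := fun z => hC _ (DecisionProblem.clip_mem z)
  have h := fun ω => continuous_msgExp_silent (E := E) hp hq hD (fun μ _ => hCm μ) ω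
  have hx := ((E.continuous_silence p 1).const_mul E.prior).comp (continuous_fst (Y := ℝ))
  have hy := ((E.continuous_silence p 0).const_mul (1 - E.prior)).comp (continuous_fst (Y := ℝ))
  have h2 := (continuous_integral_thr (E := E) (X := ℝ)
    (F := fun t s => E.msgValue D q (thr t) s (1 - s)) (C := C) E.integrable_marginal
    (fun _ => E.marginal_eq_zero) (fun t => ?_) (fun t s hs => ?_) (fun s hs => ?_)).comp
    continuous_swap
  · simp only [(welfare₂_eq D (E.isStrategy_thr _) hp (E.isStrategy_thr _) hq).2]
    exact ((hx.mul (h 1)).add (hy.mul (h 0))).add (continuous_const.mul h2)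
  · have hm := fun ω => measurable_msgExp (E := E) (q := q) (τ := thr t)
      (F := fun s n => D.clipValue (E.update q (thr t) s (1 - s) n)) (E.isStrategy_thr t)
      (D.measurable_clipValue.comp (by simp only [update_none, post]; fun_prop))
      (D.measurable_clipValue.comp measurable_update_prod) ω
    exact (measurable_id.mul (hm 1)).add ((measurable_const.sub measurable_id).mul (hm 0))
  · have hu := E.Icc_subset_unit hs
    have hb := fun ω => abs_msgExp_le (E.isStrategy_thr t) hq
      (g := fun n => D.clipValue (E.update q (thr t) s (1 - s) n))
      (D.measurable_clipValue.comp (measurable_update _ _)) (hCm _) (fun _ _ => hCm _) ω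
    have b1 := abs_le.1 (hb 1)
    have b0 := abs_le.1 (hb 0)
    have hs' := sub_nonneg.2 hu.2
    rw [msgValue, mix, abs_le]
    constructor <;> nlinarith [mul_le_mul_of_nonneg_left b1.1 hu.1,
      mul_le_mul_of_nonneg_left b1.2 hu.1, mul_le_mul_of_nonneg_left b0.1 hs',
      mul_le_mul_of_nonneg_left b0.2 hs']
  · have hu := E.Icc_subset_unit hs
    exact continuous_msgValue_thr hq hD hu.1 (sub_nonneg.2 hu.2) (by norm_num)

lemma isBestWelfare₁ (D : DecisionProblem.{u}) (hp : p ∈ Ioo (0 : ℝ) 1)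
    (ht : IsLeast (E.thresholds₁ c p) t) : E.IsBestWelfare₁ D c p (E.welfare₁ D p (thr t)) := by
  obtain ⟨⟨σ, hσ, hσt⟩, hmin⟩ := ht
  refine ⟨⟨σ, hσ, (hσt.welfare₁_eq D).symm⟩, ?_⟩
  rintro _ ⟨τ, hτ, rfl⟩
  obtain ⟨r, hr⟩ := hτ.exists_hasThreshold
  rw [hr.welfare₁_eq]
  exact welfare₁_thr_anti D hp (hmin ⟨τ, hτ, hr⟩)

lemma exists_isBestWelfare₂ (hp : p ∈ Ioo (0 : ℝ) 1) (hq : q ∈ Ioo (0 : ℝ) 1)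
    (hD : Continuous D.clipValue) (hne : (E.thresholds₂ c p q).Nonempty) :
    ∃ e ∈ E.thresholds₂ c p q,
      E.IsBestWelfare₂ D c p q (E.welfare₂ D p (thr e.1) q (thr e.2)) := by
  have hclosed : IsClosed (E.thresholds₂ c p q) := by
    have : E.thresholds₂ c p q =
        {e | e.1 = E.clamp (E.silentBelief p e.1 + c / (1 - E.thrResponse p e.1 q e.2))} ∩
        {e | e.2 = E.clamp (E.silentBelief q e.2 + c / (1 - E.thrResponse q e.2 p e.1))} :=
      Set.ext fun _ => mem_thresholds₂_iff hp hq
    rw [this]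
    refine (isClosed_eq continuous_fst (continuous_clamp.comp (.add ?_ (.div ?_ ?_ ?_)))).inter
      (isClosed_eq continuous_snd (continuous_clamp.comp (.add ?_ (.div ?_ ?_ ?_))))
    · exact (continuous_silentBelief hp).comp continuous_fst
    · exact continuous_const
    · exact continuous_const.sub (continuous_thrResponse hp hq)
    · exact fun z => (sub_pos.2 (thrResponse_lt_one hp hq _ _)).ne'
    · exact (continuous_silentBelief hq).comp continuous_snd
    · exact continuous_const
    · exact continuous_const.sub ((continuous_thrResponse hq hp).comp continuous_swap)
    · exact fun z => (sub_pos.2 (thrResponse_lt_one hq hp _ _)).ne'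
  have hcomp : IsCompact (E.thresholds₂ c p q) :=
    (isCompact_Icc.prod isCompact_Icc).of_isClosed_subset hclosed fun e he =>
      mem_prod.2 (thresholds₂_subset hp hq he)
  obtain ⟨e, he, hmax⟩ := hcomp.exists_isMaxOn hne
    (continuous_welfare₂ (E := E) hp hq hD).continuousOn
  refine ⟨e, he, ?_, ?_⟩
  · obtain ⟨σ, τ, h, hσ, hτ⟩ := he
    exact ⟨σ, τ, h, (hσ.welfare₂_eq D hτ).symm⟩
  · rintro _ ⟨σ, τ, h, rfl⟩
    obtain ⟨r, r', hr, hr'⟩ := h.exists_hasThreshold hp hq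
    rw [hr.welfare₂_eq D hr']
    exact isMaxOn_iff.1 hmax (r, r') ⟨σ, τ, h, hr, hr'⟩

/-- With identical senders there is a symmetric equilibrium. -/
lemma exists_symmetric_threshold₂ (c : ℝ) (hp : p ∈ Ioo (0 : ℝ) 1) :
    ∃ t, (t, t) ∈ E.thresholds₂ c p p := by
  have hκ : Continuous fun t => E.thrResponse p t p t :=
    (continuous_thrResponse hp hp).comp (continuous_id.prodMk continuous_id)
  have hg : Continuous fun t =>
      E.clamp (E.silentBelief p t + c / (1 - E.thrResponse p t p t)) := by
    refine continuous_clamp.comp ((continuous_silentBelief hp).add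
      (Continuous.div continuous_const (continuous_const.sub hκ) fun t => ?_))
    exact (sub_pos.2 (thrResponse_lt_one hp hp _ _)).ne'
  obtain ⟨t, -, ht⟩ := exists_fixedPoint_le hg (fun _ => clamp_mem _)
    (right_mem_Icc.2 E.lo_lt_hi.le) (clamp_mem _).2
  exact ⟨t, (mem_thresholds₂_iff hp hp).2 ⟨ht, ht⟩⟩

/-! ### A second sender may help -/

/-- Messages matter under quadratic loss, as different disclosed signals call for different
actions. -/
lemma not_messagesUseless_quadraticLoss (hq : q ∈ Ioo (0 : ℝ) 1)
    (hσ : E.HasThreshold σ t) (hτ : E.HasThreshold τ t') (hlt : t < E.hi) :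
    ¬ E.MessagesUseless quadraticLoss p σ q τ := by
  rintro ⟨a, ha⟩
  change Icc (0 : ℝ) 1 at a
  have hst := E.isStrategy_thr t'
  have key : ∀ s ∈ Ioc t E.hi, (a : ℝ) *
      (s * E.silence q (thr t') 1 + (1 - s) * E.silence q (thr t') 0) =
      s * E.silence q (thr t') 1 := by
    intro s hs
    have hI : s ∈ Icc E.lo E.hi := ⟨hσ.1.1.trans hs.1.le, hs.2⟩
    have hu := E.Icc_subset_unit hI
    have h := ha (some s) none ⟨hI, by rw [(hσ.2 s hI).1 hs.1]; exact one_pos⟩ trivial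
    rw [belief₂_some, hτ.update_eq, quadraticLoss_isOptimal_iff
      (update_none_mem hst hq hu.1 (sub_nonneg.2 hu.2)), update_none] at h
    rw [h, mul_comm]
    exact add_mul_post (mul_nonneg hu.1 (hst.silence_pos hq 1).le)
      (mul_nonneg (sub_nonneg.2 hu.2) (hst.silence_pos hq 0).le)
  have h1 := key E.hi ⟨hlt, le_rfl⟩
  have h2 := key ((t + E.hi) / 2) ⟨by linarith, by linarith⟩
  have p1 := hst.silence_pos hq 1
  have p0 := hst.silence_pos hq 0
  -- Two affine functions of `s` that agree at two points agree at `0` and at `1`.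
  have h3 : (E.hi - (t + E.hi) / 2) * ((a : ℝ) *
      (E.silence q (thr t') 1 - E.silence q (thr t') 0) - E.silence q (thr t') 1) = 0 := by
    linear_combination h1 - h2
  have h4 := (mul_eq_zero.1 h3).resolve_left (by linarith)
  have h5 : (a : ℝ) * E.silence q (thr t') 0 = 0 := by
    linear_combination h1 - E.hi * h4
  have h6 := (mul_eq_zero.1 h5).resolve_right p0.ne'
  rw [h6] at h4
  linarith

/-- At zero cost the second sender strictly helps, and this survives a small cost: a symmetric pair
of thresholds slightly above the costless one is an equilibrium for a suitable small cost. -/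
lemma exists_welfare_gain (E : Environment) (hp : p ∈ Ioo (0 : ℝ) 1) :
    ∃ c w w₁ : ℝ, 0 < c ∧ E.IsBestWelfare₂ quadraticLoss c p p w ∧
      E.IsBestWelfare₁ quadraticLoss c p w₁ ∧ w₁ < w := by
  obtain ⟨t₀, ht₀, -⟩ := exists_isLeast_thresholds₁ (E := E) 0 hp
  have hlt := threshold₁_lt_hi le_rfl ht₀
  have hlo := (thresholds₁_subset _ _ ht₀).1
  have hgain : E.welfare₁ quadraticLoss p (thr t₀) <
      E.welfare₂ quadraticLoss p (thr t₀) p (thr t₀) := by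
    have h₂ : (t₀, t₀) ∈ E.thresholds₂ 0 p p := by rw [thresholds₂_zero hp hp ht₀ ht₀]; rfl
    obtain ⟨σ, τ, heq, hσ, hτ⟩ := h₂
    obtain ⟨σ', heq', hσ'⟩ := ht₀
    have := (welfare_comparison (D := quadraticLoss) hp hp le_rfl heq heq').2
      (not_messagesUseless_quadraticLoss hp hσ hτ hlt)
    rwa [hσ'.welfare₁_eq, hσ.welfare₂_eq _ hτ] at this
  have hcont := (continuous_welfare₂ (E := E) hp hp continuous_quadraticLoss_clipValue).comp
    (continuous_id.prodMk continuous_id)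
  obtain ⟨t, hgain', ht⟩ := (((hcont.continuousAt.eventually_const_lt hgain).filter_mono
    nhdsWithin_le_nhds).and (Ioo_mem_nhdsGT hlt)).exists
  have hb₀ := threshold₁_bounds ht₀
  simp only [add_zero] at hb₀
  have hB : E.silentBelief p t < t := not_le.1 fun h =>
    not_lt_of_silentBelief_add (E := E) hp le_rfl (by simpa using hb₀.1 hlt) (by simpa using h) ht.1
  have hκ := sub_pos.2 (thrResponse_lt_one (E := E) hp hp t t)
  set c := (t - E.silentBelief p t) * (1 - E.thrResponse p t p t) with hc
  have hcpos : 0 < c := mul_pos (sub_pos.2 hB) hκ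
  have hmem : (t, t) ∈ E.thresholds₂ c p p := by
    have : t = E.clamp (E.silentBelief p t + c / (1 - E.thrResponse p t p t)) := by
      rw [hc, mul_div_cancel_right₀ _ hκ.ne', add_sub_cancel,
        eq_clamp_iff ⟨hlo.trans ht.1.le, ht.2.le⟩]
      simp
    exact (mem_thresholds₂_iff hp hp).2 ⟨this, this⟩
  obtain ⟨e, -, hw⟩ := exists_isBestWelfare₂ hp hp continuous_quadraticLoss_clipValue ⟨_, hmem⟩
  obtain ⟨s, hs⟩ := exists_isLeast_thresholds₁ (E := E) c hp
  refine ⟨c, _, _, hcpos, hw, isBestWelfare₁ quadraticLoss hp hs, ?_⟩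
  have hle : t₀ ≤ s := by
    by_contra! h
    have h1 := (threshold₁_bounds hs.1).1 (h.trans hlt)
    have h2 := hb₀.2 ((thresholds₁_subset _ _ hs.1).1.trans_lt h)
    exact not_lt_of_silentBelief_add (E := E) (c := 0) hp le_rfl (by linarith) (by linarith) h
  have h1 : E.welfare₂ quadraticLoss p (thr t) p (thr t) ≤ _ := hw.2 (by
    obtain ⟨σ, τ, h, hσ, hτ⟩ := hmem
    exact ⟨σ, τ, h, (hσ.welfare₂_eq _ hτ).symm⟩)
  exact ((welfare₁_thr_anti quadraticLoss hp hle).trans_lt hgain').trans_le h1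

end Environment

/-! ### A signal distribution with a spike -/

/-- The uniform density on `(a, b]`, not normalized. -/
noncomputable def box (a b s : ℝ) : ℝ := if a < s ∧ s ≤ b then 1 else 0

lemma box_nonneg (a b s : ℝ) : 0 ≤ box a b s := by
  unfold box
  split_ifs <;> norm_num

lemma measurable_box (a b : ℝ) : Measurable (box a b) :=
  Measurable.ite measurableSet_Ioc measurable_const measurable_const

lemma mul_box_eq_indicator (g : ℝ → ℝ) (a b : ℝ) :
    (fun s => g s * box a b s) = (Ioc a b).indicator g := by
  funext s
  by_cases h : s ∈ Ioc a b
  · rw [indicator_of_mem h, box, if_pos (mem_Ioc.1 h), mul_one]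
  · rw [indicator_of_notMem h, box, if_neg (mt mem_Ioc.2 h), mul_zero]

lemma integrable_mul_box {g : ℝ → ℝ} (hg : Continuous g) (a b : ℝ) :
    Integrable fun s => g s * box a b s := by
  rw [mul_box_eq_indicator, integrable_indicator_iff measurableSet_Ioc]
  exact hg.integrableOn_Ioc

lemma integral_mul_box (g : ℝ → ℝ) {a b : ℝ} (hab : a ≤ b) :
    ∫ s, g s * box a b s = ∫ s in a..b, g s := by
  rw [mul_box_eq_indicator, integral_indicator measurableSet_Ioc,
    intervalIntegral.integral_of_le hab]

lemma integral_quadratic (k₀ k₁ k₂ a b : ℝ) : ∫ s in a..b, (k₀ + k₁ * s + k₂ * s ^ 2) =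
    k₀ * (b - a) + k₁ * ((b ^ 2 - a ^ 2) / 2) + k₂ * ((b ^ 3 - a ^ 3) / 3) := by
  rw [intervalIntegral.integral_add (Continuous.intervalIntegrable (by fun_prop) _ _)
      (Continuous.intervalIntegrable (by fun_prop) _ _),
    intervalIntegral.integral_add (Continuous.intervalIntegrable (by fun_prop) _ _)
      (Continuous.intervalIntegrable (by fun_prop) _ _),
    intervalIntegral.integral_const_mul, intervalIntegral.integral_const_mul,
    intervalIntegral.integral_const, integral_id, integral_pow]
  norm_num
  ring

/-- A density on `(0, 1]` with a spike of mass about one half at one half, and little mass above. -/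
noncomputable def spike (s : ℝ) : ℝ :=
  box 0 (1 / 2) s + 499 / 10 * box (1 / 2) (51 / 100) s + 1 / 490 * box (51 / 100) 1 s

lemma spike_nonneg (s : ℝ) : 0 ≤ spike s := by
  have h1 := box_nonneg 0 (1 / 2) s
  have h2 := box_nonneg (1 / 2) (51 / 100) s
  have h3 := box_nonneg (51 / 100) 1 s
  unfold spike
  positivity

lemma measurable_spike : Measurable spike :=
  ((measurable_box _ _).add ((measurable_box _ _).const_mul _)).add
    ((measurable_box _ _).const_mul _)

lemma spike_eq_zero {s : ℝ} (hs : s ∉ Ioc (0 : ℝ) 1) : spike s = 0 := by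
  have h : ∀ a b : ℝ, 0 ≤ a → b ≤ 1 → box a b s = 0 := fun a b ha hb =>
    if_neg fun h => hs ⟨ha.trans_lt h.1, h.2.trans hb⟩
  rw [spike, h _ _ le_rfl (by norm_num), h _ _ (by norm_num) (by norm_num),
    h _ _ (by norm_num) le_rfl]
  norm_num

lemma spike_pos {s : ℝ} (hs : s ∈ Ioc (0 : ℝ) 1) : 0 < spike s := by
  have h1 := box_nonneg 0 (1 / 2) s
  have h2 := box_nonneg (1 / 2) (51 / 100) s
  have h3 := box_nonneg (51 / 100) 1 s
  unfold spike
  rcases le_or_gt s (1 / 2) with h | h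
  · have : box 0 (1 / 2) s = 1 := if_pos ⟨hs.1, h⟩
    rw [this]
    positivity
  · rcases le_or_gt s (51 / 100) with h' | h'
    · have : box (1 / 2) (51 / 100) s = 1 := if_pos ⟨h, h'⟩
      rw [this]
      positivity
    · have : box (51 / 100) 1 s = 1 := if_pos ⟨h', hs.2⟩
      rw [this]
      positivity

lemma integral_mul_spike {g : ℝ → ℝ} (hg : Continuous g) :
    (Integrable fun s => g s * spike s) ∧ ∫ s, g s * spike s = (∫ s in (0)..(1 / 2), g s) +
      499 / 10 * (∫ s in (1 / 2)..(51 / 100), g s) + 1 / 490 * ∫ s in (51 / 100)..1, g s := by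
  have i1 := integrable_mul_box hg 0 (1 / 2)
  have i2 := (integrable_mul_box hg (1 / 2) (51 / 100)).const_mul (499 / 10)
  have i3 := (integrable_mul_box hg (51 / 100) 1).const_mul (1 / 490)
  have i12 : Integrable fun s => g s * box 0 (1 / 2) s +
      499 / 10 * (g s * box (1 / 2) (51 / 100) s) := i1.add i2
  have e : (fun s => g s * spike s) = fun s => g s * box 0 (1 / 2) s +
      499 / 10 * (g s * box (1 / 2) (51 / 100) s) + 1 / 490 * (g s * box (51 / 100) 1 s) := by
    funext s
    rw [spike]
    ring
  rw [e]
  refine ⟨i12.add i3, ?_⟩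
  rw [integral_add i12 i3, integral_add i1 i2, integral_const_mul, integral_const_mul,
    integral_mul_box _ (by norm_num), integral_mul_box _ (by norm_num),
    integral_mul_box _ (by norm_num)]

lemma integral_thr_mul_spike {g : ℝ → ℝ} (hg : Continuous g) {t : ℝ}
    (ht : t ∈ Icc (1 / 2 : ℝ) (51 / 100)) : ∫ s, Environment.thr t s * (g s * spike s) =
      499 / 10 * (∫ s in t..(51 / 100), g s) + 1 / 490 * ∫ s in (51 / 100)..1, g s := by
  obtain ⟨h1, h2⟩ := ht
  have i2 := (integrable_mul_box hg t (51 / 100)).const_mul (499 / 10)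
  have i3 := (integrable_mul_box hg (51 / 100) 1).const_mul (1 / 490)
  have e : (fun s => Environment.thr t s * (g s * spike s)) = fun s =>
      499 / 10 * (g s * box t (51 / 100) s) + 1 / 490 * (g s * box (51 / 100) 1 s) := by
    funext s
    simp only [spike, Environment.thr, box]
    rcases le_or_gt s t with h | h
    · rw [if_neg h.not_gt, if_neg (fun h' : t < s ∧ s ≤ 51 / 100 => h.not_gt h'.1),
        if_neg (fun h' : 51 / 100 < s ∧ s ≤ 1 => by linarith [h'.1])]
      ring
    · have e1 : ¬ (0 < s ∧ s ≤ 1 / 2) := fun h' => by linarith [h'.2]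
      have e2 : (1 / 2 < s ∧ s ≤ 51 / 100) ↔ (t < s ∧ s ≤ 51 / 100) :=
        and_congr_left fun _ => ⟨fun _ => h, fun _ => h1.trans_lt h⟩
      rw [if_neg e1, if_pos h]
      simp only [e2]
      ring
  rw [e, integral_add i2 i3, integral_const_mul, integral_const_mul, integral_mul_box _ h2,
    integral_mul_box _ (by norm_num)]

/-- The environment whose marginal signal density is `spike`. -/
noncomputable def spikeEnvironment : Environment where
  prior := 1511 / 4000
  lo := 0
  hi := 1
  density ω s := if ω = 1 then 4000 / 1511 * s * spike s else 4000 / 2489 * (1 - s) * spike s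
  prior_mem := by norm_num
  lo_nonneg := le_rfl
  lo_lt_hi := one_pos
  hi_le_one := le_rfl
  measurable_density ω := by
    have := measurable_spike
    split_ifs <;> fun_prop
  density_nonneg ω s := by
    by_cases hs : s ∈ Ioc (0 : ℝ) 1
    · have h0 := hs.1.le
      have h1 := sub_nonneg.2 hs.2
      have h2 := spike_nonneg s
      split_ifs <;> positivity
    · simp [spike_eq_zero hs]
  density_eq_zero ω s hs := by
    simp [spike_eq_zero fun h => hs (Ioc_subset_Icc_self h)]
  integral_density ω := by
    have h : ∀ k₀ k₁ : ℝ, ∫ s, (k₀ + k₁ * s + 0 * s ^ 2) * spike s = k₀ + k₁ * (1511 / 4000) := by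
      intro k₀ k₁
      rw [(integral_mul_spike (g := fun s => k₀ + k₁ * s + 0 * s ^ 2) (by fun_prop)).2,
        integral_quadratic, integral_quadratic, integral_quadratic]
      ring
    by_cases hω : ω = 1
    · simp only [hω, if_true]
      convert h 0 (4000 / 1511) using 1
      · simp
      · norm_num
    · simp only [hω, if_false]
      convert h (4000 / 2489) (-(4000 / 2489)) using 1
      · congr 1
        funext s
        ring
      · norm_num
  full_support ω a b ha hab hb := by
    have hint : ∀ g : ℝ → ℝ, Continuous g →
        IntervalIntegrable (fun s => g s * spike s) volume a b :=
      fun g hg => (integral_mul_spike hg).1.intervalIntegrable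
    split_ifs
    · refine intervalIntegral.intervalIntegral_pos_of_pos_on (hint _ (by fun_prop))
        (fun s hs => ?_) hab
      have hs0 := ha.trans_lt hs.1
      have := spike_pos ⟨hs0, (hs.2.trans_le hb).le⟩
      positivity
    · refine intervalIntegral.intervalIntegral_pos_of_pos_on (hint _ (by fun_prop))
        (fun s hs => ?_) hab
      have hs1 := sub_pos.2 (hs.2.trans_le hb)
      have := spike_pos ⟨ha.trans_lt hs.1, (hs.2.trans_le hb).le⟩
      positivity
  private_belief := Filter.Eventually.of_forall fun s => by
    simp only [Fin.isValue, zero_ne_one, if_false, if_true]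
    ring

lemma spikeEnvironment_marginal : spikeEnvironment.marginal = spike := by
  funext s
  simp only [Environment.marginal, spikeEnvironment, Fin.isValue, zero_ne_one, if_false, if_true]
  ring

namespace Environment

lemma spike_silentMass {p t : ℝ} (ht : t ∈ Icc (1 / 2 : ℝ) (51 / 100)) :
    spikeEnvironment.silentMass p t = 1 - p * (499 / 10 * (51 / 100 - t) + 1 / 1000) := by
  have := integral_thr_mul_spike (g := fun _ => 1) continuous_const ht
  simp only [one_mul, intervalIntegral.integral_const, smul_eq_mul, mul_one] at this
  rw [silentMass_eq, spikeEnvironment_marginal, this]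
  norm_num

lemma spike_prior_mul_silence {p t : ℝ} (ht : t ∈ Icc (1 / 2 : ℝ) (51 / 100)) :
    spikeEnvironment.prior * spikeEnvironment.silence p (thr t) 1 =
      1511 / 4000 - p * (499 / 20 * ((51 / 100) ^ 2 - t ^ 2) + 151 / 200000) := by
  have := integral_thr_mul_spike (g := fun s => s) continuous_id ht
  simp only [integral_id] at this
  rw [prior_mul_silence_eq, spikeEnvironment_marginal, this]
  simp only [spikeEnvironment]
  ring

variable {E : Environment} {c p q t t' : ℝ} {σ τ : ℝ → ℝ}

/-! ### A second sender may hurt -/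

/-- A sender who is rarely informed cannot move the posterior much. -/
lemma responsiveness_le {x y : ℝ} (hτ : E.IsStrategy τ) (hq : q ∈ Ioo (0 : ℝ) 1) (hx : 0 < x)
    (hy : 0 < y) : E.responsiveness q τ x y ≤ q := by
  have h := silence_mul_le_one_sub_msgExp hτ hq hx hy
  rw [← one_sub_post_mul_one_sub_responsiveness hτ hq hx hy] at h
  have l1 := hτ.one_sub_le_silence hq 1
  have l0 := hτ.one_sub_le_silence hq 0
  have p1 := mul_pos hx (hτ.silence_pos hq 1)
  have p0 := mul_pos hy (hτ.silence_pos hq 0)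
  have e := add_mul_one_sub_post p1.le p0.le
  have e' := add_mul_one_sub_post hx.le hy.le
  have hb := one_sub_post_pos hx hy
  rw [update_none] at h
  set T₁ := E.silence q τ 1
  set T₀ := E.silence q τ 0
  set u := 1 - post (x * T₁) (y * T₀)
  set v := 1 - post x y
  have key : (1 - q) * v ≤ T₁ * u := by
    refine le_of_mul_le_mul_left ?_ (mul_pos (add_pos p1 p0) (add_pos hx hy))
    have h1 : (x * T₁ + y * T₀) * (x + y) * ((1 - q) * v) = (x * T₁ + y * T₀) * (1 - q) * y := by
      linear_combination (x * T₁ + y * T₀) * (1 - q) * e'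
    have h2 : (x * T₁ + y * T₀) * (x + y) * (T₁ * u) = (x + y) * T₁ * (y * T₀) := by
      linear_combination (x + y) * T₁ * e
    rw [h1, h2]
    nlinarith [mul_nonneg (mul_pos p1 hy).le (sub_nonneg.2 l0),
      mul_nonneg (mul_pos p0 hy).le (sub_nonneg.2 l1)]
  have := le_of_mul_le_mul_left (show v * (1 - q) ≤ v * (1 - E.responsiveness q τ x y) by
    linarith) hb
  linarith

lemma silence_thr_mono (hp : 0 ≤ p) (htt' : t ≤ t') (ω : Fin 2) :
    E.silence p (thr t) ω ≤ E.silence p (thr t') ω := by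
  have h := E.isStrategy_thr
  rw [(h t).silence_eq, (h t').silence_eq]
  have := mul_le_mul_of_nonneg_left (integral_mono ((h t').integrable_mul_density ω)
    ((h t).integrable_mul_density ω) fun s => mul_le_mul_of_nonneg_right (?_ : thr t' s ≤ thr t s)
      (E.density_nonneg ω s)) hp
  · linarith
  · unfold thr
    split_ifs with h1 h2 h2 <;> norm_num
    exact h2 (htt'.trans_lt h1)

lemma quadraticLoss_clipValue_nonpos (μ : ℝ) : quadraticLoss.clipValue μ ≤ 0 := by
  have h := DecisionProblem.clip_mem μ
  rw [DecisionProblem.clipValue, quadraticLoss_value h, neg_nonpos]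
  exact mul_nonneg h.1 (sub_nonneg.2 h.2)

lemma msgValue_quadraticLoss_le {x y : ℝ} (hτ : E.IsStrategy τ) (hq : q ∈ Ioo (0 : ℝ) 1)
    (hx : 0 ≤ x) (hy : 0 ≤ y) : E.msgValue quadraticLoss q τ x y ≤
      (x * E.silence q τ 1 + y * E.silence q τ 0) *
        quadraticLoss.clipValue (E.update q τ x y none) := by
  rw [msgValue, mix_eq hτ (isBddMsg_value quadraticLoss x y)]
  refine add_le_of_nonpos_right (mul_nonpos_of_nonneg_of_nonpos hq.1.le
    (integral_nonpos fun s => ?_))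
  have h1 := mul_nonneg hx (hτ.mul_density_nonneg 1 s)
  have h0 := mul_nonneg hy (hτ.mul_density_nonneg 0 s)
  exact mul_nonpos_of_nonneg_of_nonpos (by linarith) (quadraticLoss_clipValue_nonpos _)

/-- Under quadratic loss, welfare is bounded by what is lost when both senders are silent. -/
lemma welfare₂_quadraticLoss_le (hσ : E.IsStrategy σ) (hp : p ∈ Ioo (0 : ℝ) 1)
    (hτ : E.IsStrategy τ) (hq : q ∈ Ioo (0 : ℝ) 1) :
    E.welfare₂ quadraticLoss p σ q τ ≤ -((E.prior * E.silence p σ 1 * E.silence q τ 1) *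
      ((1 - E.prior) * E.silence p σ 0 * E.silence q τ 0)) := by
  have hx := prior_mul_silence_pos hσ hp
  have hy := one_sub_prior_mul_silence_pos hσ hp
  have h1 := msgValue_quadraticLoss_le hτ hq hx.le hy.le
  have h2 : ∫ s, σ s * E.marginal s * E.msgValue quadraticLoss q τ s (1 - s) ≤ 0 := by
    refine integral_nonpos fun s => ?_
    by_cases hs : s ∈ Icc E.lo E.hi
    · have hu := E.Icc_subset_unit hs
      refine mul_nonpos_of_nonneg_of_nonpos (mul_nonneg (hσ.2 s hs).1 (E.marginal_nonneg s))
        ((msgValue_quadraticLoss_le hτ hq hu.1 (sub_nonneg.2 hu.2)).trans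
          (mul_nonpos_of_nonneg_of_nonpos (add_nonneg (mul_nonneg hu.1 (hτ.silence_pos hq 1).le)
            (mul_nonneg (sub_nonneg.2 hu.2) (hτ.silence_pos hq 0).le))
            (quadraticLoss_clipValue_nonpos _)))
    · simp [E.marginal_eq_zero hs]
  have h3 := mul_nonpos_of_nonneg_of_nonpos hp.1.le h2
  rw [(welfare₂_eq quadraticLoss hσ hp hτ hq).2]
  have hX := mul_pos hx (hτ.silence_pos hq 1)
  have hY := mul_pos hy (hτ.silence_pos hq 0)
  rw [quadraticLoss.clipValue_eq (update_none_mem hτ hq hx.le hy.le),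
    quadraticLoss_value (update_none_mem hτ hq hx.le hy.le), update_none] at h1
  have hle1 : E.silence p σ 1 * E.silence q τ 1 ≤ 1 := mul_le_one₀ (hσ.silence_le_one hp 1)
    (hτ.silence_pos hq 1).le (hτ.silence_le_one hq 1)
  have hle0 : E.silence p σ 0 * E.silence q τ 0 ≤ 1 := mul_le_one₀ (hσ.silence_le_one hp 0)
    (hτ.silence_pos hq 0).le (hτ.silence_le_one hq 0)
  set X := E.prior * E.silence p σ 1 * E.silence q τ 1
  set Y := (1 - E.prior) * E.silence p σ 0 * E.silence q τ 0
  have hXY : X + Y ≤ 1 := by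
    have := mul_le_mul_of_nonneg_left hle1 E.prior_pos.le
    have := mul_le_mul_of_nonneg_left hle0 E.one_sub_prior_pos.le
    have e1 : X = E.prior * (E.silence p σ 1 * E.silence q τ 1) := mul_assoc _ _ _
    have e0 : Y = (1 - E.prior) * (E.silence p σ 0 * E.silence q τ 0) := mul_assoc _ _ _
    linarith
  have e := add_mul_post hX.le hY.le
  have e' := add_mul_one_sub_post hX.le hY.le
  have hm := post_mem hX.le hY.le
  have h4 : X * Y ≤ X * (1 - post X Y) := by
    refine mul_le_mul_of_nonneg_left ?_ hX.le
    have := mul_le_mul_of_nonneg_right hXY (sub_nonneg.2 hm.2)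
    linarith
  have h5 : (X + Y) * -(post X Y * (1 - post X Y)) = -(X * (1 - post X Y)) := by
    linear_combination -(1 - post X Y) * e
  linarith

/-- The gain `t - B t` of the threshold type drops at the spike: concealing half of the spike raises
the belief after silence by more than the width of the spike. -/
lemma spike_gain_drop (ht : t ∈ Icc (101 / 200 : ℝ) (51 / 100)) :
    t - spikeEnvironment.silentBelief (2 / 5) t <
      1 / 2 - spikeEnvironment.silentBelief (2 / 5) (1 / 2) := by
  have hp : (2 / 5 : ℝ) ∈ Ioo (0 : ℝ) 1 := by norm_num
  have h0 := silentMass_mul_silentBelief (E := spikeEnvironment) hp (1 / 2)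
  rw [spike_silentMass (by norm_num), spike_prior_mul_silence (by norm_num)] at h0
  obtain ⟨δ, hδ, hN, hM, -⟩ := exists_silentMass_add (E := spikeEnvironment) hp.1.le ht.1
  rw [← silentMass_mul_silentBelief hp t, hN, spike_silentMass (by norm_num),
    spike_prior_mul_silence (by norm_num)] at hM
  have hpos := silentMass_pos (E := spikeEnvironment) hp t
  rw [hN, spike_silentMass (by norm_num)] at hpos
  -- The belief is below `7 / 20` at threshold `1 / 2`, and the spike has width `1 / 100`.
  have h1 : (36 / 100 : ℝ) ≤ spikeEnvironment.silentBelief (2 / 5) t := by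
    refine le_of_mul_le_mul_left (le_trans ?_ hM) hpos
    linarith
  linarith [ht.2]

/-- Welfare of the single-sender game when the upper half of the spike is disclosed; it is to be
compared with `spike_welfare₂`, where all of the spike is concealed. -/
lemma spike_welfare₁ : -(23315 / 100000 : ℝ) <
    spikeEnvironment.welfare₁ quadraticLoss (2 / 5) (thr (101 / 200)) := by
  have hp : (2 / 5 : ℝ) ∈ Ioo (0 : ℝ) 1 := by norm_num
  have hst := spikeEnvironment.isStrategy_thr (101 / 200)
  have hint : ∫ s, thr (101 / 200) s * spikeEnvironment.marginal s * quadraticLoss.clipValue s =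
      499 / 10 * (∫ s in (101 / 200)..(51 / 100), (0 + -1 * s + 1 * s ^ 2)) +
        1 / 490 * ∫ s in (51 / 100)..1, (0 + -1 * s + 1 * s ^ 2) := by
    rw [← integral_thr_mul_spike (by fun_prop) (by norm_num), spikeEnvironment_marginal]
    refine integral_congr_ae (Filter.Eventually.of_forall fun s => ?_)
    by_cases hs : s ∈ Ioc (0 : ℝ) 1
    · simp only [quadraticLoss.clipValue_eq (Ioc_subset_Icc_self hs),
        quadraticLoss_value (Ioc_subset_Icc_self hs)]
      ring
    · simp [spike_eq_zero hs]
  have hb := silentMass_mul_silentBelief (E := spikeEnvironment) hp (101 / 200)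
  have hN := spike_silentMass (p := 2 / 5) (t := 101 / 200) (by norm_num)
  rw [hN, spike_prior_mul_silence (by norm_num)] at hb
  rw [silentMass] at hN
  have hmem := belief₁_none_mem hst hp
  rw [(welfare₁_eq quadraticLoss hst hp).2, hint, quadraticLoss_value hmem, hN,
    integral_quadratic, integral_quadratic]
  rw [silentBelief, mul_comm] at hb
  rw [eq_div_of_mul_eq (by norm_num) hb]
  norm_num

lemma spike_welfare₂ (ht : 51 / 100 ≤ t) (ht' : 51 / 100 ≤ t') :
    spikeEnvironment.welfare₂ quadraticLoss (2 / 5) (thr t) (2 / 5) (thr t') ≤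
      -(2341 / 10000) := by
  have hp : (2 / 5 : ℝ) ∈ Ioo (0 : ℝ) 1 := by norm_num
  have hst := spikeEnvironment.isStrategy_thr
  refine (welfare₂_quadraticLoss_le (hst t) hp (hst t') hp).trans (neg_le_neg ?_)
  have hM := spike_prior_mul_silence (p := 2 / 5) (t := 51 / 100) (by norm_num)
  have hN := spike_silentMass (p := 2 / 5) (t := 51 / 100) (by norm_num)
  rw [silentMass, hM] at hN
  have hprior : spikeEnvironment.prior = 1511 / 4000 := rfl
  rw [hprior] at hM hN ⊢
  have l1 : (999 / 1000 : ℝ) ≤ spikeEnvironment.silence (2 / 5) (thr (51 / 100)) 1 := by linarith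
  have l0 : (999 / 1000 : ℝ) ≤ spikeEnvironment.silence (2 / 5) (thr (51 / 100)) 0 := by linarith
  have a1 := l1.trans (silence_thr_mono hp.1.le ht 1)
  have a0 := l0.trans (silence_thr_mono hp.1.le ht 0)
  have b1 := l1.trans (silence_thr_mono hp.1.le ht' 1)
  have b0 := l0.trans (silence_thr_mono hp.1.le ht' 0)
  calc (2341 / 10000 : ℝ) ≤ 1511 / 4000 * (999 / 1000) * (999 / 1000) *
        ((1 - 1511 / 4000) * (999 / 1000) * (999 / 1000)) := by norm_num
    _ ≤ _ := by gcongr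

/-- With the spike, the disclosure cost can be such that a single sender discloses half of the spike,
while any discouragement by a second sender makes both senders conceal all of it. -/
lemma exists_welfare_loss : ∃ (E : Environment) (c w w₁ : ℝ), 0 < c ∧
    E.IsBestWelfare₂ quadraticLoss c (2 / 5) (2 / 5) w ∧
    E.IsBestWelfare₁ quadraticLoss c (2 / 5) w₁ ∧ w < w₁ := by
  have hp : (2 / 5 : ℝ) ∈ Ioo (0 : ℝ) 1 := by norm_num
  set E := spikeEnvironment with hE
  have hlo : E.lo = 0 := rfl
  have hhi : E.hi = 1 := rfl
  have hprior : E.prior = 1511 / 4000 := rfl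
  -- The cost is the maximal gain of a threshold type up to the end of the spike.
  obtain ⟨r, hr, hmax⟩ := isCompact_Icc.exists_isMaxOn
    (⟨1 / 2, by norm_num⟩ : (Icc (0 : ℝ) (51 / 100)).Nonempty)
    (continuous_id.sub (continuous_silentBelief (E := E) hp)).continuousOn
  rw [isMaxOn_iff] at hmax
  simp only [Pi.sub_apply, id] at hmax
  set c := r - E.silentBelief (2 / 5) r with hc
  have hhalf := hmax (1 / 2) (by norm_num)
  have hr' : r < 101 / 200 := by
    by_contra! h
    exact (spike_gain_drop ⟨h, hr.2⟩).not_ge hhalf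
  have hcpos : 0 < c := by
    have h0 := silentMass_mul_silentBelief (E := spikeEnvironment) hp (1 / 2)
    rw [spike_silentMass (by norm_num), spike_prior_mul_silence (by norm_num)] at h0
    linarith
  -- As the belief after silence is at least `(1 - p) * prior`, complete silence is not sustainable.
  have hcle : c < 28 / 100 := by
    have h1 := (E.isStrategy_thr r).one_sub_le_silence hp 1
    have h0 := (E.isStrategy_thr r).silence_le_one hp 0
    have h1' := (E.isStrategy_thr r).silence_le_one hp 1
    have hB := silentMass_mul_silentBelief (E := E) hp r
    have hN : E.silentMass (2 / 5) r ≤ 1 := by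
      rw [silentMass, hprior]
      linarith
    have hBpos := silentBelief_pos (E := E) hp r
    rw [hprior] at hB
    have := mul_le_mul_of_nonneg_right hN hBpos.le
    linarith
  have hrI : r ∈ Icc E.lo E.hi := ⟨hr.1, by rw [hhi]; linarith⟩
  have hr₁ : r ∈ E.thresholds₁ c (2 / 5) := by
    rw [mem_thresholds₁_iff, eq_clamp_iff hrI, hc, add_sub_cancel]
    simp
  -- In the two-sender game, neither complete silence nor disclosure of the spike is possible.
  have hlt : ∀ e ∈ E.thresholds₂ c (2 / 5) (2 / 5), e.1 < E.hi := by
    intro e he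
    refine lt_of_le_of_ne (thresholds₂_subset hp hp he).1.2 fun h => ?_
    have h1 := (threshold₂_bounds hp hp he).2 (h ▸ E.lo_lt_hi)
    rw [h, silentBelief_hi, hhi, hprior] at h1
    have hκ : E.thrResponse (2 / 5) 1 (2 / 5) e.2 ≤ 2 / 5 :=
      responsiveness_le (E.isStrategy_thr _) hp (prior_mul_silence_pos (E.isStrategy_thr _) hp)
        (one_sub_prior_mul_silence_pos (E.isStrategy_thr _) hp)
    have h2 : c / (1 - E.thrResponse (2 / 5) 1 (2 / 5) e.2) ≤ c / (3 / 5) :=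
      div_le_div_of_nonneg_left hcpos.le (by norm_num) (by linarith)
    rw [div_eq_mul_inv c (3 / 5)] at h2
    norm_num at h2
    linarith
  have hge : ∀ e ∈ E.thresholds₂ c (2 / 5) (2 / 5), 51 / 100 ≤ e.1 := by
    intro e he
    by_contra! h
    have hI := thresholds₂_subset hp hp he
    have h1 := (threshold₂_bounds hp hp he).1 (hlt e he)
    have h2 := lt_div_of_pos hcpos (thrResponse_pos hp hp e.1 hI.2
      (hlt e.swap ((mem_thresholds₂_swap hp hp).1 he))) (thrResponse_lt_one hp hp _ _)
    linarith [hmax e.1 ⟨hI.1.1, h.le⟩]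
  obtain ⟨t, ht⟩ := exists_symmetric_threshold₂ (E := E) c hp
  obtain ⟨e, he, hw⟩ := exists_isBestWelfare₂ hp hp continuous_quadraticLoss_clipValue ⟨_, ht⟩
  obtain ⟨s, hs⟩ := exists_isLeast_thresholds₁ (E := E) c hp
  refine ⟨E, c, _, _, hcpos, hw, isBestWelfare₁ quadraticLoss hp hs, ?_⟩
  have h1 := spike_welfare₂ (hge e he) (hge e.swap ((mem_thresholds₂_swap hp hp).1 he))
  have h2 := welfare₁_thr_anti (E := E) quadraticLoss hp ((hs.2 hr₁).trans hr'.le)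
  have h3 := spike_welfare₁
  rw [Prod.fst_swap] at h1
  linarith

end Environment

end Disclosure

open Disclosure Environment in
theorem corollary1 :
    -- Comparison of thresholds and welfare, for all parameters of the model.
    (∀ (E : Disclosure.Environment) (c p₁ p₂ : ℝ), p₁ ∈ Set.Ioo (0 : ℝ) 1 → p₂ ∈ Set.Ioo (0 : ℝ) 1 →
      -- All equilibria are in threshold strategies.
      (∀ p ∈ ({p₁, p₂} : Set ℝ), ∀ σ, E.IsEquilibrium₁ c p σ → ∃ t, E.HasThreshold σ t) ∧
      (∀ σ₁ σ₂, E.IsEquilibrium₂ c p₁ p₂ σ₁ σ₂ →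
        ∃ t₁ t₂, E.HasThreshold σ₁ t₁ ∧ E.HasThreshold σ₂ t₂) ∧
      -- The benchmark: the unique (if `c ≤ 0`) or smallest (if `c > 0`) single-sender thresholds.
      ∃ s₁ s₂ : ℝ,
        IsLeast (E.thresholds₁ c p₁) s₁ ∧ IsLeast (E.thresholds₁ c p₂) s₂ ∧
        (c ≤ 0 → E.thresholds₁ c p₁ = {s₁} ∧ E.thresholds₁ c p₂ = {s₂}) ∧
        (c = 0 →
          E.thresholds₂ c p₁ p₂ = {(s₁, s₂)} ∧
          ∀ D : Disclosure.DecisionProblem.{u}, E.BetterWithTwo D c p₁ p₂) ∧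
        (c < 0 →
          (∀ e ∈ E.thresholds₂ c p₁ p₂, e ≤ (s₁, s₂) ∧
            (e = (s₁, s₂) ↔ s₁ = E.lo ∧ s₂ = E.lo)) ∧
          ∀ D : Disclosure.DecisionProblem.{u}, E.BetterWithTwo D c p₁ p₂) ∧
        (0 < c →
          (∀ e ∈ E.thresholds₂ c p₁ p₂, (s₁, s₂) ≤ e) ∧
          (E.thresholds₂ c p₁ p₂ = {(s₁, s₂)} ↔ s₁ = E.hi ∧ s₂ = E.hi) ∧
          ((s₁, s₂) ∈ E.thresholds₂ c p₁ p₂ ↔ s₁ = E.hi ∨ s₂ = E.hi))) ∧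
    -- With a disclosure cost, the best two-sender welfare may be higher than both best
    -- single-sender welfares,
    (∃ (E : Disclosure.Environment) (c p₁ p₂ w w₁ w₂ : ℝ),
      0 < c ∧ p₁ ∈ Set.Ioo (0 : ℝ) 1 ∧ p₂ ∈ Set.Ioo (0 : ℝ) 1 ∧
      E.IsBestWelfare₂ Disclosure.quadraticLoss c p₁ p₂ w ∧
      E.IsBestWelfare₁ Disclosure.quadraticLoss c p₁ w₁ ∧
      E.IsBestWelfare₁ Disclosure.quadraticLoss c p₂ w₂ ∧
      w₁ < w ∧ w₂ < w) ∧
    -- and it may be lower than both.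
    (∃ (E : Disclosure.Environment) (c p₁ p₂ w w₁ w₂ : ℝ),
      0 < c ∧ p₁ ∈ Set.Ioo (0 : ℝ) 1 ∧ p₂ ∈ Set.Ioo (0 : ℝ) 1 ∧
      E.IsBestWelfare₂ Disclosure.quadraticLoss c p₁ p₂ w ∧
      E.IsBestWelfare₁ Disclosure.quadraticLoss c p₁ w₁ ∧
      E.IsBestWelfare₁ Disclosure.quadraticLoss c p₂ w₂ ∧
      w < w₁ ∧ w < w₂) := by
  have hp : (2 / 5 : ℝ) ∈ Ioo (0 : ℝ) 1 := by norm_num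
  refine ⟨fun E c p₁ p₂ hp₁ hp₂ => ⟨fun p _ σ h => h.exists_hasThreshold,
    fun σ₁ σ₂ h => h.exists_hasThreshold hp₁ hp₂, ?_⟩, ?_, ?_⟩
  · obtain ⟨s₁, hs₁⟩ := exists_isLeast_thresholds₁ (E := E) c hp₁
    obtain ⟨s₂, hs₂⟩ := exists_isLeast_thresholds₁ (E := E) c hp₂
    refine ⟨s₁, s₂, hs₁, hs₂, fun hc => ⟨thresholds₁_eq_singleton hp₁ hc hs₁.1,
      thresholds₁_eq_singleton hp₂ hc hs₂.1⟩, ?_, fun hc => ⟨fun e he => ?_, fun D =>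
      betterWithTwo D hp₁ hp₂ hc.le⟩, fun hc => ?_⟩
    · rintro rfl
      exact ⟨thresholds₂_zero hp₁ hp₂ hs₁.1 hs₂.1, fun D => betterWithTwo D hp₁ hp₂ le_rfl⟩
    · have he' := (mem_thresholds₂_swap hp₁ hp₂).1 he
      have hle : e ≤ (s₁, s₂) := ⟨threshold₂_le_threshold₁ hp₁ hp₂ hc.le he hs₁.1,
        threshold₂_le_threshold₁ hp₂ hp₁ hc.le he' hs₂.1⟩
      refine ⟨hle, ?_, ?_⟩
      · rintro rfl
        exact ⟨eq_lo_of_threshold₂_eq hp₁ hp₂ hc he hs₁.1 hs₂.1,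
          eq_lo_of_threshold₂_eq hp₂ hp₁ hc he' hs₂.1 hs₁.1⟩
      · rintro ⟨rfl, rfl⟩
        obtain ⟨h1, h2⟩ := thresholds₂_subset hp₁ hp₂ he
        exact le_antisymm hle (Prod.le_def.2 ⟨h1.1, h2.1⟩)
    · have hge : ∀ e ∈ E.thresholds₂ c p₁ p₂, (s₁, s₂) ≤ e := fun e he =>
        ⟨threshold₁_le_threshold₂ hp₁ hp₂ hc.le he hs₁, threshold₁_le_threshold₂ hp₂ hp₁ hc.le
          ((mem_thresholds₂_swap hp₁ hp₂).1 he) hs₂⟩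
      -- Whether complete nondisclosure is an equilibrium does not depend on the sender.
      have hhi : E.hi ∈ E.thresholds₁ c p₁ ↔ E.hi ∈ E.thresholds₁ c p₂ := by
        rw [hi_mem_thresholds₁_iff, hi_mem_thresholds₁_iff]
      have hmem : (s₁, s₂) ∈ E.thresholds₂ c p₁ p₂ ↔ s₁ = E.hi ∨ s₂ = E.hi := by
        refine ⟨fun h => eq_hi_or_eq_hi hp₁ hp₂ hc h hs₁.1, ?_⟩
        rintro (rfl | rfl)
        · exact (mem_thresholds₂_swap hp₁ hp₂).2
            (mk_hi_mem_thresholds₂ hp₂ hp₁ hc.le hs₁.1 hs₂.1)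
        · exact mk_hi_mem_thresholds₂ hp₁ hp₂ hc.le hs₂.1 hs₁.1
      refine ⟨hge, ⟨fun h => ?_, ?_⟩, hmem⟩
      · have hboth : E.hi ∈ E.thresholds₁ c p₁ ∧ E.hi ∈ E.thresholds₁ c p₂ := by
          rcases hmem.1 (h ▸ rfl) with e | e
          · have := e ▸ hs₁.1
            exact ⟨this, hhi.1 this⟩
          · have := e ▸ hs₂.1
            exact ⟨hhi.2 this, this⟩
        have : (E.hi, E.hi) ∈ E.thresholds₂ c p₁ p₂ :=
          mk_hi_mem_thresholds₂ hp₁ hp₂ hc.le hboth.2 hboth.1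
        rw [h, mem_singleton_iff, Prod.ext_iff] at this
        exact ⟨this.1.symm, this.2.symm⟩
      · intro h
        refine Subset.antisymm (fun e he => ?_) (singleton_subset_iff.2 (hmem.2 (.inl h.1)))
        obtain ⟨h1, h2⟩ := thresholds₂_subset hp₁ hp₂ he
        exact le_antisymm (Prod.le_def.2 ⟨h1.2.trans_eq h.1.symm, h2.2.trans_eq h.2.symm⟩) (hge e he)
  · obtain ⟨c, w, w₁, hc, h₂, h₁, hlt⟩ := exists_welfare_gain spikeEnvironment hp
    exact ⟨_, c, _, _, w, w₁, w₁, hc, hp, hp, h₂, h₁, h₁, hlt, hlt⟩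
  · obtain ⟨E, c, w, w₁, hc, h₂, h₁, hlt⟩ := exists_welfare_loss
    exact ⟨E, c, _, _, w, w₁, w₁, hc, hp, hp, h₂, h₁, h₁, hlt, hlt⟩
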